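/- **Setting.** There are $M$ agents, each with $K$ arms. Agent $m$ draws i.i.d. pairs $(x,r)\sim\mathcal D_m$ of a context $x\in\mathcal X_m$ and a reward vector $r\in[0,1]^K$, picks an arm $a$ and receives $r(a)$; $\mu_m(x,a)=\mathbb E[r(a)\mid x]$. All agents act at every time step $t=1,2,\dots$; epoch $l\ge 1$ consists of the steps $\tau^{l-1}+1,\dots,\tau^l$, where $0=\tau^0<\tau^1<\cdots$; $E^l=\tau^l-\tau^{l-1}$, and $l(T)=\min\{l: T\le\tau^l\}$. With $\pi^*_m(x)\in\arg\max_a\mu_m(x,a)$, the regret is $$\mathrm{Reg}(T)=\mathbb E\Big[\sum_{m=1}^M\sum_{t=1}^T\big(\mu_m(x_{m,t},\pi_m^*(x_{m,t}))-\mu_m(x_{m,t},a_{m,t})\big)\Big].$$ The reward functions $f_{m,\omega_m}(x,a)$ of agent $m$ are parametrized by $\omega_m=(\omega^\alpha,\omega_m^\beta)\in\mathbb R^{d^\alpha}\times\mathbb R^{d_m^\beta}$ with $d^\alpha\ge1$. Let $\Omega^\alpha\subseteq\mathbb R^{d^\alpha}$ and $\Omega^\beta_m\subseteq\mathbb R^{d^\beta_m}$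 be convex, $\Omega=\Omega^\alpha\times\prod_m\Omega^\beta_m$; the $f_{m,\omega_m}$ are measurable, jointly in $(\omega_m,x)$, and bounded uniformly over $\omega\in\Omega$. There are true parameters $(\omega^{\alpha,*},\omega^{\beta,*}_{[M]})\in\Omega$ with $f_{m,(\omega^{\alpha,*},\omega_m^{\beta,*})}(x,a)=\mu_m(x,a)$ for all $m$, all $a$ and almost all $x$. The losses $\ell_m(z;r)$ are, for each $z$, measurable in $r$ and bounded over $r\in[0,1]$. For a dataset $\mathcal S$ with $n$ samples $(x_m^i,a_m^i,r_m^i)$ of each agent, put $\widehat{\mathcal L}_m(\omega_m;\mathcal S)=\frac1n\sum_i\ell_m(f_{m,\omega_m}(x_m^i,a_m^i);r_m^i)$ and $\widehat{\mathcal L}(\omega^\alpha,\omega^\beta_{[M]};\mathcal S)=\frac1M\sum_m\widehat{\mathcal L}_m(\omega^\alpha,\omega^\beta_m;\mathcal S)$. The personalized Rademacher complexity is $$\mathfrak P(n)=\sup\ \mathbb E_{\mathcal S,\sigma}\Big[\sup_{\omega\in\Omega}\sum_{m}\frac1{Mn}\sum_{i=1}^n\sigma_{m,i}\,\ell_m(f_{m,\omega_m}(x_m^i,a_m^i);r_m^i)\Big],$$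 with independent uniform signs $\sigma_{m,i}$, where the outer supremum is over all laws $\mathcal D'_m$ of $(x,r)\in\mathcal X_m\times[0,1]^K$ and all arm selection rules $p'_m(\cdot\mid x)$, and the samples $(x,a,r(a))$ of $\mathcal S$ are independent with $(x,r)\sim\mathcal D'_m$, $a\sim p'_m(\cdot\mid x)$. Write $\mathfrak P^l=\mathfrak P(E^l)$ and assume $\mathfrak P^l>0$. **Protocol LSGD-PFL**, with $\rho$ communication rounds, $\kappa\ge1$ local updates per round, step size $\eta>0$ and weight decay $q\in[0,1)$. Every agent keeps a local copy $\omega^\alpha_{(m)}$ of the shared parameters and its own $\omega^\beta_m$; all start from a fixed point of $\Omega$. In each of $\rho\kappa$ local steps each agent draws one of its samples uniformly at random, independently, and with the gradient of the loss $\ell$ on that sample sets $\omega^\alpha_{(m)}\leftarrow\omega^\alpha_{(m)}-\eta\nabla_{\omega^\alpha}\ell$, $\omega^\beta_m\leftarrow\omega^\beta_m-\frac\eta M\nabla_{\omega^\beta_m}\ell$. After every $\kappa$ local steps there is one communication round: the copies $\omega^\alpha_{(m)}$ are replaced by their average. The output is the average, with weights proportional to $(1-q)^{-(k+1)}$, of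 the iterates $\big(\frac1M\sum_m\omega^\alpha_{(m)},\omega^\beta_{[M]}\big)$ after $k=0,\dots,\rho\kappa-1$ local steps. **FedIGW.** In epoch $l$, given estimates $\widehat f^l_m$ ($\widehat f^1_m=0$), agent $m$ plays $a\ne\widehat a:=\arg\max\widehat f^l_m(x,\cdot)$ with probability $1/(K+\gamma^l(\widehat f^l_m(x,\widehat a)-\widehat f^l_m(x,a)))$ and $\widehat a$ with the remaining probability. At the end of epoch $l$, LSGD-PFL with $\rho^l$ rounds and $\kappa^l$ local updates per round is run on the data of epoch $l$ only; its output gives $\widehat f^{l+1}_m$. The rates are $\gamma^l=\sqrt{K\mu_f/\mathfrak P^{l-1}}$, and it is assumed that $\gamma^l\le\gamma^{l+1}$ for $l\ge2$. **Assumptions.** Let $\mu_f,\mu_\omega,\beta_{\omega^\alpha},\beta_{\omega^\beta}>0$ and $\sigma_b,G_b\ge0$. 1. For $r\in[0,1]$, $\ell_m(\cdot\,;r)$ is differentiable and $\mu_f$-strongly convex; for all $m,a$ and almost all $x$, $\mathbb E[\ell_m(\mu_m(x,a);r(a))\mid x]=\inf_{y\in\mathbb R}\mathbb E[\ell_m(y;r(a))\mid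 x]$. 2. For every dataset with rewards in $[0,1]$ and $n=E^l$ samples per agent, $l\ge1$: * the loss on each sample is differentiable in $\omega_m\in\mathbb R^{d^\alpha}\times\mathbb R^{d^\beta_m}$; each $\widehat{\mathcal L}_m$ is convex in $\omega_m$, and $\widehat{\mathcal L}$ is $\mu_\omega$-strongly convex in $(\omega^\alpha,\omega^\beta_{[M]})$; * each $\widehat{\mathcal L}_m$ is $\beta_{\omega^\alpha}$-smooth in $\omega^\alpha$ and $M\beta_{\omega^\beta}$-smooth in $\omega^\beta_m$; * on $\Omega$, the gradients in $\omega^\alpha$ and in $\omega^\beta_m$ of the loss on a uniformly drawn sample of agent $m$ have variance at most $\sigma_b^2$, and $\frac1M\sum_m\|\nabla_{\omega_m}\widehat{\mathcal L}_m\|_2^2\le G_b^2$; * for step sizes $\eta\le\min\{1/\beta_{\omega^\beta},1/(\kappa^l\beta_{\omega^\alpha})\}$ the local parameters in LSGD-PFL stay in $\Omega$, for all numbers of rounds and all drawn samples. **Claim.** There are a universal constant $C$ and a rule that computes the number $\rho^l$ of rounds, the step size and the weight decay of LSGD-PFL in epoch $l$ from $M,\kappa^l,\mu_\omega,\beta_{\omega^\alpha},\beta_{\omega^\beta},\sigma_b,G_b,\mathfrak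 P^l$ alone, such that, for all such problems and all $T$, $$\mathrm{Reg}(T)\le C\Big(ME^1+\sum_{l=2}^{l(T)}\sqrt{K\mathfrak P^{l-1}/\mu_f}\;ME^l\Big),$$ and the total number of communication rounds satisfies $$\sum_{l=1}^{l(T)}\rho^l\le C\sum_{l=1}^{l(T)}\log\!\Big(2+\frac{G_b^2}{\mu_\omega\mathfrak P^l}\Big)\left(\frac{\max\{\beta_{\omega^\beta}/\kappa^l,\beta_{\omega^\alpha}\}}{\mu_\omega}+\frac{\sigma_b^2}{\mu_\omega\kappa^lM\mathfrak P^l}+\sqrt{\frac{\beta_{\omega^\alpha}(G_b^2+\sigma_b^2)}{\mu_\omega^2\mathfrak P^l}}\right).$$ -/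

import Mathlib

open MeasureTheory ProbabilityTheory
open scoped RealInnerProductSpace ENNReal

noncomputable section

namespace FedIGW

/-! ### Convexity and smoothness of a differentiable function, in first-order form -/

/-- `F` is differentiable and `μ`-strongly convex on the whole space. -/
def StronglyConvex {H : Type*} [NormedAddCommGroup H] [InnerProductSpace ℝ H] [CompleteSpace H]
    (μ : ℝ) (F : H → ℝ) : Prop :=
  Differentiable ℝ F ∧ ∀ w w' : H, F w' - F w ≥ ⟪gradient F w, w' - w⟫ + μ / 2 * ‖w' - w‖ ^ 2

/-- `F` is differentiable and `β`-smooth on the whole space. -/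
def Smooth {H : Type*} [NormedAddCommGroup H] [InnerProductSpace ℝ H] [CompleteSpace H]
    (β : ℝ) (F : H → ℝ) : Prop :=
  Differentiable ℝ F ∧ ∀ w w' : H, F w' - F w ≤ ⟪gradient F w, w' - w⟫ + β / 2 * ‖w' - w‖ ^ 2

/-! ### The personalized federated contextual bandit -/

/-- The data of a personalized federated contextual bandit with agents `Fin M`, arms `Fin K` for
every agent, and context spaces `X m`. No property beyond the `D m` being probability measures is
part of the structure. -/
structure Bandit (M K : ℕ) (X : Fin M → Type*) [∀ m, MeasurableSpace (X m)] where
  /-- joint law of the context and of the reward vector of agent `m` -/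
  D : ∀ m, Measure (X m × (Fin K → ℝ))
  isProb : ∀ m, IsProbabilityMeasure (D m)
  /-- number of globally shared parameters -/
  dα : ℕ
  /-- number of personal parameters of each agent -/
  dβ : Fin M → ℕ
  /-- the parametrized reward functions of agent `m` -/
  f : ∀ m, EuclideanSpace ℝ (Fin dα) → EuclideanSpace ℝ (Fin (dβ m)) → X m → Fin K → ℝ
  /-- the loss function of agent `m`: first the prediction, then the reward -/
  ℓ : Fin M → ℝ → ℝ → ℝ
  /-- the region of shared parameters -/
  Ωα : Set (EuclideanSpace ℝ (Fin dα))
  /-- the region of personal parameters of agent `m` -/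
  Ωβ : ∀ m, Set (EuclideanSpace ℝ (Fin (dβ m)))
  /-- the starting point of the learning protocol: shared parameters -/
  startα : EuclideanSpace ℝ (Fin dα)
  /-- the starting point of the learning protocol: personal parameters -/
  startβ : ∀ m, EuclideanSpace ℝ (Fin (dβ m))

attribute [instance] Bandit.isProb

/-- A dataset with `n` samples `(x, a, r)` of every agent. -/
abbrev Dataset {M : ℕ} (K : ℕ) (X : Fin M → Type*) (n : ℕ) := ∀ m, Fin n → X m × Fin K × ℝ

/-- All rewards of the dataset lie in `[0, 1]`. -/
def Dataset.Valid {M K : ℕ} {X : Fin M → Type*} {n : ℕ} (S : Dataset K X n) : Prop :=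
  ∀ m i, (S m i).2.2 ∈ Set.Icc (0 : ℝ) 1

/-! ### Inverse gap weighting -/

/-- The maximizer of `v` (the first one, if there are several). -/
def greedy {K : ℕ} [NeZero K] (v : Fin K → ℝ) : Fin K :=
  sInf {a | ∀ b, v b ≤ v a}

/-- The inverse-gap-weighting probabilities for the estimated rewards `v` and the rate `γ`. -/
def igw {K : ℕ} [NeZero K] (γ : ℝ) (v : Fin K → ℝ) (a : Fin K) : ℝ :=
  if a = greedy v then
    1 - ∑ b ∈ Finset.univ.erase (greedy v), 1 / ((K : ℝ) + γ * (v (greedy v) - v b))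
  else 1 / ((K : ℝ) + γ * (v (greedy v) - v a))

/-- The law of `(x, a, r a)` when `(x, r) ∼ D` and then `a ∼ p (x)`. -/
def sampleLaw {K : ℕ} {Y : Type*} [MeasurableSpace Y] (D : Measure (Y × (Fin K → ℝ)))
    (p : Y → Fin K → ℝ) : Measure (Y × Fin K × ℝ) :=
  D.bind fun z => ∑ a, ENNReal.ofReal (p z.1 a) • Measure.dirac (z.1, a, z.2 a)

/-- The law of a dataset of `n` independent samples per agent. -/
def datasetLaw {M K : ℕ} {X : Fin M → Type*} [∀ m, MeasurableSpace (X m)] (n : ℕ)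
    (D : ∀ m, Measure (X m × (Fin K → ℝ))) (p : ∀ m, X m → Fin K → ℝ) :
    Measure (Dataset K X n) :=
  Measure.pi fun m => Measure.pi fun _ : Fin n => sampleLaw (D m) (p m)

/-! ### Tuning of the learning protocol -/

/-- Tuning of one run of the protocol: the number of communication rounds (global aggregations),
the step size, and the decay `q` in the weights `(1 - q) ^ (-(k + 1))` of the output. -/
structure Tuning where
  rounds : ℕ
  step : ℝ
  step_pos : 0 < step
  decay : ℝ
  decay_mem : decay ∈ Set.Ico (0 : ℝ) 1

/-- The constants from which the tuning is computed. -/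
structure Constants where
  /-- number of agents -/
  M : ℕ
  /-- number of local updates between two aggregations -/
  κ : ℕ
  /-- strong convexity -/
  μω : ℝ
  /-- smoothness in the shared parameters -/
  βα : ℝ
  /-- smoothness in the personal parameters -/
  ββ : ℝ
  /-- bound on the standard deviation of the stochastic gradients -/
  σ : ℝ
  /-- bound on the dissimilarity of the gradients -/
  G : ℝ
  /-- the target for the optimization error -/
  target : ℝ

/-! ### Epochs -/

/-- The length of epoch `l`, which consists of the time steps `τ (l - 1) + 1, …, τ l`. -/
def epochLength (τ : ℕ → ℕ) (l : ℕ) : ℕ := τ l - τ (l - 1)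

/-- The number of epochs up to the horizon `T`. -/
def epochCount (τ : ℕ → ℕ) (T : ℕ) : ℕ := sInf {l | T ≤ τ l}

namespace Bandit

variable {M K : ℕ} {X : Fin M → Type*} [∀ m, MeasurableSpace (X m)]

/-- Shared parameters. -/
abbrev Shared (P : Bandit M K X) := EuclideanSpace ℝ (Fin P.dα)

/-- Personal parameters of agent `m`. -/
abbrev Personal (P : Bandit M K X) (m : Fin M) := EuclideanSpace ℝ (Fin (P.dβ m))

/-- All parameters, with their joint Euclidean norm. -/
abbrev Joint (P : Bandit M K X) := WithLp 2 (P.Shared × PiLp 2 P.Personal)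

/-! ### Rewards, realizability, losses -/

/-- The conditional mean reward of arm `a` of agent `m` given the context `x`. -/
def meanReward (P : Bandit M K X) (m : Fin M) (x : X m) (a : Fin K) : ℝ :=
  ∫ r, r a ∂((P.D m).condKernel x)

/-- The loss of the optimal arm over the arm `a` in the context `x`. -/
def gap [NeZero K] (P : Bandit M K X) (m : Fin M) (x : X m) (a : Fin K) : ℝ :=
  P.meanReward m x (greedy (P.meanReward m x)) - P.meanReward m x a

/-- Loss of the parameters `(α, b)` of agent `m` on one sample. -/
def sampleLoss (P : Bandit M K X) (m : Fin M) (s : X m × Fin K × ℝ)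
    (α : P.Shared) (b : P.Personal m) : ℝ :=
  P.ℓ m (P.f m α b s.1 s.2.1) s.2.2

/-- Empirical loss of agent `m`. -/
def localLoss (P : Bandit M K X) {n : ℕ} (S : Dataset K X n) (m : Fin M)
    (α : P.Shared) (b : P.Personal m) : ℝ :=
  1 / (n : ℝ) * ∑ i, P.sampleLoss m (S m i) α b

/-- The objective of the personalized federated learning problem (all agents hold equally many
samples, so each has weight `1 / M`). -/
def totalLoss (P : Bandit M K X) {n : ℕ} (S : Dataset K X n) (w : P.Joint) : ℝ :=
  1 / (M : ℝ) * ∑ m, P.localLoss S m w.fst (w.snd m)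

/-- Regularity of the model: rewards in `[0, 1]`, measurability, bounded predictions over the
parameter region, the parameter region is convex and contains the starting point, and at least one
parameter is shared. -/
structure Regular (P : Bandit M K X) : Prop where
  shared_pos : 0 < P.dα
  reward_mem : ∀ m, ∀ᵐ z ∂P.D m, ∀ a, z.2 a ∈ Set.Icc (0 : ℝ) 1
  measurable_f : ∀ m a, Measurable fun q : (P.Shared × P.Personal m) × X m =>
    P.f m q.1.1 q.1.2 q.2 a
  bounded_f : ∃ B, ∀ m, ∀ α ∈ P.Ωα, ∀ b ∈ P.Ωβ m, ∀ x a, |P.f m α b x a| ≤ B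
  measurable_loss : ∀ m z, Measurable (P.ℓ m z)
  bounded_loss : ∀ m z, ∃ B, ∀ r ∈ Set.Icc (0 : ℝ) 1, |P.ℓ m z r| ≤ B
  convexα : Convex ℝ P.Ωα
  convexβ : ∀ m, Convex ℝ (P.Ωβ m)
  startα_mem : P.startα ∈ P.Ωα
  startβ_mem : ∀ m, P.startβ m ∈ P.Ωβ m

/-- `(α, b)` are true parameters in the parameter region: the mean reward function of every agent
`m` is given by the shared parameters `α` and the personal parameters `b m`. -/
structure TrueParameter (P : Bandit M K X) (α : P.Shared) (b : ∀ m, P.Personal m) : Prop where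
  memα : α ∈ P.Ωα
  memβ : ∀ m, b m ∈ P.Ωβ m
  realizable : ∀ m, ∀ᵐ x ∂(P.D m).fst, ∀ a, P.f m α (b m) x a = P.meanReward m x a

/-- Conditions on the loss: `μf`-strong convexity in the prediction, and the prediction of the true
parameters minimizes the conditional expected loss over all predictions `y`. -/
structure LossCondition (P : Bandit M K X) (α : P.Shared) (b : ∀ m, P.Personal m) (μf : ℝ) :
    Prop where
  differentiable : ∀ m, ∀ r ∈ Set.Icc (0 : ℝ) 1, Differentiable ℝ fun z => P.ℓ m z r
  strongly_convex : ∀ m, ∀ r ∈ Set.Icc (0 : ℝ) 1, ∀ z z' : ℝ,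
    P.ℓ m z' r - P.ℓ m z r ≥ deriv (fun y => P.ℓ m y r) z * (z' - z) + μf / 2 * (z' - z) ^ 2
  optimal : ∀ m, ∀ᵐ x ∂(P.D m).fst, ∀ a, ∀ y : ℝ,
    ∫ r, P.ℓ m (P.f m α (b m) x a) (r a) ∂((P.D m).condKernel x)
      ≤ ∫ r, P.ℓ m y (r a) ∂((P.D m).condKernel x)

/-! ### The personalized Rademacher complexity -/

/-- The value of a random sign. -/
def sign (s : Bool) : ℝ := if s then 1 else -1

/-- The Rademacher complexity for `n` samples per agent, context-reward laws `D'` and arm selection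
rules `p`. -/
def rademacherAt (P : Bandit M K X) (n : ℕ) (D' : ∀ m, Measure (X m × (Fin K → ℝ)))
    (p : ∀ m, X m → Fin K → ℝ) : ℝ :=
  ∫ S : Dataset K X n, ∫ s : Fin M → Fin n → Bool,
    ⨆ w : P.Ωα × (∀ m, P.Ωβ m),
      ∑ m, 1 / ((M : ℝ) * n) * ∑ i, sign (s m i) * P.sampleLoss m (S m i) w.1 (w.2 m)
    ∂(uniformOn Set.univ) ∂(datasetLaw n D' p)

/-- The distribution-independent Rademacher complexity: the supremum over all context-reward laws
with rewards in `[0, 1]` and all arm selection rules. -/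
def rademacher (P : Bandit M K X) (n : ℕ) : ℝ :=
  sSup {v | ∃ (D' : ∀ m, Measure (X m × (Fin K → ℝ))) (p : ∀ m, X m → Fin K → ℝ),
    (∀ m, IsProbabilityMeasure (D' m)) ∧
    (∀ m, ∀ᵐ z ∂D' m, ∀ a, z.2 a ∈ Set.Icc (0 : ℝ) 1) ∧
    (∀ m a, Measurable fun x => p m x a) ∧
    (∀ m x, p m x ∈ stdSimplex ℝ (Fin K)) ∧
    v = P.rademacherAt n D' p}

/-! ### The protocol LSGD-PFL -/

/-- The local copies of all agents: agent `m` holds its copy of the shared parameters and its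
personal parameters. -/
abbrev State (P : Bandit M K X) := ∀ m, P.Shared × P.Personal m

/-- Gradient of the loss on one sample in the shared parameters. -/
def gradα (P : Bandit M K X) (m : Fin M) (s : X m × Fin K × ℝ) (α : P.Shared)
    (b : P.Personal m) : P.Shared :=
  gradient (fun α' => P.sampleLoss m s α' b) α

/-- Gradient of the loss on one sample in the personal parameters. -/
def gradβ (P : Bandit M K X) (m : Fin M) (s : X m × Fin K × ℝ) (α : P.Shared)
    (b : P.Personal m) : P.Personal m :=
  gradient (fun b' => P.sampleLoss m s α b') b

/-- One local stochastic gradient step of every agent, with the sampled indices `idx`. The weight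
`1 / M` is that of the local loss in the objective. -/
def localStep (P : Bandit M K X) {n : ℕ} (S : Dataset K X n) (η : ℝ) (idx : Fin M → Fin n)
    (st : P.State) : P.State := fun m =>
  ((st m).1 - η • P.gradα m (S m (idx m)) (st m).1 (st m).2,
   (st m).2 - (η / (M : ℝ)) • P.gradβ m (S m (idx m)) (st m).1 (st m).2)

/-- The average of the local copies of the shared parameters. -/
def meanShared (P : Bandit M K X) (st : P.State) : P.Shared :=
  (1 / (M : ℝ)) • ∑ m, (st m).1

/-- Communication: the shared parameters, and only these, are averaged and sent back. -/
def aggregate (P : Bandit M K X) (st : P.State) : P.State := fun m =>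
  (P.meanShared st, (st m).2)

/-- The state after `k` local steps in a run with `N` local steps in total, where each `κ`-th local
step is followed by an aggregation. -/
def iterate (P : Bandit M K X) {n : ℕ} (S : Dataset K X n) (κ : ℕ) (η : ℝ) {N : ℕ}
    (ξ : Fin M → Fin N → Fin n) : ℕ → P.State
  | 0 => fun m => (P.startα, P.startβ m)
  | k + 1 =>
    if h : k < N then
      let st := P.localStep S η (fun m => ξ m ⟨k, h⟩) (P.iterate S κ η ξ k)
      if κ ∣ k + 1 then P.aggregate st else st
    else P.iterate S κ η ξ k

/-- Output of the protocol, shared parameters: weighted average over the iterates. -/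
def outputα (P : Bandit M K X) {n : ℕ} (S : Dataset K X n) (κ : ℕ) (c : Tuning)
    (ξ : Fin M → Fin (c.rounds * κ) → Fin n) : P.Shared :=
  (∑ k ∈ Finset.range (c.rounds * κ), ((1 - c.decay) ^ (k + 1))⁻¹)⁻¹ •
    ∑ k ∈ Finset.range (c.rounds * κ),
      ((1 - c.decay) ^ (k + 1))⁻¹ • P.meanShared (P.iterate S κ c.step ξ k)

/-- Output of the protocol, personal parameters: weighted average over the iterates. -/
def outputβ (P : Bandit M K X) {n : ℕ} (S : Dataset K X n) (κ : ℕ) (c : Tuning)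
    (ξ : Fin M → Fin (c.rounds * κ) → Fin n) (m : Fin M) : P.Personal m :=
  (∑ k ∈ Finset.range (c.rounds * κ), ((1 - c.decay) ^ (k + 1))⁻¹)⁻¹ •
    ∑ k ∈ Finset.range (c.rounds * κ),
      ((1 - c.decay) ^ (k + 1))⁻¹ • (P.iterate S κ c.step ξ k m).2

/-- Conditions for LSGD-PFL on datasets with `n` samples per agent and with `κ` local updates per
round. -/
structure LSGDCondition (P : Bandit M K X) (n κ : ℕ) (μω βα ββ σ G : ℝ) : Prop where
  /-- the losses on single samples are differentiable in the parameters -/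
  differentiable : ∀ m (s : X m × Fin K × ℝ), s.2.2 ∈ Set.Icc (0 : ℝ) 1 →
    Differentiable ℝ fun q : P.Shared × P.Personal m => P.sampleLoss m s q.1 q.2
  convex : ∀ S : Dataset K X n, S.Valid → ∀ m,
    ConvexOn ℝ Set.univ fun q : P.Shared × P.Personal m => P.localLoss S m q.1 q.2
  strongly_convex : ∀ S : Dataset K X n, S.Valid → StronglyConvex μω (P.totalLoss S)
  smoothα : ∀ S : Dataset K X n, S.Valid → ∀ m b, Smooth βα fun α => P.localLoss S m α b
  smoothβ : ∀ S : Dataset K X n, S.Valid → ∀ m α, Smooth (M * ββ) fun b => P.localLoss S m α b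
  varianceα : ∀ S : Dataset K X n, S.Valid → ∀ m, ∀ α ∈ P.Ωα, ∀ b ∈ P.Ωβ m,
    1 / (n : ℝ) * ∑ i, ‖P.gradα m (S m i) α b
      - gradient (fun α' => P.localLoss S m α' b) α‖ ^ 2 ≤ σ ^ 2
  varianceβ : ∀ S : Dataset K X n, S.Valid → ∀ m, ∀ α ∈ P.Ωα, ∀ b ∈ P.Ωβ m,
    1 / (n : ℝ) * ∑ i, ‖P.gradβ m (S m i) α b
      - gradient (fun b' => P.localLoss S m α b') b‖ ^ 2 ≤ σ ^ 2
  dissimilarity : ∀ S : Dataset K X n, S.Valid → ∀ α ∈ P.Ωα, ∀ b : ∀ m, P.Personal m,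
    (∀ m, b m ∈ P.Ωβ m) →
    1 / (M : ℝ) * ∑ m, (‖gradient (fun α' => P.localLoss S m α' (b m)) α‖ ^ 2
      + ‖gradient (fun b' => P.localLoss S m α b') (b m)‖ ^ 2) ≤ G ^ 2
  /-- with small step sizes the local parameters do not leave the parameter region -/
  stays : ∀ S : Dataset K X n, S.Valid → ∀ η : ℝ, 0 < η → η ≤ 1 / ββ → η ≤ 1 / (κ * βα) →
    ∀ (N : ℕ) (ξ : Fin M → Fin N → Fin n), ∀ k ≤ N, ∀ m,
      (P.iterate S κ η ξ k m).1 ∈ P.Ωα ∧ (P.iterate S κ η ξ k m).2 ∈ P.Ωβ m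

/-! ### FedIGW with LSGD-PFL -/

/-- The data of epoch `l`: the samples of the agents, and the sample indices that are drawn by the
run of LSGD-PFL at the end of the epoch. -/
abbrev EpochData (_P : Bandit M K X) (τ κ : ℕ → ℕ) (c : ℕ → Tuning) (l : ℕ) :=
  Dataset K X (epochLength τ l) ×
    (Fin M → Fin ((c l).rounds * κ l) → Fin (epochLength τ l))

/-- The estimated reward functions that LSGD-PFL returns at the end of epoch `l`. -/
def estimate (P : Bandit M K X) (τ κ : ℕ → ℕ) (c : ℕ → Tuning) (l : ℕ)
    (d : P.EpochData τ κ c l) (m : Fin M) (x : X m) (a : Fin K) : ℝ :=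
  P.f m (P.outputα d.1 (κ l) (c l) d.2) (P.outputβ d.1 (κ l) (c l) d.2 m) x a

/-- The law of the data of epoch `l` when the arms are chosen by inverse gap weighting with the
estimated reward functions `fhat`. -/
def epochLawGiven [NeZero K] (P : Bandit M K X) (τ κ : ℕ → ℕ) (c : ℕ → Tuning) (γ : ℕ → ℝ)
    (l : ℕ) (fhat : ∀ m, X m → Fin K → ℝ) : Measure (P.EpochData τ κ c l) :=
  (datasetLaw (epochLength τ l) P.D fun m x => igw (γ l) (fhat m x)).prod (uniformOn Set.univ)

/-- The law of the data of epoch `l` in a run of FedIGW. The first epoch uses the estimate `0`;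
each later epoch depends on the past through the estimate that was returned at the end of the
previous epoch, because the datasets are emptied at the end of each epoch. Epochs are numbered
from `1`. -/
def epochLaw [NeZero K] (P : Bandit M K X) (τ κ : ℕ → ℕ) (c : ℕ → Tuning) (γ : ℕ → ℝ) :
    ∀ l, Measure (P.EpochData τ κ c l)
  | 0 => 0
  | 1 => P.epochLawGiven τ κ c γ 1 fun _ _ _ => 0
  | l + 2 => (P.epochLaw τ κ c γ (l + 1)).bind fun d =>
      P.epochLawGiven τ κ c γ (l + 2) (P.estimate τ κ c (l + 1) d)

/-- The expected regret of all agents in the time steps `1, …, T`: the `i`-th sample of epoch `l`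
(counted from `0`) belongs to the time step `τ (l - 1) + i + 1`. -/
def regret [NeZero K] (P : Bandit M K X) (τ κ : ℕ → ℕ) (c : ℕ → Tuning) (γ : ℕ → ℝ)
    (T : ℕ) : ℝ :=
  ∑ l ∈ Finset.Icc 1 (epochCount τ T), ∫ d, ∑ m, ∑ i : Fin (epochLength τ l),
    (if τ (l - 1) + i + 1 ≤ T then P.gap m (d.1 m i).1 (d.1 m i).2.1 else 0)
    ∂(P.epochLaw τ κ c γ l)

/-- The number of communication rounds up to the horizon `T`. -/
def communicationRounds (τ : ℕ → ℕ) (c : ℕ → Tuning) (T : ℕ) : ℕ :=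
  ∑ l ∈ Finset.Icc 1 (epochCount τ T), (c l).rounds

/-- The learning rate of epoch `l`, computed from the complexity `𝔓` for the length of the previous
epoch. -/
def learningRate (P : Bandit M K X) (τ : ℕ → ℕ) (μf : ℝ) (l : ℕ) : ℝ :=
  √(K * μf / P.rademacher (epochLength τ (l - 1)))

end Bandit

end FedIGW

end

/-!
The proof has three independent parts, and a fourth one that joins them.

**Optimization.** Fix a dataset. The empirical loss of all agents has a global minimizer, which need
not lie in the parameter region, and the partial gradients vanish there (in the shared parameters:
on average over the agents). For the averaged iterate, one local step contracts the squared distance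
to the minimizer in mean, up to the noise of the stochastic gradients and up to the disagreement of
the local copies (`Bandit.expect_sqDist_advance_le`). The squared norm of the step is absorbed by the
Bregman divergences of the local losses at the local copies, which by convexity and smoothness in
each of the two blocks control the differences of the gradients (`BlockSmooth.cocoercive`). The
disagreement stays small since every communication round resets it
(`Bandit.expect_drift_iterate_le`). The weighted average of the iterates solves this recursion, and
with the step size `1 / invStep` its optimization error is of the order of the target
(`Bandit.expect_optimization_error_le`) after the claimed number of rounds
(`Constants.Admissible.rounds_le`).

**Statistics.** Symmetrization bounds the mean uniform deviation of the empirical from the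
population risk by twice the complexity (`integral_iSup_sub_le`). Strong convexity of the loss in the
prediction and optimality of the true mean rewards turn excess risk into mean squared distance
(`sq_dist_le_excess_risk`). Hence, whatever arm selection rule an epoch uses, the estimates returned
at its end have a mean squared error of the order `M 𝔓 / μf` under that rule
(`Bandit.lintegral_predictionError_output_le`).

**Inverse gap weighting.** In a fixed context, let the distortion be the least `D` such that true and
estimated gaps, scaled by the learning rate `γ`, are at most twice each other up to `D`. The regret of
one step is at most `(2 K + D) / γ` (`mul_sum_igw_mul_gapOf_le`). From one epoch to the next `D` is
halved, up to `K / 2` and to `8 γ'²` times the squared error of the new estimate under the arm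
selection of the old one (`gapDistortion_step_le`).

**Recursion over the epochs.** Since `γ'² = K μf / 𝔓`, the scaled squared error is of the order
`M K` in mean, and the mean distortion, which is `0` in the first epoch because its learning rate is
`0`, stays of the order `M K` forever (`Bandit.lintegral_distortion_epochLaw_le`). Every step of
epoch `l` thus has a mean regret of the order `M K / γ = M √(K 𝔓 / μf)`.

Measurability of the output of the protocol in the data is never used. For a fixed dataset the
average over the drawn indices is a finite sum, and across the epochs only upper bounds of lower
integrals are needed, which hold for a composition of laws without measurability.
-/

namespace FedIGW

open scoped BigOperators

/-! ### Averages over finitely many independent draws -/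

/-- Redrawing one component of a uniformly distributed element does not change an average. The
component is described by `get` and is overwritten by `up`. -/
lemma expect_resample {A B : Type*} [Fintype A] [Fintype B] [Nonempty B]
    (up : A → B → A) (get : A → B) (get_up : ∀ a b, get (up a b) = b)
    (up_up : ∀ a b c, up (up a b) c = up a c) (up_get : ∀ a, up a (get a) = a) (h : A → ℝ) :
    𝔼 a, 𝔼 b, h (up a b) = 𝔼 a, h a := by
  have hinv : Function.Involutive fun p : A × B => (up p.1 p.2, get p.1) := by
    rintro ⟨a, b⟩
    simp [get_up, up_up, up_get]
  calc 𝔼 a, 𝔼 b, h (up a b)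
      = 𝔼 p : A × B, h (up p.1 p.2) := by
        rw [← Finset.univ_product_univ, Finset.expect_product]
    _ = 𝔼 p : A × B, h p.1 :=
        Finset.expect_equiv (hinv.toPerm _) (by simp) (by intro p _; rfl)
    _ = 𝔼 a, 𝔼 _b : B, h a := by
        rw [← Finset.univ_product_univ, Finset.expect_product]
    _ = 𝔼 a, h a := by simp

lemma expect_resample_coord {ι J : Type*} [Fintype ι] [DecidableEq ι] [Fintype J] [Nonempty J]
    (m : ι) (h : (ι → J) → ℝ) :
    𝔼 x, 𝔼 j, h (Function.update x m j) = 𝔼 x, h x :=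
  expect_resample (fun x j => Function.update x m j) (fun x => x m) (by simp) (by simp)
    (by simp) h

lemma expect_coord {ι J : Type*} [Fintype ι] [DecidableEq ι] [Fintype J] [Nonempty J]
    (m : ι) (h : J → ℝ) : 𝔼 x : ι → J, h (x m) = 𝔼 j, h j := by
  rw [← expect_resample_coord m]
  simp

section Variance

variable {H : Type*} [NormedAddCommGroup H] [InnerProductSpace ℝ H]

/-- Independent centred vectors are orthogonal in mean. -/
lemma expect_norm_sub_sum_sq {ι J : Type*} [Fintype ι] [DecidableEq ι] [Fintype J] [Nonempty J]
    (Z : ι → J → H) (hZ : ∀ m, ∑ j, Z m j = 0) (d : H) (s : Finset ι) :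
    𝔼 x : ι → J, ‖d - ∑ m ∈ s, Z m (x m)‖ ^ 2 = ‖d‖ ^ 2 + ∑ m ∈ s, 𝔼 j, ‖Z m j‖ ^ 2 := by
  induction s using Finset.induction_on with
  | empty => simp
  | insert a s ha ih =>
    have hx : ∀ x : ι → J, ‖d - ∑ m ∈ insert a s, Z m (x m)‖ ^ 2 =
        ‖d - ∑ m ∈ s, Z m (x m)‖ ^ 2 + -2 * ⟪d - ∑ m ∈ s, Z m (x m), Z a (x a)⟫
          + ‖Z a (x a)‖ ^ 2 := by
      intro x
      rw [Finset.sum_insert ha, add_comm (Z a (x a)), ← sub_sub, norm_sub_sq_real]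
      ring
    have hcross : 𝔼 x : ι → J, -2 * ⟪d - ∑ m ∈ s, Z m (x m), Z a (x a)⟫ = 0 := by
      rw [← expect_resample_coord a]
      refine Finset.expect_eq_zero fun x _ => ?_
      have : ∀ j, d - ∑ m ∈ s, Z m (Function.update x a j m) = d - ∑ m ∈ s, Z m (x m) := by
        intro j
        congr 1
        refine Finset.sum_congr rfl fun m hm => ?_
        rw [Function.update_of_ne (by rintro rfl; exact ha hm)]
      simp only [this, Function.update_self]
      rw [Fintype.expect_eq_sum_div_card, ← Finset.mul_sum, ← inner_sum, hZ]
      simp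
    simp_rw [hx]
    rw [Finset.expect_add_distrib, Finset.expect_add_distrib, hcross, ih,
      expect_coord a (fun j => ‖Z a j‖ ^ 2), Finset.sum_insert ha]
    ring

/-- Mean of `‖d - t • ∑ X‖²` for independent vectors `X m` with means `c m`. -/
lemma expect_norm_sub_smul_sum_sq {ι J : Type*} [Fintype ι] [DecidableEq ι] [Fintype J]
    [Nonempty J] (X : ι → J → H) (c : ι → H) (hc : ∀ m, ∑ j, (X m j - c m) = 0) (d : H) (t : ℝ) :
    𝔼 x : ι → J, ‖d - t • ∑ m, X m (x m)‖ ^ 2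
      = ‖d - t • ∑ m, c m‖ ^ 2 + t ^ 2 * ∑ m, 𝔼 j, ‖X m j - c m‖ ^ 2 := by
  have h := expect_norm_sub_sum_sq (fun m j => t • (X m j - c m))
    (fun m => by rw [← Finset.smul_sum, hc, smul_zero]) (d - t • ∑ m, c m) Finset.univ
  have e : ∀ x : ι → J, d - t • ∑ m, c m - ∑ m, t • (X m (x m) - c m)
      = d - t • ∑ m, X m (x m) := by
    intro x
    rw [← Finset.smul_sum, Finset.sum_sub_distrib, smul_sub]
    abel
  simp_rw [e] at h
  rw [h, Finset.mul_sum]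
  congr 1
  refine Finset.sum_congr rfl fun m _ => ?_
  rw [Finset.mul_expect]
  refine Finset.expect_congr rfl fun j _ => ?_
  rw [norm_smul, mul_pow, Real.norm_eq_abs, sq_abs]

lemma norm_sum_sq_le {ι H : Type*} [Fintype ι] [NormedAddCommGroup H] (x : ι → H) :
    ‖∑ m, x m‖ ^ 2 ≤ Fintype.card ι * ∑ m, ‖x m‖ ^ 2 :=
  calc ‖∑ m, x m‖ ^ 2 ≤ (∑ m, ‖x m‖) ^ 2 := by gcongr; exact norm_sum_le _ _
    _ ≤ _ := sq_sum_le_card_mul_sum_sq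

/-- The mean is the best constant approximation in mean square. -/
lemma sum_norm_sub_mean_sq_le {ι : Type*} [Fintype ι] [Nonempty ι] (x : ι → H) (c : H) :
    ∑ m, ‖x m - (1 / (Fintype.card ι : ℝ)) • ∑ m, x m‖ ^ 2 ≤ ∑ m, ‖x m - c‖ ^ 2 := by
  set y := (1 / (Fintype.card ι : ℝ)) • ∑ m, x m with hy
  have hcard : (Fintype.card ι : ℝ) ≠ 0 := by simp
  have h0 : ∑ m, (x m - y) = 0 := by
    rw [Finset.sum_sub_distrib, Finset.sum_const, Finset.card_univ, hy, ← Nat.cast_smul_eq_nsmul ℝ,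
      smul_smul, mul_one_div_cancel hcard, one_smul, sub_self]
  have h : ∀ m, ‖x m - c‖ ^ 2 = ‖x m - y‖ ^ 2 + 2 * ⟪x m - y, y - c⟫ + ‖y - c‖ ^ 2 := by
    intro m
    rw [← norm_add_sq_real]
    congr 2
    abel
  simp_rw [h]
  rw [Finset.sum_add_distrib, Finset.sum_add_distrib, ← Finset.mul_sum, ← sum_inner, h0]
  simp only [inner_zero_left, mul_zero, add_zero, Finset.sum_const, nsmul_eq_mul]
  have : 0 ≤ ((Finset.univ : Finset ι).card : ℝ) * ‖y - c‖ ^ 2 := by positivity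
  linarith

end Variance

/-! ### Convex functions that are smooth in each of two blocks of variables -/

/-- First-order description of a convex function `φ` of two blocks of variables, with partial
gradients `gA` and `gB`, which is `βA`-smooth in the first and `βB`-smooth in the second block. -/
structure BlockSmooth {A B : Type*} [NormedAddCommGroup A] [InnerProductSpace ℝ A]
    [NormedAddCommGroup B] [InnerProductSpace ℝ B] (φ : A → B → ℝ) (gA : A → B → A)
    (gB : A → B → B) (βA βB : ℝ) : Prop where
  convex : ∀ a b a' b', ⟪gA a b, a' - a⟫ + ⟪gB a b, b' - b⟫ ≤ φ a' b' - φ a b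
  smoothA : ∀ a b a', φ a' b - φ a b ≤ ⟪gA a b, a' - a⟫ + βA / 2 * ‖a' - a‖ ^ 2
  smoothB : ∀ a b b', φ a b' - φ a b ≤ ⟪gB a b, b' - b⟫ + βB / 2 * ‖b' - b‖ ^ 2

namespace BlockSmooth

variable {A B : Type*} [NormedAddCommGroup A] [InnerProductSpace ℝ A]
  [NormedAddCommGroup B] [InnerProductSpace ℝ B] {φ : A → B → ℝ} {gA : A → B → A}
  {gB : A → B → B} {βA βB : ℝ}

/-- Convexity turns smoothness in each block into joint smoothness: `(a + u, b + v)` is the midpoint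
of `(a + 2 u, b)` and `(a, b + 2 v)`. -/
lemma joint_smooth (h : BlockSmooth φ gA gB βA βB) (a u : A) (b v : B) :
    φ (a + u) (b + v) - φ a b ≤ ⟪gA a b, u⟫ + ⟪gB a b, v⟫ + βA * ‖u‖ ^ 2 + βB * ‖v‖ ^ 2 := by
  have h1 := h.convex (a + u) (b + v) (a + (2 : ℝ) • u) b
  have h2 := h.convex (a + u) (b + v) a (b + (2 : ℝ) • v)
  have h3 := h.smoothA a b (a + (2 : ℝ) • u)
  have h4 := h.smoothB a b (b + (2 : ℝ) • v)
  have e1 : a + (2 : ℝ) • u - (a + u) = u := by rw [two_smul]; abel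
  have e2 : b - (b + v) = -v := by abel
  have e3 : a - (a + u) = -u := by abel
  have e4 : b + (2 : ℝ) • v - (b + v) = v := by rw [two_smul]; abel
  rw [e1, e2, inner_neg_right] at h1
  rw [e3, e4, inner_neg_right] at h2
  rw [add_sub_cancel_left, inner_smul_right, norm_smul, mul_pow] at h3 h4
  norm_num at h3 h4
  linarith

/-- Cocoercivity: the Bregman divergence controls the differences of the partial gradients. The
constants `4` are twice those of a single block, because of `joint_smooth`. -/
lemma cocoercive (h : BlockSmooth φ gA gB βA βB) (hA : 0 < βA) (hB : 0 < βB) (a a' : A)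
    (b b' : B) :
    ‖gA a b - gA a' b'‖ ^ 2 / (4 * βA) + ‖gB a b - gB a' b'‖ ^ 2 / (4 * βB)
      ≤ φ a' b' - φ a b - ⟪gA a b, a' - a⟫ - ⟪gB a b, b' - b⟫ := by
  set p := gA a b - gA a' b' with hp
  set q := gB a b - gB a' b' with hq
  have h1 := h.joint_smooth a' ((1 / (2 * βA)) • p) b' ((1 / (2 * βB)) • q)
  have h2 := h.convex a b (a' + (1 / (2 * βA)) • p) (b' + (1 / (2 * βB)) • q)
  have e1 : ⟪gA a b, p⟫ - ⟪gA a' b', p⟫ = ‖p‖ ^ 2 := by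
    rw [← inner_sub_left, ← hp, real_inner_self_eq_norm_sq]
  have e2 : ⟪gB a b, q⟫ - ⟪gB a' b', q⟫ = ‖q‖ ^ 2 := by
    rw [← inner_sub_left, ← hq, real_inner_self_eq_norm_sq]
  rw [add_sub_right_comm, inner_add_right, add_sub_right_comm, inner_add_right, inner_smul_right,
    inner_smul_right] at h2
  rw [inner_smul_right, inner_smul_right, norm_smul, norm_smul, mul_pow, mul_pow,
    Real.norm_eq_abs, Real.norm_eq_abs, sq_abs, sq_abs] at h1
  have e3 : ⟪gA a b, p⟫ = ⟪gA a' b', p⟫ + ‖p‖ ^ 2 := by linarith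
  have e4 : ⟪gB a b, q⟫ = ⟪gB a' b', q⟫ + ‖q‖ ^ 2 := by linarith
  rw [e3, e4] at h2
  have e5 : βA * ((1 / (2 * βA)) ^ 2 * ‖p‖ ^ 2) = ‖p‖ ^ 2 / (4 * βA) := by field_simp; ring
  have e6 : βB * ((1 / (2 * βB)) ^ 2 * ‖q‖ ^ 2) = ‖q‖ ^ 2 / (4 * βB) := by field_simp; ring
  have e7 : 1 / (2 * βA) * ‖p‖ ^ 2 = 2 * (‖p‖ ^ 2 / (4 * βA)) := by field_simp; ring
  have e8 : 1 / (2 * βB) * ‖q‖ ^ 2 = 2 * (‖q‖ ^ 2 / (4 * βB)) := by field_simp; ring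
  rw [e5, e6] at h1
  rw [mul_add, mul_add, e7, e8] at h2
  linarith

/-- The partial gradient in the first block is Lipschitz in the first block. -/
lemma norm_gradA_sub_sq_le (h : BlockSmooth φ gA gB βA βB) (hA : 0 < βA) (hB : 0 < βB)
    (a a' : A) (b : B) : ‖gA a b - gA a' b‖ ^ 2 ≤ 2 * βA ^ 2 * ‖a' - a‖ ^ 2 := by
  have h1 := h.cocoercive hA hB a a' b b
  have h2 := h.smoothA a b a'
  rw [sub_self, inner_zero_right] at h1
  have h3 : 0 ≤ ‖gB a b - gB a' b‖ ^ 2 / (4 * βB) := by positivity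
  have h4 : ‖gA a b - gA a' b‖ ^ 2 / (4 * βA) ≤ βA / 2 * ‖a' - a‖ ^ 2 := by linarith
  rw [div_le_iff₀ (by positivity)] at h4
  linarith

end BlockSmooth

/-! ### One local step of all agents -/

section OneStep

variable {M : ℕ} {A : Type*} {B : Fin M → Type*} [NormedAddCommGroup A] [InnerProductSpace ℝ A]
  [∀ m, NormedAddCommGroup (B m)] [∀ m, InnerProductSpace ℝ (B m)]
  {F : ∀ m, A → B m → ℝ} {gA : ∀ m, A → B m → A} {gB : ∀ m, A → B m → B m} {βα ββ : ℝ}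

/-- One step along the exact gradients, taken at the local copies `a m`, decreases the squared
distance of the averaged iterate `((1 / M) ∑ a m, b)` to a stationary point `(a', b')`, up to the
disagreement of the copies. The Bregman divergences at the local copies absorb the squared norm of
the step. -/
lemma norm_step_sq_le (hM : 0 < M) (hα : 0 < βα) (hβ : 0 < ββ)
    (h : ∀ m, BlockSmooth (F m) (gA m) (gB m) βα (M * ββ)) {η : ℝ} (hη : 0 < η)
    (hηα : 4 * βα * η ≤ 1) (hηβ : 4 * ββ * η ≤ 1)
    (a : Fin M → A) (b : ∀ m, B m) (x : A) (a' : A) (b' : ∀ m, B m)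
    (statA : ∑ m, gA m a' (b' m) = 0) (statB : ∀ m, gB m a' (b' m) = 0) :
    ‖x - a' - (η * (1 / M)) • ∑ m, gA m (a m) (b m)‖ ^ 2
        + ∑ m, ‖b m - b' m - (η / M) • gB m (a m) (b m)‖ ^ 2
      ≤ ‖x - a'‖ ^ 2 + ∑ m, ‖b m - b' m‖ ^ 2
        - 2 * η * (1 / M * ∑ m, (F m x (b m) - F m a' (b' m)))
        + η * βα * (1 / M * ∑ m, ‖a m - x‖ ^ 2) := by
  have hM' : (0 : ℝ) < M := by exact_mod_cast hM
  -- the Bregman divergence of `F m` at the local copy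
  set D : Fin M → ℝ := fun m => F m a' (b' m) - F m (a m) (b m)
    - ⟪gA m (a m) (b m), a' - a m⟫ - ⟪gB m (a m) (b m), b' m - b m⟫ with hD
  have hco : ∀ m, ‖gA m (a m) (b m) - gA m a' (b' m)‖ ^ 2 / (4 * βα)
      + ‖gB m (a m) (b m)‖ ^ 2 / (4 * (M * ββ)) ≤ D m := by
    intro m
    have := (h m).cocoercive hα (by positivity) (a m) a' (b m) (b' m)
    rwa [statB, sub_zero] at this
  have hD0 : ∀ m, 0 ≤ D m := fun m => le_trans (by positivity) (hco m)
  have hcoA : ∀ m, ‖gA m (a m) (b m) - gA m a' (b' m)‖ ^ 2 ≤ 4 * βα * D m := by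
    intro m
    have h1 : 0 ≤ ‖gB m (a m) (b m)‖ ^ 2 / (4 * (M * ββ)) := by positivity
    have h2 : ‖gA m (a m) (b m) - gA m a' (b' m)‖ ^ 2 / (4 * βα) ≤ D m := by
      linarith [hco m]
    rw [div_le_iff₀ (by positivity)] at h2
    linarith
  have hcoB : ∀ m, ‖gB m (a m) (b m)‖ ^ 2 ≤ M * (4 * ββ * D m) := by
    intro m
    have h1 : 0 ≤ ‖gA m (a m) (b m) - gA m a' (b' m)‖ ^ 2 / (4 * βα) := by positivity
    have h2 : ‖gB m (a m) (b m)‖ ^ 2 / (4 * (M * ββ)) ≤ D m := by linarith [hco m]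
    rw [div_le_iff₀ (by positivity)] at h2
    linarith
  have hnA : ‖∑ m, gA m (a m) (b m)‖ ^ 2 ≤ M * (4 * βα * ∑ m, D m) := by
    have e : ∑ m, gA m (a m) (b m) = ∑ m, (gA m (a m) (b m) - gA m a' (b' m)) := by
      rw [Finset.sum_sub_distrib, statA, sub_zero]
    rw [e]
    refine (norm_sum_sq_le _).trans ?_
    rw [Fintype.card_fin, Finset.mul_sum (a := 4 * βα)]
    gcongr with m
    exact hcoA m
  have hnB : ∑ m, ‖gB m (a m) (b m)‖ ^ 2 ≤ M * (4 * ββ * ∑ m, D m) := by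
    rw [Finset.mul_sum (a := 4 * ββ), Finset.mul_sum]
    gcongr with m
    exact hcoB m
  have hin : ∀ m, F m x (b m) - F m a' (b' m) + D m - βα / 2 * ‖a m - x‖ ^ 2
      ≤ ⟪x - a', gA m (a m) (b m)⟫ + ⟪b m - b' m, gB m (a m) (b m)⟫ := by
    intro m
    have h1 := (h m).smoothA (a m) (b m) x
    have e1 : ⟪gA m (a m) (b m), x - a m⟫
        = ⟪x - a', gA m (a m) (b m)⟫ + ⟪gA m (a m) (b m), a' - a m⟫ := by
      rw [real_inner_comm (gA m (a m) (b m)) (x - a'), ← inner_add_right]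
      congr 1
      abel
    have e2 : ⟪b m - b' m, gB m (a m) (b m)⟫ = -⟪gB m (a m) (b m), b' m - b m⟫ := by
      rw [real_inner_comm, ← inner_neg_right, neg_sub]
    rw [norm_sub_rev x] at h1
    rw [e2]
    simp only [hD]
    linarith
  have hsum := Finset.sum_le_sum fun m (_ : m ∈ Finset.univ) => hin m
  rw [Finset.sum_sub_distrib, Finset.sum_add_distrib, ← Finset.mul_sum, Finset.sum_add_distrib,
    ← inner_sum] at hsum
  have expB : ∑ m, ‖b m - b' m - (η / M) • gB m (a m) (b m)‖ ^ 2
      = ∑ m, ‖b m - b' m‖ ^ 2 - 2 * (η / M) * ∑ m, ⟪b m - b' m, gB m (a m) (b m)⟫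
        + (η / M) ^ 2 * ∑ m, ‖gB m (a m) (b m)‖ ^ 2 := by
    rw [Finset.mul_sum, Finset.mul_sum, ← Finset.sum_sub_distrib, ← Finset.sum_add_distrib]
    refine Finset.sum_congr rfl fun m _ => ?_
    rw [norm_sub_sq_real, inner_smul_right, norm_smul, mul_pow, Real.norm_eq_abs, sq_abs]
    ring
  rw [expB, norm_sub_sq_real, inner_smul_right, norm_smul, mul_pow, Real.norm_eq_abs, sq_abs]
  set SD := ∑ m, D m
  have hSD : 0 ≤ SD := Finset.sum_nonneg fun m _ => hD0 m
  have h1 : (η * (1 / M)) ^ 2 * ‖∑ m, gA m (a m) (b m)‖ ^ 2 ≤ η / M * (4 * βα * η * SD) :=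
    calc (η * (1 / M)) ^ 2 * ‖∑ m, gA m (a m) (b m)‖ ^ 2
        ≤ (η * (1 / M)) ^ 2 * (M * (4 * βα * SD)) := by gcongr
      _ = _ := by field_simp
  have h2 : (η / M) ^ 2 * ∑ m, ‖gB m (a m) (b m)‖ ^ 2 ≤ η / M * (4 * ββ * η * SD) :=
    calc (η / M) ^ 2 * ∑ m, ‖gB m (a m) (b m)‖ ^ 2
        ≤ (η / M) ^ 2 * (M * (4 * ββ * SD)) := by gcongr
      _ = _ := by field_simp
  have h3 : η / M * (4 * βα * η * SD) + η / M * (4 * ββ * η * SD) ≤ η / M * (2 * SD) := by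
    rw [← mul_add]
    gcongr
    have := mul_le_mul_of_nonneg_right hηα hSD
    have := mul_le_mul_of_nonneg_right hηβ hSD
    linarith
  have h4 := mul_le_mul_of_nonneg_left hsum (by positivity : 0 ≤ 2 * (η / M))
  have e2 : 2 * (η * (1 / M) * ⟪x - a', ∑ m, gA m (a m) (b m)⟫)
      = 2 * (η / M) * ⟪x - a', ∑ m, gA m (a m) (b m)⟫ := by ring
  have e3 : 2 * η * (1 / M * ∑ m, (F m x (b m) - F m a' (b' m)))
      = 2 * (η / M) * ∑ m, (F m x (b m) - F m a' (b' m)) := by ring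
  have e4 : η * βα * (1 / M * ∑ m, ‖a m - x‖ ^ 2)
      = 2 * (η / M) * (βα / 2 * ∑ m, ‖a m - x‖ ^ 2) := by ring
  rw [e2, e3, e4]
  linarith

/-- Growth of the disagreement of the local copies in one step along the exact gradients. -/
lemma sum_norm_drift_sq_le (hM : 0 < M) (hα : 0 < βα) (hβ : 0 < ββ)
    (h : ∀ m, BlockSmooth (F m) (gA m) (gB m) βα (M * ββ)) {η κ G : ℝ} (hη : 0 < η)
    (hκ : 1 ≤ κ) (hηα : 4 * (κ * βα) * η ≤ 1) (a : Fin M → A) (b : ∀ m, B m) (x : A)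
    (hG : 1 / (M : ℝ) * ∑ m, ‖gA m x (b m)‖ ^ 2 ≤ G ^ 2) :
    1 / (M : ℝ) * ∑ m, ‖a m - x - η • gA m (a m) (b m)‖ ^ 2
      ≤ (1 + 3 / (2 * κ)) * (1 / M * ∑ m, ‖a m - x‖ ^ 2) + 4 * κ * η ^ 2 * G ^ 2 := by
  have hM' : (0 : ℝ) < M := by exact_mod_cast hM
  have key : ∀ m, ‖a m - x - η • gA m (a m) (b m)‖ ^ 2
      ≤ (1 + 3 / (2 * κ)) * ‖a m - x‖ ^ 2 + 4 * κ * η ^ 2 * ‖gA m x (b m)‖ ^ 2 := by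
    intro m
    set u := ‖a m - x‖
    set g := gA m (a m) (b m)
    set g' := gA m x (b m)
    have h1 : ‖g‖ ^ 2 ≤ 2 * ‖g'‖ ^ 2 + 4 * βα ^ 2 * u ^ 2 := by
      have h2 := (h m).norm_gradA_sub_sq_le hα (by positivity) x (a m) (b m)
      rw [norm_sub_rev] at h2
      have h3 : ‖g‖ ≤ ‖g'‖ + ‖g - g'‖ := by
        have := norm_add_le g' (g - g')
        rwa [add_sub_cancel] at this
      have h4 : ‖g‖ ^ 2 ≤ (‖g'‖ + ‖g - g'‖) ^ 2 := by gcongr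
      have h5 : ‖g - g'‖ ^ 2 ≤ 2 * βα ^ 2 * u ^ 2 := h2
      nlinarith [sq_nonneg (‖g'‖ - ‖g - g'‖)]
    have h2 : ‖a m - x - η • g‖ ^ 2 ≤ (1 + 1 / κ) * u ^ 2 + (2 * κ) * (η ^ 2 * ‖g‖ ^ 2) := by
      have h3 : ‖a m - x - η • g‖ ≤ u + η * ‖g‖ := by
        refine (norm_sub_le _ _).trans ?_
        rw [norm_smul, Real.norm_eq_abs, abs_of_pos hη]
      have h4 : ‖a m - x - η • g‖ ^ 2 ≤ (u + η * ‖g‖) ^ 2 := by gcongr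
      have h5 : 2 * u * (η * ‖g‖) ≤ 1 / κ * u ^ 2 + κ * (η * ‖g‖) ^ 2 := by
        have : 0 ≤ 1 / κ * (u - κ * (η * ‖g‖)) ^ 2 := by positivity
        have e : 1 / κ * (u - κ * (η * ‖g‖)) ^ 2
            = 1 / κ * u ^ 2 - 2 * u * (η * ‖g‖) + κ * (η * ‖g‖) ^ 2 := by field_simp; ring
        linarith
      have h6 : (η * ‖g‖) ^ 2 ≤ κ * (η * ‖g‖) ^ 2 := le_mul_of_one_le_left (by positivity) hκ
      have e : η ^ 2 * ‖g‖ ^ 2 = (η * ‖g‖) ^ 2 := by ring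
      rw [e]
      nlinarith
    have h3 : 2 * κ * (η ^ 2 * (4 * βα ^ 2 * u ^ 2)) ≤ 1 / (2 * κ) * u ^ 2 := by
      have h4 : (4 * (κ * βα) * η) ^ 2 ≤ 1 := by
        have : 0 ≤ 4 * (κ * βα) * η := by positivity
        nlinarith
      have e : 2 * κ * (η ^ 2 * (4 * βα ^ 2 * u ^ 2))
          = 1 / (2 * κ) * u ^ 2 * (4 * (κ * βα) * η) ^ 2 := by field_simp; ring
      rw [e]
      exact mul_le_of_le_one_right (by positivity) h4
    have h4 : 2 * κ * (η ^ 2 * ‖g‖ ^ 2)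
        ≤ 2 * κ * (η ^ 2 * (2 * ‖g'‖ ^ 2 + 4 * βα ^ 2 * u ^ 2)) := by gcongr
    have e : (1 + 3 / (2 * κ)) * u ^ 2 = (1 + 1 / κ) * u ^ 2 + 1 / (2 * κ) * u ^ 2 := by
      field_simp
      ring
    rw [e]
    linarith
  calc 1 / (M : ℝ) * ∑ m, ‖a m - x - η • gA m (a m) (b m)‖ ^ 2
      ≤ 1 / (M : ℝ) * ∑ m, ((1 + 3 / (2 * κ)) * ‖a m - x‖ ^ 2
          + 4 * κ * η ^ 2 * ‖gA m x (b m)‖ ^ 2) := by gcongr with m; exact key m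
    _ = (1 + 3 / (2 * κ)) * (1 / M * ∑ m, ‖a m - x‖ ^ 2)
          + 4 * κ * η ^ 2 * (1 / (M : ℝ) * ∑ m, ‖gA m x (b m)‖ ^ 2) := by
        rw [Finset.sum_add_distrib, ← Finset.mul_sum, ← Finset.mul_sum]; ring
    _ ≤ _ := by gcongr

variable {n : ℕ} [NeZero n] {σ : ℝ}

/-- One stochastic step of all agents: squared distance to a stationary point in mean. -/
lemma expect_norm_step_sq_le (hM : 0 < M) (hα : 0 < βα) (hβ : 0 < ββ)
    (h : ∀ m, BlockSmooth (F m) (gA m) (gB m) βα (M * ββ)) {η : ℝ} (hη : 0 < η)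
    (hηα : 4 * βα * η ≤ 1) (hηβ : 4 * ββ * η ≤ 1)
    (a : Fin M → A) (b : ∀ m, B m) (a' : A) (b' : ∀ m, B m)
    (statA : ∑ m, gA m a' (b' m) = 0) (statB : ∀ m, gB m a' (b' m) = 0)
    (sA : Fin M → Fin n → A) (sB : ∀ m, Fin n → B m)
    (meanA : ∀ m, ∑ i, (sA m i - gA m (a m) (b m)) = 0)
    (meanB : ∀ m, ∑ i, (sB m i - gB m (a m) (b m)) = 0)
    (varA : ∀ m, 𝔼 i, ‖sA m i - gA m (a m) (b m)‖ ^ 2 ≤ σ ^ 2)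
    (varB : ∀ m, 𝔼 i, ‖sB m i - gB m (a m) (b m)‖ ^ 2 ≤ σ ^ 2)
    (x : A) (hx : x = (1 / (M : ℝ)) • ∑ m, a m) :
    𝔼 idx : Fin M → Fin n,
        (‖(1 / (M : ℝ)) • ∑ m, (a m - η • sA m (idx m)) - a'‖ ^ 2
          + ∑ m, ‖b m - (η / M) • sB m (idx m) - b' m‖ ^ 2)
      ≤ ‖x - a'‖ ^ 2 + ∑ m, ‖b m - b' m‖ ^ 2
        - 2 * η * (1 / M * ∑ m, (F m x (b m) - F m a' (b' m)))
        + η * βα * (1 / M * ∑ m, ‖a m - x‖ ^ 2) + 2 * η ^ 2 * σ ^ 2 / M := by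
  have hM' : (0 : ℝ) < M := by exact_mod_cast hM
  have det := norm_step_sq_le hM hα hβ h hη hηα hηβ a b x a' b' statA statB
  have eA : ∀ idx : Fin M → Fin n, (1 / (M : ℝ)) • ∑ m, (a m - η • sA m (idx m)) - a'
      = x - a' - (η * (1 / M)) • ∑ m, sA m (idx m) := by
    intro idx
    rw [Finset.sum_sub_distrib, smul_sub, ← hx, ← Finset.smul_sum, smul_smul, mul_comm (1 / (M : ℝ))]
    abel
  have eB : ∀ (idx : Fin M → Fin n) m, b m - (η / M) • sB m (idx m) - b' m
      = b m - b' m - (η / M) • sB m (idx m) := by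
    intro idx m
    abel
  simp_rw [eA, eB]
  rw [Finset.expect_add_distrib, expect_norm_sub_smul_sum_sq sA _ meanA, Finset.expect_sum_comm]
  have hB : ∀ m, 𝔼 idx : Fin M → Fin n, ‖b m - b' m - (η / M) • sB m (idx m)‖ ^ 2
      ≤ ‖b m - b' m - (η / M) • gB m (a m) (b m)‖ ^ 2 + (η / M) ^ 2 * σ ^ 2 := by
    intro m
    rw [expect_coord m fun i => ‖b m - b' m - (η / M) • sB m i‖ ^ 2]
    have := expect_norm_sub_smul_sum_sq (ι := Unit) (fun _ => sB m) (fun _ => gB m (a m) (b m))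
      (fun _ => meanB m) (b m - b' m) (η / M)
    simp only [Finset.univ_unique, Finset.sum_singleton] at this
    rw [expect_coord () fun i => ‖b m - b' m - (η / M) • sB m i‖ ^ 2] at this
    rw [this]
    gcongr
    exact varB m
  have hBs := Finset.sum_le_sum fun m (_ : m ∈ Finset.univ) => hB m
  rw [Finset.sum_add_distrib, Finset.sum_const, Finset.card_univ, Fintype.card_fin,
    nsmul_eq_mul] at hBs
  have hA : (η * (1 / M)) ^ 2 * ∑ m, 𝔼 j, ‖sA m j - gA m (a m) (b m)‖ ^ 2 ≤ η ^ 2 * σ ^ 2 / M :=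
    calc (η * (1 / M)) ^ 2 * ∑ m, 𝔼 j, ‖sA m j - gA m (a m) (b m)‖ ^ 2
        ≤ (η * (1 / M)) ^ 2 * ∑ _m : Fin M, σ ^ 2 := by gcongr with m; exact varA m
      _ = _ := by
        rw [Finset.sum_const, Finset.card_univ, Fintype.card_fin, nsmul_eq_mul]
        field_simp
  have e : (M : ℝ) * ((η / M) ^ 2 * σ ^ 2) = η ^ 2 * σ ^ 2 / M := by field_simp
  have e' : 2 * η ^ 2 * σ ^ 2 / M = η ^ 2 * σ ^ 2 / M + η ^ 2 * σ ^ 2 / M := by ring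
  rw [e']
  rw [e] at hBs
  linarith

/-- One stochastic step of all agents: disagreement of the local copies in mean. -/
lemma expect_drift_le (hM : 0 < M) (hα : 0 < βα) (hβ : 0 < ββ)
    (h : ∀ m, BlockSmooth (F m) (gA m) (gB m) βα (M * ββ)) {η κ G : ℝ} (hη : 0 < η)
    (hκ : 1 ≤ κ) (hηα : 4 * (κ * βα) * η ≤ 1) (a : Fin M → A) (b : ∀ m, B m)
    (sA : Fin M → Fin n → A) (meanA : ∀ m, ∑ i, (sA m i - gA m (a m) (b m)) = 0)
    (varA : ∀ m, 𝔼 i, ‖sA m i - gA m (a m) (b m)‖ ^ 2 ≤ σ ^ 2)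
    (x : A) (hG : 1 / (M : ℝ) * ∑ m, ‖gA m x (b m)‖ ^ 2 ≤ G ^ 2) :
    𝔼 idx : Fin M → Fin n, 1 / (M : ℝ) * ∑ m, ‖a m - η • sA m (idx m)
        - (1 / (M : ℝ)) • ∑ m, (a m - η • sA m (idx m))‖ ^ 2
      ≤ (1 + 3 / (2 * κ)) * (1 / M * ∑ m, ‖a m - x‖ ^ 2)
        + (4 * κ * η ^ 2 * G ^ 2 + η ^ 2 * σ ^ 2) := by
  have hM' : (0 : ℝ) < M := by exact_mod_cast hM
  have : Nonempty (Fin M) := ⟨⟨0, hM⟩⟩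
  have det := sum_norm_drift_sq_le hM hα hβ h hη hκ hηα a b x hG
  calc 𝔼 idx : Fin M → Fin n, 1 / (M : ℝ) * ∑ m, ‖a m - η • sA m (idx m)
        - (1 / (M : ℝ)) • ∑ m, (a m - η • sA m (idx m))‖ ^ 2
      ≤ 𝔼 idx : Fin M → Fin n, 1 / (M : ℝ) * ∑ m, ‖a m - x - η • sA m (idx m)‖ ^ 2 := by
        refine Finset.expect_le_expect fun idx _ => ?_
        have hmean := sum_norm_sub_mean_sq_le (fun m => a m - η • sA m (idx m)) x
        rw [Fintype.card_fin] at hmean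
        gcongr ?_ * ?_
        refine hmean.trans (le_of_eq (Finset.sum_congr rfl fun m _ => ?_))
        congr 2
        abel
    _ = 1 / (M : ℝ) * ∑ m, 𝔼 i, ‖a m - x - η • sA m i‖ ^ 2 := by
        rw [← Finset.mul_expect, Finset.expect_sum_comm]
        congr 1
        refine Finset.sum_congr rfl fun m _ => ?_
        rw [expect_coord m fun i => ‖a m - x - η • sA m i‖ ^ 2]
    _ ≤ 1 / (M : ℝ) * ∑ m, (‖a m - x - η • gA m (a m) (b m)‖ ^ 2 + η ^ 2 * σ ^ 2) := by
        gcongr with m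
        have := expect_norm_sub_smul_sum_sq (ι := Unit) (fun _ => sA m)
          (fun _ => gA m (a m) (b m)) (fun _ => meanA m) (a m - x) η
        simp only [Finset.univ_unique, Finset.sum_singleton] at this
        rw [expect_coord () fun i => ‖a m - x - η • sA m i‖ ^ 2] at this
        rw [this]
        gcongr
        exact varA m
    _ = 1 / (M : ℝ) * ∑ m, ‖a m - x - η • gA m (a m) (b m)‖ ^ 2 + η ^ 2 * σ ^ 2 := by
        rw [Finset.sum_add_distrib, Finset.sum_const, Finset.card_univ, Fintype.card_fin,
          nsmul_eq_mul]
        field_simp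
    _ ≤ _ := by linarith

end OneStep

/-! ### The empirical losses as block-smooth convex functions -/

/-- A differentiable convex function lies above its tangents. -/
lemma fderiv_le_sub_of_convexOn {E : Type*} [NormedAddCommGroup E] [NormedSpace ℝ E] {φ : E → ℝ}
    (hφ : ConvexOn ℝ Set.univ φ) {x : E} (hd : DifferentiableAt ℝ φ x) (y : E) :
    fderiv ℝ φ x (y - x) ≤ φ y - φ x := by
  set L : ℝ →ᵃ[ℝ] E := AffineMap.lineMap x y
  have hc : ConvexOn ℝ Set.univ (φ ∘ L) := hφ.comp_affineMap L
  have hL0 : L 0 = x := by simp [L]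
  have hL1 : L 1 = y := by simp [L]
  have hLd : HasDerivAt L (y - x) 0 := AffineMap.hasDerivAt_lineMap
  have hd' : HasDerivAt (φ ∘ L) (fderiv ℝ φ x (y - x)) 0 := by
    have h : HasFDerivAt φ (fderiv ℝ φ x) (L 0) := by rw [hL0]; exact hd.hasFDerivAt
    exact h.comp_hasDerivAt 0 hLd
  have := hc.le_slope_of_hasDerivAt (Set.mem_univ 0) (Set.mem_univ 1) zero_lt_one hd'
  rwa [slope_def_field, sub_zero, div_one, Function.comp_apply, Function.comp_apply, hL0, hL1]
    at this

/-- Strong convexity makes `F` coercive, and the gradient vanishes at the minimizer. -/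
lemma exists_isMin_of_stronglyConvex {H : Type*} [NormedAddCommGroup H] [InnerProductSpace ℝ H]
    [FiniteDimensional ℝ H] [CompleteSpace H] {μ : ℝ} (hμ : 0 < μ) {F : H → ℝ}
    (hF : StronglyConvex μ F) : ∃ w, ∀ w', μ / 2 * ‖w' - w‖ ^ 2 ≤ F w' - F w := by
  have : ProperSpace H := FiniteDimensional.proper ℝ H
  obtain ⟨w, hw⟩ := hF.1.continuous.exists_forall_le' 0 <| by
    filter_upwards [tendsto_norm_cocompact_atTop.eventually_ge_atTop (2 * ‖gradient F 0‖ / μ)]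
      with w hw
    have h1 := hF.2 0 w
    rw [sub_zero] at h1
    have h2 := (abs_le.1 (abs_real_inner_le_norm (gradient F 0) w)).1
    rw [div_le_iff₀ hμ] at hw
    nlinarith [norm_nonneg w]
  refine ⟨w, fun w' => ?_⟩
  have h0 : gradient F w = 0 := by
    have : fderiv ℝ F w = 0 :=
      IsLocalMin.fderiv_eq_zero (Filter.Eventually.of_forall hw)
    rw [gradient, this, map_zero]
  have := hF.2 w w'
  rw [h0, inner_zero_left, zero_add] at this
  exact this

namespace Bandit

variable {M K : ℕ} {X : Fin M → Type*} [∀ m, MeasurableSpace (X m)] {P : Bandit M K X}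
  {n κ : ℕ} {μω βα ββ σ G : ℝ} {S : Dataset K X n}

/-- Gradient of the empirical loss of agent `m` in the shared parameters. -/
noncomputable def localGradα (P : Bandit M K X) {n : ℕ} (S : Dataset K X n) (m : Fin M) (α : P.Shared)
    (b : P.Personal m) : P.Shared :=
  gradient (fun α' => P.localLoss S m α' b) α

/-- Gradient of the empirical loss of agent `m` in the personal parameters. -/
noncomputable def localGradβ (P : Bandit M K X) {n : ℕ} (S : Dataset K X n) (m : Fin M) (α : P.Shared)
    (b : P.Personal m) : P.Personal m :=
  gradient (fun b' => P.localLoss S m α b') b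

/-- The empirical loss of all agents, as a function of the two groups of parameters. -/
noncomputable def empiricalLoss (P : Bandit M K X) {n : ℕ} (S : Dataset K X n) (α : P.Shared)
    (b : ∀ m, P.Personal m) : ℝ :=
  1 / (M : ℝ) * ∑ m, P.localLoss S m α (b m)

namespace LSGDCondition

lemma differentiable_localLoss (h : P.LSGDCondition n κ μω βα ββ σ G) (hS : S.Valid)
    (m : Fin M) :
    Differentiable ℝ fun q : P.Shared × P.Personal m => P.localLoss S m q.1 q.2 := by
  unfold localLoss
  exact (Differentiable.fun_sum fun i _ => h.differentiable m (S m i) (hS m i)).const_mul _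

lemma blockSmooth (h : P.LSGDCondition n κ μω βα ββ σ G) (hS : S.Valid) (m : Fin M) :
    BlockSmooth (P.localLoss S m) (P.localGradα S m) (P.localGradβ S m) βα (M * ββ) where
  convex a b a' b' := by
    have hd := h.differentiable_localLoss hS m
    have := fderiv_le_sub_of_convexOn (h.convex S hS m) (hd (a, b)) (a', b')
    have e : ((a', b') : P.Shared × P.Personal m) - (a, b) = (a' - a, 0) + (0, b' - b) := by simp
    rw [e, map_add] at this
    have h1 : HasFDerivAt (fun x => P.localLoss S m x b)
        ((fderiv ℝ (fun q : P.Shared × P.Personal m => P.localLoss S m q.1 q.2) (a, b)).comp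
          (ContinuousLinearMap.inl ℝ P.Shared (P.Personal m))) a :=
      HasFDerivAt.comp (f := fun x : P.Shared => (x, b)) a (hd (a, b)).hasFDerivAt
        (hasFDerivAt_prodMk_left a b)
    have h2 : HasFDerivAt (fun y => P.localLoss S m a y)
        ((fderiv ℝ (fun q : P.Shared × P.Personal m => P.localLoss S m q.1 q.2) (a, b)).comp
          (ContinuousLinearMap.inr ℝ P.Shared (P.Personal m))) b :=
      HasFDerivAt.comp (f := fun y : P.Personal m => (a, y)) b (hd (a, b)).hasFDerivAt
        (hasFDerivAt_prodMk_right a b)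
    have e1 : ⟪P.localGradα S m a b, a' - a⟫
        = fderiv ℝ (fun q : P.Shared × P.Personal m => P.localLoss S m q.1 q.2) (a, b)
          (a' - a, 0) := by
      rw [localGradα, inner_gradient_left, h1.fderiv]
      rfl
    have e2 : ⟪P.localGradβ S m a b, b' - b⟫
        = fderiv ℝ (fun q : P.Shared × P.Personal m => P.localLoss S m q.1 q.2) (a, b)
          (0, b' - b) := by
      rw [localGradβ, inner_gradient_left, h2.fderiv]
      rfl
    rw [e1, e2]
    exact this
  smoothA a b a' := (h.smoothα S hS m b).2 a a'
  smoothB a b b' := (h.smoothβ S hS m a).2 b b'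

lemma hasGradientAt_sampleα (h : P.LSGDCondition n κ μω βα ββ σ G) (m : Fin M)
    {s : X m × Fin K × ℝ} (hs : s.2.2 ∈ Set.Icc (0 : ℝ) 1) (α : P.Shared) (b : P.Personal m) :
    HasGradientAt (fun α' => P.sampleLoss m s α' b) (P.gradα m s α b) α :=
  DifferentiableAt.hasGradientAt
    (DifferentiableAt.comp (f := fun x : P.Shared => (x, b)) α (h.differentiable m s hs (α, b))
      (by fun_prop))

lemma hasGradientAt_sampleβ (h : P.LSGDCondition n κ μω βα ββ σ G) (m : Fin M)
    {s : X m × Fin K × ℝ} (hs : s.2.2 ∈ Set.Icc (0 : ℝ) 1) (α : P.Shared) (b : P.Personal m) :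
    HasGradientAt (fun b' => P.sampleLoss m s α b') (P.gradβ m s α b) b :=
  DifferentiableAt.hasGradientAt
    (DifferentiableAt.comp (f := fun y : P.Personal m => (α, y)) b (h.differentiable m s hs (α, b))
      (by fun_prop))

end LSGDCondition

/-- The gradient of an average is the average of the gradients. -/
lemma sum_sub_gradient_average_eq_zero {H : Type*} [NormedAddCommGroup H] [InnerProductSpace ℝ H]
    [CompleteSpace H] [NeZero n] {φ : Fin n → H → ℝ} {g : Fin n → H} {x : H}
    (h : ∀ i, HasGradientAt (φ i) (g i) x) :
    ∑ i, (g i - gradient (fun y => 1 / (n : ℝ) * ∑ i, φ i y) x) = 0 := by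
  have hs : HasFDerivAt (fun y => 1 / (n : ℝ) * ∑ i, φ i y)
      ((1 / (n : ℝ)) • ∑ i, InnerProductSpace.toDual ℝ H (g i)) x :=
    (HasFDerivAt.fun_sum fun i _ => (h i).hasFDerivAt).const_mul _
  have e : gradient (fun y => 1 / (n : ℝ) * ∑ i, φ i y) x = (1 / (n : ℝ)) • ∑ i, g i := by
    rw [gradient, hs.fderiv]
    simp
  have hn : (n : ℝ) ≠ 0 := NeZero.ne _
  rw [Finset.sum_sub_distrib, Finset.sum_const, Finset.card_univ, Fintype.card_fin, e,
    ← Nat.cast_smul_eq_nsmul ℝ, smul_smul, mul_one_div_cancel hn, one_smul, sub_self]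

namespace LSGDCondition

/-- The gradient on a random sample is unbiased. -/
lemma sum_gradα_sub (h : P.LSGDCondition n κ μω βα ββ σ G) [NeZero n] (hS : S.Valid)
    (m : Fin M) (α : P.Shared) (b : P.Personal m) :
    ∑ i, (P.gradα m (S m i) α b - P.localGradα S m α b) = 0 :=
  sum_sub_gradient_average_eq_zero fun i => h.hasGradientAt_sampleα m (hS m i) α b

lemma sum_gradβ_sub (h : P.LSGDCondition n κ μω βα ββ σ G) [NeZero n] (hS : S.Valid)
    (m : Fin M) (α : P.Shared) (b : P.Personal m) :
    ∑ i, (P.gradβ m (S m i) α b - P.localGradβ S m α b) = 0 :=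
  sum_sub_gradient_average_eq_zero fun i => h.hasGradientAt_sampleβ m (hS m i) α b

/-- The empirical loss has a minimizer over all parameters (possibly outside of the parameter
region), and grows quadratically around it. -/
lemma exists_minimizer (h : P.LSGDCondition n κ μω βα ββ σ G) (hμ : 0 < μω) (hS : S.Valid) :
    ∃ (α : P.Shared) (b : ∀ m, P.Personal m), ∀ α' b',
      μω / 2 * (‖α' - α‖ ^ 2 + ∑ m, ‖b' m - b m‖ ^ 2)
        ≤ P.empiricalLoss S α' b' - P.empiricalLoss S α b := by
  obtain ⟨w, hw⟩ := exists_isMin_of_stronglyConvex hμ (h.strongly_convex S hS)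
  refine ⟨w.fst, fun m => w.snd m, fun α' b' => ?_⟩
  have := hw (WithLp.toLp 2 (α', WithLp.toLp 2 b'))
  rw [WithLp.prod_norm_sq_eq_of_L2,
    PiLp.norm_sq_eq_of_L2 _ (WithLp.toLp 2 (α', WithLp.toLp 2 b') - w).snd] at this
  exact this

end LSGDCondition

/-- Stationarity of a global minimizer in the shared parameters. -/
lemma sum_localGradα_eq_zero (h : P.LSGDCondition n κ μω βα ββ σ G) (hM : 0 < M) (hα : 0 < βα)
    (hS : S.Valid) {α : P.Shared} {b : ∀ m, P.Personal m}
    (hmin : ∀ α' b', P.empiricalLoss S α b ≤ P.empiricalLoss S α' b') :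
    ∑ m, P.localGradα S m α (b m) = 0 := by
  have hM' : (0 : ℝ) < M := by exact_mod_cast hM
  set g := ∑ m, P.localGradα S m α (b m)
  have h1 := hmin (α + (-(1 / (M * βα))) • g) b
  unfold empiricalLoss at h1
  have h2 : ∑ m, P.localLoss S m α (b m)
      ≤ ∑ m, P.localLoss S m (α + (-(1 / (M * βα))) • g) (b m) :=
    le_of_mul_le_mul_left h1 (by positivity)
  have h3 := Finset.sum_le_sum fun m (_ : m ∈ Finset.univ) =>
    (h.blockSmooth hS m).smoothA α (b m) (α + (-(1 / (M * βα))) • g)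
  rw [Finset.sum_sub_distrib, Finset.sum_add_distrib, ← sum_inner, Finset.sum_const,
    Finset.card_univ, Fintype.card_fin, nsmul_eq_mul, add_sub_cancel_left, inner_smul_right,
    real_inner_self_eq_norm_sq, norm_smul, mul_pow, Real.norm_eq_abs, sq_abs] at h3
  have e : -(1 / (M * βα)) * ‖g‖ ^ 2 + M * (βα / 2 * ((-(1 / (M * βα))) ^ 2 * ‖g‖ ^ 2))
      = -(1 / (2 * (M * βα)) * ‖g‖ ^ 2) := by field_simp; ring
  change _ ≤ -(1 / (M * βα)) * ‖g‖ ^ 2 + M * (βα / 2 * ((-(1 / (M * βα))) ^ 2 * ‖g‖ ^ 2)) at h3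
  rw [e] at h3
  have h4 : 1 / (2 * (M * βα)) * ‖g‖ ^ 2 ≤ 0 := by linarith
  have h5 : 0 < 1 / (2 * (M * βα)) := by positivity
  have h6 : ‖g‖ ^ 2 ≤ 0 := by
    by_contra! hc
    have := mul_pos h5 hc
    linarith
  exact norm_eq_zero.1 (pow_eq_zero_iff two_ne_zero |>.1 (le_antisymm h6 (sq_nonneg _)))

/-- Stationarity of a global minimizer in the personal parameters. -/
lemma localGradβ_eq_zero (hM : 0 < M) {α : P.Shared} {b : ∀ m, P.Personal m}
    (hmin : ∀ α' b', P.empiricalLoss S α b ≤ P.empiricalLoss S α' b') (m : Fin M) :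
    P.localGradβ S m α (b m) = 0 := by
  have hM' : (0 : ℝ) < M := by exact_mod_cast hM
  have h1 : ∀ y, P.localLoss S m α (b m) ≤ P.localLoss S m α y := by
    intro y
    have h2 := hmin α (Function.update b m y)
    unfold empiricalLoss at h2
    have h3 := le_of_mul_le_mul_left h2 (by positivity)
    rw [← Finset.add_sum_erase _ _ (Finset.mem_univ m),
      ← Finset.add_sum_erase (a := m) _ (fun k => P.localLoss S k α (Function.update b m y k))
        (Finset.mem_univ m), Function.update_self] at h3
    have h4 : ∑ k ∈ Finset.univ.erase m, P.localLoss S k α (Function.update b m y k)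
        = ∑ k ∈ Finset.univ.erase m, P.localLoss S k α (b k) := by
      refine Finset.sum_congr rfl fun k hk => ?_
      rw [Function.update_of_ne (Finset.ne_of_mem_erase hk)]
    linarith
  have : fderiv ℝ (fun y => P.localLoss S m α y) (b m) = 0 :=
    IsLocalMin.fderiv_eq_zero (Filter.Eventually.of_forall h1)
  rw [localGradβ, gradient, this, map_zero]

/-- The strong convexity constant is at most the smoothness constant, because there is at least one
shared parameter. -/
lemma LSGDCondition.strongConvexity_le_smoothness (h : P.LSGDCondition n κ μω βα ββ σ G)
    (hM : 0 < M) (hd : 0 < P.dα) (hμ : 0 < μω) (hα : 0 < βα) (hS : S.Valid) : μω ≤ βα := by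
  have hM' : (0 : ℝ) < M := by exact_mod_cast hM
  obtain ⟨α, b, hmin⟩ := h.exists_minimizer hμ hS
  have hmin' : ∀ α' b', P.empiricalLoss S α b ≤ P.empiricalLoss S α' b' := fun α' b' => by
    have := hmin α' b'
    have h0 : 0 ≤ μω / 2 * (‖α' - α‖ ^ 2 + ∑ m, ‖b' m - b m‖ ^ 2) := by positivity
    linarith
  have hg := sum_localGradα_eq_zero h hM hα hS hmin'
  set u : P.Shared := EuclideanSpace.single ⟨0, hd⟩ 1 with hu
  have hun : ‖u‖ = 1 := by simp [hu]
  have h1 := hmin (α + u) b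
  have h3 := Finset.sum_le_sum fun m (_ : m ∈ Finset.univ) =>
    (h.blockSmooth hS m).smoothA α (b m) (α + u)
  rw [Finset.sum_sub_distrib, Finset.sum_add_distrib, ← sum_inner, hg, inner_zero_left,
    Finset.sum_const, Finset.card_univ, Fintype.card_fin, nsmul_eq_mul, add_sub_cancel_left,
    hun] at h3
  unfold empiricalLoss at h1
  rw [← mul_sub, add_sub_cancel_left, hun] at h1
  have h4 : 1 / (M : ℝ) * (∑ m, P.localLoss S m (α + u) (b m) - ∑ m, P.localLoss S m α (b m))
      ≤ 1 / (M : ℝ) * (0 + M * (βα / 2 * 1 ^ 2)) := by gcongr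
  have e : 1 / (M : ℝ) * (0 + M * (βα / 2 * 1 ^ 2)) = βα / 2 := by field_simp; ring
  simp only [sub_self, norm_zero] at h1
  norm_num at h1
  rw [e] at h4
  norm_num at h4
  linarith

/-- The squared distance of the starting point to the minimizer: the gradients at the starting point
are bounded because this point lies in the parameter region. -/
lemma LSGDCondition.dist_start_sq_le (h : P.LSGDCondition n κ μω βα ββ σ G)
    (hM : 0 < M) (hμ : 0 < μω) (hS : S.Valid) {α : P.Shared}
    {b : ∀ m, P.Personal m} (hmin : ∀ α' b', μω / 2 * (‖α' - α‖ ^ 2 + ∑ m, ‖b' m - b m‖ ^ 2)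
      ≤ P.empiricalLoss S α' b' - P.empiricalLoss S α b)
    {α₀ : P.Shared} {b₀ : ∀ m, P.Personal m} (hα₀ : α₀ ∈ P.Ωα) (hb₀ : ∀ m, b₀ m ∈ P.Ωβ m) :
    ‖α₀ - α‖ ^ 2 + ∑ m, ‖b₀ m - b m‖ ^ 2 ≤ 4 * G ^ 2 / μω ^ 2 := by
  have hM' : (0 : ℝ) < M := by exact_mod_cast hM
  set r := ‖α₀ - α‖ ^ 2 + ∑ m, ‖b₀ m - b m‖ ^ 2 with hr
  have h1 := hmin α₀ b₀
  have hdis := h.dissimilarity S hS α₀ hα₀ b₀ hb₀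
  -- Young's inequality with weights tuned so that half of the quadratic growth is left
  have hm : ∀ m, P.localLoss S m α₀ (b₀ m) - P.localLoss S m α (b m)
      ≤ 1 / μω * (‖P.localGradα S m α₀ (b₀ m)‖ ^ 2 + ‖P.localGradβ S m α₀ (b₀ m)‖ ^ 2)
        + μω / 4 * (‖α₀ - α‖ ^ 2 + ‖b₀ m - b m‖ ^ 2) := by
    intro m
    have h2 := (h.blockSmooth hS m).convex α₀ (b₀ m) α (b m)
    have h3 := (abs_le.1 (abs_real_inner_le_norm (P.localGradα S m α₀ (b₀ m)) (α - α₀))).1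
    have h4 := (abs_le.1 (abs_real_inner_le_norm (P.localGradβ S m α₀ (b₀ m)) (b m - b₀ m))).1
    rw [norm_sub_rev] at h3 h4
    have y : ∀ p q : ℝ, p * q ≤ 1 / μω * p ^ 2 + μω / 4 * q ^ 2 := by
      intro p q
      have : 0 ≤ 1 / μω * (p - μω / 2 * q) ^ 2 := by positivity
      have e : 1 / μω * (p - μω / 2 * q) ^ 2 = 1 / μω * p ^ 2 + μω / 4 * q ^ 2 - p * q := by
        field_simp; ring
      linarith
    have h5 := y ‖P.localGradα S m α₀ (b₀ m)‖ ‖α₀ - α‖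
    have h6 := y ‖P.localGradβ S m α₀ (b₀ m)‖ ‖b₀ m - b m‖
    linarith
  have h2 : P.empiricalLoss S α₀ b₀ - P.empiricalLoss S α b ≤ 1 / μω * G ^ 2 + μω / 4 * r := by
    unfold empiricalLoss
    rw [← mul_sub, ← Finset.sum_sub_distrib]
    calc 1 / (M : ℝ) * ∑ m, (P.localLoss S m α₀ (b₀ m) - P.localLoss S m α (b m))
        ≤ 1 / (M : ℝ) * ∑ m, (1 / μω * (‖P.localGradα S m α₀ (b₀ m)‖ ^ 2
            + ‖P.localGradβ S m α₀ (b₀ m)‖ ^ 2)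
            + μω / 4 * (‖α₀ - α‖ ^ 2 + ‖b₀ m - b m‖ ^ 2)) := by gcongr with m; exact hm m
      _ = 1 / μω * (1 / (M : ℝ) * ∑ m, (‖P.localGradα S m α₀ (b₀ m)‖ ^ 2
            + ‖P.localGradβ S m α₀ (b₀ m)‖ ^ 2))
            + μω / 4 * (‖α₀ - α‖ ^ 2 + 1 / M * ∑ m, ‖b₀ m - b m‖ ^ 2) := by
          rw [Finset.sum_add_distrib, ← Finset.mul_sum, ← Finset.mul_sum,
            Finset.sum_add_distrib (f := fun _ => ‖α₀ - α‖ ^ 2), Finset.sum_const,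
            Finset.card_univ, Fintype.card_fin, nsmul_eq_mul]
          field_simp
      _ ≤ 1 / μω * G ^ 2 + μω / 4 * r := by
          rw [hr]
          gcongr
          · exact hdis
          · have h1M : 1 / (M : ℝ) ≤ 1 := by
              rw [div_le_one hM']
              exact_mod_cast hM
            exact mul_le_of_le_one_left (by positivity) h1M
  have h3 : μω / 4 * r ≤ 1 / μω * G ^ 2 := by linarith
  have e : r = 4 / μω * (μω / 4 * r) := by field_simp
  rw [e]
  calc 4 / μω * (μω / 4 * r) ≤ 4 / μω * (1 / μω * G ^ 2) := by gcongr
    _ = 4 * G ^ 2 / μω ^ 2 := by field_simp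

end Bandit

namespace Bandit

variable {M K : ℕ} {X : Fin M → Type*} [∀ m, MeasurableSpace (X m)] {P : Bandit M K X}
  {n κ : ℕ} {μω βα ββ σ G : ℝ} {S : Dataset K X n}

/-! ### The iterates of LSGD-PFL -/

/-- The local step number `k` (counted from `0`), with the aggregation that may follow it. -/
noncomputable def advance (P : Bandit M K X) (S : Dataset K X n) (κ : ℕ) (η : ℝ) (k : ℕ)
    (idx : Fin M → Fin n) (st : P.State) : P.State :=
  if κ ∣ k + 1 then P.aggregate (P.localStep S η idx st) else P.localStep S η idx st

/-- The personal parameters of a state. -/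
def personalPart (st : P.State) : ∀ m, P.Personal m := fun m => (st m).2

/-- Squared distance of the averaged state to given parameters. -/
noncomputable def sqDist (α : P.Shared) (b : ∀ m, P.Personal m) (st : P.State) : ℝ :=
  ‖P.meanShared st - α‖ ^ 2 + ∑ m, ‖(st m).2 - b m‖ ^ 2

/-- Mean squared deviation of the local copies of the shared parameters from their average. -/
noncomputable def drift (st : P.State) : ℝ :=
  1 / (M : ℝ) * ∑ m, ‖(st m).1 - P.meanShared st‖ ^ 2

lemma meanShared_aggregate (hM : 0 < M) (st : P.State) :
    P.meanShared (P.aggregate st) = P.meanShared st := by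
  have hM' : (M : ℝ) ≠ 0 := by positivity
  change (1 / (M : ℝ)) • ∑ _m : Fin M, P.meanShared st = P.meanShared st
  rw [Finset.sum_const, Finset.card_univ, Fintype.card_fin, ← Nat.cast_smul_eq_nsmul ℝ, smul_smul,
    one_div_mul_cancel hM', one_smul]

lemma sqDist_aggregate (hM : 0 < M) (α : P.Shared) (b : ∀ m, P.Personal m) (st : P.State) :
    sqDist α b (P.aggregate st) = sqDist α b st := by
  simp only [sqDist, meanShared_aggregate hM]
  rfl

lemma drift_aggregate (hM : 0 < M) (st : P.State) : drift (P.aggregate st) = 0 := by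
  simp [drift, meanShared_aggregate hM, aggregate]

lemma sqDist_advance (hM : 0 < M) (α : P.Shared) (b : ∀ m, P.Personal m) (η : ℝ) (k : ℕ)
    (idx : Fin M → Fin n) (st : P.State) :
    sqDist α b (P.advance S κ η k idx st) = sqDist α b (P.localStep S η idx st) := by
  unfold advance
  split_ifs
  · exact sqDist_aggregate hM α b _
  · rfl

lemma sqDist_nonneg (α : P.Shared) (b : ∀ m, P.Personal m) (st : P.State) :
    0 ≤ sqDist α b st := by unfold sqDist; positivity

lemma meanShared_mem (hM : 0 < M) (hc : Convex ℝ P.Ωα) {st : P.State}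
    (h : ∀ m, (st m).1 ∈ P.Ωα) : P.meanShared st ∈ P.Ωα := by
  have hM' : (0 : ℝ) < M := by exact_mod_cast hM
  unfold meanShared
  rw [Finset.smul_sum]
  refine hc.sum_mem (fun _ _ => by positivity) ?_ fun m _ => h m
  rw [Finset.sum_const, Finset.card_univ, Fintype.card_fin, nsmul_eq_mul, mul_one_div_cancel hM'.ne']

lemma expect_gradα_var (h : P.LSGDCondition n κ μω βα ββ σ G) (hS : S.Valid) (m : Fin M)
    {α : P.Shared} {b : P.Personal m} (hα : α ∈ P.Ωα) (hb : b ∈ P.Ωβ m) :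
    𝔼 i, ‖P.gradα m (S m i) α b - P.localGradα S m α b‖ ^ 2 ≤ σ ^ 2 := by
  rw [Fintype.expect_eq_sum_div_card, Fintype.card_fin, div_eq_inv_mul, ← one_div]
  exact h.varianceα S hS m α hα b hb

lemma expect_gradβ_var (h : P.LSGDCondition n κ μω βα ββ σ G) (hS : S.Valid) (m : Fin M)
    {α : P.Shared} {b : P.Personal m} (hα : α ∈ P.Ωα) (hb : b ∈ P.Ωβ m) :
    𝔼 i, ‖P.gradβ m (S m i) α b - P.localGradβ S m α b‖ ^ 2 ≤ σ ^ 2 := by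
  rw [Fintype.expect_eq_sum_div_card, Fintype.card_fin, div_eq_inv_mul, ← one_div]
  exact h.varianceβ S hS m α hα b hb

/-- One step of the protocol contracts the squared distance to the minimizer in mean, up to noise
and to the disagreement of the local copies, and gains the suboptimality of the averaged state. -/
lemma expect_sqDist_advance_le (h : P.LSGDCondition n κ μω βα ββ σ G) [NeZero n] (hM : 0 < M)
    (hμ : 0 < μω) (hα : 0 < βα) (hβ : 0 < ββ) (hS : S.Valid) {α : P.Shared}
    {b : ∀ m, P.Personal m} (hmin : ∀ α' b', μω / 2 * (‖α' - α‖ ^ 2 + ∑ m, ‖b' m - b m‖ ^ 2)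
      ≤ P.empiricalLoss S α' b' - P.empiricalLoss S α b) {η : ℝ} (hη : 0 < η)
    (hηα : 4 * βα * η ≤ 1) (hηβ : 4 * ββ * η ≤ 1) {st : P.State}
    (hst : ∀ m, (st m).1 ∈ P.Ωα ∧ (st m).2 ∈ P.Ωβ m) (k : ℕ) :
    𝔼 idx, sqDist α b (P.advance S κ η k idx st)
      ≤ (1 - η * μω / 2) * sqDist α b st
        - η * (P.empiricalLoss S (P.meanShared st) (personalPart st) - P.empiricalLoss S α b)
        + η * βα * drift st + 2 * η ^ 2 * σ ^ 2 / M := by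
  have hmin' : ∀ α' b', P.empiricalLoss S α b ≤ P.empiricalLoss S α' b' := fun α' b' => by
    have := hmin α' b'
    have h0 : 0 ≤ μω / 2 * (‖α' - α‖ ^ 2 + ∑ m, ‖b' m - b m‖ ^ 2) := by positivity
    linarith
  have key := expect_norm_step_sq_le hM hα hβ (fun m => h.blockSmooth hS m) hη hηα hηβ
    (fun m => (st m).1) (fun m => (st m).2) α b (sum_localGradα_eq_zero h hM hα hS hmin')
    (localGradβ_eq_zero hM hmin')
    (fun m i => P.gradα m (S m i) (st m).1 (st m).2)
    (fun m i => P.gradβ m (S m i) (st m).1 (st m).2)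
    (fun m => h.sum_gradα_sub hS m _ _) (fun m => h.sum_gradβ_sub hS m _ _)
    (fun m => expect_gradα_var h hS m (hst m).1 (hst m).2)
    (fun m => expect_gradβ_var h hS m (hst m).1 (hst m).2) (P.meanShared st) rfl
  have hg := hmin (P.meanShared st) (personalPart st)
  have e : 1 / (M : ℝ) * ∑ m, (P.localLoss S m (P.meanShared st) (st m).2
      - P.localLoss S m α (b m))
      = P.empiricalLoss S (P.meanShared st) (personalPart st) - P.empiricalLoss S α b := by
    rw [Finset.sum_sub_distrib, mul_sub]
    rfl
  rw [e] at key
  simp_rw [sqDist_advance hM]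
  refine key.trans ?_
  change sqDist α b st - 2 * η * _ + η * βα * drift st + _ ≤ _
  have hg' := mul_le_mul_of_nonneg_left hg hη.le
  change η * (μω / 2 * sqDist α b st) ≤ _ at hg'
  linarith

/-- Growth of the disagreement of the local copies in one step without aggregation. -/
lemma expect_drift_localStep_le (h : P.LSGDCondition n κ μω βα ββ σ G) (hP : P.Regular) [NeZero n]
    (hM : 0 < M) (hα : 0 < βα) (hβ : 0 < ββ) (hκ : 1 ≤ κ) (hS : S.Valid) {η : ℝ} (hη : 0 < η)
    (hηα : 4 * (κ * βα) * η ≤ 1) {st : P.State}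
    (hst : ∀ m, (st m).1 ∈ P.Ωα ∧ (st m).2 ∈ P.Ωβ m) :
    𝔼 idx, drift (P.localStep S η idx st)
      ≤ (1 + 3 / (2 * κ)) * drift st + (4 * κ * η ^ 2 * G ^ 2 + η ^ 2 * σ ^ 2) := by
  refine expect_drift_le hM hα hβ (fun m => h.blockSmooth hS m) hη (by exact_mod_cast hκ) hηα
    (fun m => (st m).1) (fun m => (st m).2) (fun m i => P.gradα m (S m i) (st m).1 (st m).2)
    (fun m => h.sum_gradα_sub hS m _ _)
    (fun m => expect_gradα_var h hS m (hst m).1 (hst m).2) (P.meanShared st) ?_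
  refine le_trans ?_ (h.dissimilarity S hS (P.meanShared st)
    (meanShared_mem hM hP.convexα fun m => (hst m).1) (fun m => (st m).2) fun m => (hst m).2)
  gcongr with m
  exact le_add_of_nonneg_right (sq_nonneg _)

lemma iterate_succ_eq_advance (S : Dataset K X n) (κ : ℕ) (η : ℝ) {N : ℕ}
    (ξ : Fin M → Fin N → Fin n) {k : ℕ} (hk : k < N) :
    P.iterate S κ η ξ (k + 1)
      = P.advance S κ η k (fun m => ξ m ⟨k, hk⟩) (P.iterate S κ η ξ k) := by
  rw [iterate, dif_pos hk]
  rfl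

lemma iterate_congr (S : Dataset K X n) (κ : ℕ) (η : ℝ) {N : ℕ} {ξ ξ' : Fin M → Fin N → Fin n} :
    ∀ k, (∀ m (j : Fin N), (j : ℕ) < k → ξ m j = ξ' m j) →
      P.iterate S κ η ξ k = P.iterate S κ η ξ' k
  | 0, _ => rfl
  | k + 1, hk => by
    have ih := iterate_congr S κ η k fun m j hj => hk m j (hj.trans k.lt_succ_self)
    by_cases h : k < N
    · have : ∀ m, ξ m ⟨k, h⟩ = ξ' m ⟨k, h⟩ := fun m => hk m ⟨k, h⟩ k.lt_succ_self
      simp only [iterate_succ_eq_advance S κ η _ h, ih, this]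
    · simp only [iterate, dif_neg h, ih]

/-- The samples of step `k` are independent of the state before step `k`. -/
lemma expect_iterate_succ [NeZero n] (S : Dataset K X n) (κ : ℕ) (η : ℝ) {N k : ℕ} (hk : k < N)
    (φ : P.State → ℝ) :
    𝔼 ξ : Fin M → Fin N → Fin n, φ (P.iterate S κ η ξ (k + 1))
      = 𝔼 ξ : Fin M → Fin N → Fin n, 𝔼 idx, φ (P.advance S κ η k idx (P.iterate S κ η ξ k)) := by
  rw [← expect_resample (A := Fin M → Fin N → Fin n) (B := Fin M → Fin n)
    (fun ξ idx m => Function.update (ξ m) ⟨k, hk⟩ (idx m)) (fun ξ m => ξ m ⟨k, hk⟩)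
    (by simp) (by simp) (by simp)]
  refine Finset.expect_congr rfl fun ξ _ => Finset.expect_congr rfl fun idx _ => ?_
  rw [iterate_succ_eq_advance S κ η _ hk]
  have : P.iterate S κ η (fun m => Function.update (ξ m) ⟨k, hk⟩ (idx m)) k
      = P.iterate S κ η ξ k := by
    refine iterate_congr S κ η k fun m j hj => ?_
    rw [Function.update_of_ne]
    rintro rfl
    exact lt_irrefl _ hj
  rw [this]
  simp

/-- The disagreement of the local copies stays small, because it is reset in every communication
round. -/
lemma expect_drift_iterate_le (h : P.LSGDCondition n κ μω βα ββ σ G) (hP : P.Regular) [NeZero n]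
    (hM : 0 < M) (hα : 0 < βα) (hβ : 0 < ββ) (hκ : 1 ≤ κ) (hS : S.Valid) {η : ℝ} (hη : 0 < η)
    (hηα : 4 * (κ * βα) * η ≤ 1) {N : ℕ}
    (hst : ∀ (ξ : Fin M → Fin N → Fin n), ∀ k ≤ N, ∀ m,
      (P.iterate S κ η ξ k m).1 ∈ P.Ωα ∧ (P.iterate S κ η ξ k m).2 ∈ P.Ωβ m) {k : ℕ} (hk : k ≤ N) :
    𝔼 ξ : Fin M → Fin N → Fin n, drift (P.iterate S κ η ξ k)
      ≤ 5 * κ * (4 * κ * η ^ 2 * G ^ 2 + η ^ 2 * σ ^ 2) := by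
  have hκ' : (0 : ℝ) < κ := by exact_mod_cast hκ
  set A := 4 * κ * η ^ 2 * G ^ 2 + η ^ 2 * σ ^ 2 with hA
  have hA0 : 0 ≤ A := by positivity
  set c : ℝ := 3 / (2 * κ) with hc
  have hc0 : 0 ≤ c := by positivity
  have main : ∀ k ≤ N, 𝔼 ξ : Fin M → Fin N → Fin n, drift (P.iterate S κ η ξ k)
      ≤ A * ((k % κ : ℕ) * (1 + c) ^ (k % κ)) := by
    intro k
    induction k with
    | zero =>
      intro _
      have : ∀ ξ : Fin M → Fin N → Fin n, drift (P.iterate S κ η ξ 0) = 0 := by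
        intro ξ
        have hM' : (M : ℝ) ≠ 0 := by positivity
        have e : P.meanShared (P.iterate S κ η ξ 0) = P.startα := by
          change (1 / (M : ℝ)) • ∑ _m : Fin M, P.startα = P.startα
          rw [Finset.sum_const, Finset.card_univ, Fintype.card_fin, ← Nat.cast_smul_eq_nsmul ℝ,
            smul_smul, one_div_mul_cancel hM', one_smul]
        rw [drift, e]
        simp [iterate]
      simp [this]
    | succ k ih =>
      intro hk
      have ih := ih (by omega)
      rw [expect_iterate_succ S κ η hk]
      by_cases hd : κ ∣ k + 1
      · simp only [advance, if_pos hd, drift_aggregate hM, Finset.expect_const_zero]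
        positivity
      · have hmod : (k + 1) % κ = k % κ + 1 := by
          rw [Nat.add_mod_eq_ite]
          have h0 : (k + 1) % κ ≠ 0 := fun h0 => hd (Nat.dvd_of_mod_eq_zero h0)
          have h1 : 1 < κ := by
            by_contra! h1
            exact hd (by rw [le_antisymm h1 hκ]; exact one_dvd _)
          have h2 := Nat.mod_lt k (show 0 < κ by omega)
          rw [Nat.add_mod, Nat.mod_eq_of_lt h1] at h0
          rw [Nat.mod_eq_of_lt h1]
          split_ifs with h3
          · exfalso
            apply h0
            rw [show k % κ + 1 = κ by omega, Nat.mod_self]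
          · rfl
        simp only [advance, if_neg hd]
        calc 𝔼 ξ : Fin M → Fin N → Fin n, 𝔼 idx, drift (P.localStep S η idx (P.iterate S κ η ξ k))
            ≤ 𝔼 ξ : Fin M → Fin N → Fin n, ((1 + c) * drift (P.iterate S κ η ξ k) + A) :=
              Finset.expect_le_expect fun ξ _ =>
                expect_drift_localStep_le h hP hM hα hβ hκ hS hη hηα (hst ξ k (by omega))
          _ = (1 + c) * 𝔼 ξ : Fin M → Fin N → Fin n, drift (P.iterate S κ η ξ k) + A := by
              rw [Finset.expect_add_distrib, ← Finset.mul_expect, Fintype.expect_const]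
          _ ≤ (1 + c) * (A * ((k % κ : ℕ) * (1 + c) ^ (k % κ))) + A * (1 + c) ^ (k % κ + 1) := by
              gcongr
              exact le_mul_of_one_le_right hA0 (one_le_pow₀ (by linarith))
          _ = A * (((k + 1) % κ : ℕ) * (1 + c) ^ ((k + 1) % κ)) := by
              rw [hmod]
              push_cast
              ring
  refine (main k hk).trans ?_
  have hexp : (1 + c) ^ (k % κ) ≤ 5 := by
    have h1 : (1 + c) ^ (k % κ) ≤ (1 + c) ^ κ :=
      pow_le_pow_right₀ (by linarith) (Nat.mod_lt _ (by omega)).le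
    have h2 : (1 + c) ^ κ ≤ Real.exp (3 / 2) := by
      have h3 : 1 + c ≤ Real.exp c := by linarith [Real.add_one_le_exp c]
      calc (1 + c) ^ κ ≤ Real.exp c ^ κ := by gcongr
        _ = Real.exp (3 / 2) := by
          rw [← Real.exp_nat_mul, hc]
          congr 1
          field_simp
    have h3 : Real.exp (3 / 2) ≤ 5 := by
      have h4 : Real.exp (3 / 2) ^ 2 ≤ 5 ^ 2 := by
        rw [← Real.exp_nat_mul]
        have h5 : Real.exp ((2 : ℕ) * (3 / 2)) = Real.exp 1 ^ 3 := by
          rw [← Real.exp_nat_mul]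
          norm_num
        rw [h5]
        calc Real.exp 1 ^ 3 ≤ 2.7182818286 ^ 3 := by
              gcongr
              exact Real.exp_one_lt_d9.le
          _ ≤ 5 ^ 2 := by norm_num
      exact le_of_sq_le_sq h4 (by norm_num)
    linarith
  have hmodκ : ((k % κ : ℕ) : ℝ) ≤ κ := by exact_mod_cast (Nat.mod_lt _ (by omega)).le
  calc A * ((k % κ : ℕ) * (1 + c) ^ (k % κ)) ≤ A * (κ * 5) := by gcongr
    _ = 5 * κ * A := by ring

end Bandit

/-! ### Weighted averages along a contraction -/

/-- A perturbed contraction, solved by dividing the step `k` by `s ^ (k + 1)`; these are the weights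
of the output of the protocol. -/
lemma weighted_sum_le_of_recursion {s η e : ℝ} (hs : 0 < s) {r δ : ℕ → ℝ} {N : ℕ}
    (h : ∀ k < N, r (k + 1) ≤ s * r k - η * δ k + e) :
    η * ∑ k ∈ Finset.range N, (s ^ (k + 1))⁻¹ * δ k + (s ^ N)⁻¹ * r N
      ≤ r 0 + e * ∑ k ∈ Finset.range N, (s ^ (k + 1))⁻¹ := by
  induction N with
  | zero => simp
  | succ N ih =>
    have ih := ih fun k hk => h k (by omega)
    have h1 := mul_le_mul_of_nonneg_left (h N (by omega)) (by positivity : 0 ≤ (s ^ (N + 1))⁻¹)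
    have e1 : (s ^ (N + 1))⁻¹ * (s * r N - η * δ N + e)
        = (s ^ N)⁻¹ * r N - η * ((s ^ (N + 1))⁻¹ * δ N) + e * (s ^ (N + 1))⁻¹ := by
      field_simp
      ring
    rw [Finset.sum_range_succ, Finset.sum_range_succ]
    linarith

lemma mul_sum_weights {s : ℝ} (hs : 0 < s) (N : ℕ) :
    (1 - s) * ∑ k ∈ Finset.range N, (s ^ (k + 1))⁻¹ = (s ^ N)⁻¹ - 1 := by
  induction N with
  | zero => simp
  | succ N ih =>
    rw [Finset.sum_range_succ, mul_add, ih]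
    field_simp
    ring

/-- Jensen's inequality for a weighted average. Only the tangent inequality is needed. -/
lemma BlockSmooth.map_weighted_average_le {A B ι : Type*} [NormedAddCommGroup A]
    [InnerProductSpace ℝ A] [NormedAddCommGroup B] [InnerProductSpace ℝ B] {φ : A → B → ℝ}
    {gA : A → B → A} {gB : A → B → B} {βA βB : ℝ} (h : BlockSmooth φ gA gB βA βB)
    (t : Finset ι) (w : ι → ℝ) (hw : ∀ k ∈ t, 0 ≤ w k) (hW : 0 < ∑ k ∈ t, w k) (a : ι → A)
    (b : ι → B) :
    φ ((∑ k ∈ t, w k)⁻¹ • ∑ k ∈ t, w k • a k) ((∑ k ∈ t, w k)⁻¹ • ∑ k ∈ t, w k • b k)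
      ≤ (∑ k ∈ t, w k)⁻¹ * ∑ k ∈ t, w k * φ (a k) (b k) := by
  set W := ∑ k ∈ t, w k
  set x := W⁻¹ • ∑ k ∈ t, w k • a k with hx
  set y := W⁻¹ • ∑ k ∈ t, w k • b k with hy
  have hx' : ∑ k ∈ t, w k • (a k - x) = 0 := by
    simp_rw [smul_sub]
    rw [Finset.sum_sub_distrib, ← Finset.sum_smul, hx, smul_smul, mul_inv_cancel₀ hW.ne', one_smul,
      sub_self]
  have hy' : ∑ k ∈ t, w k • (b k - y) = 0 := by
    simp_rw [smul_sub]
    rw [Finset.sum_sub_distrib, ← Finset.sum_smul, hy, smul_smul, mul_inv_cancel₀ hW.ne', one_smul,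
      sub_self]
  have h1 : ∑ k ∈ t, w k * (⟪gA x y, a k - x⟫ + ⟪gB x y, b k - y⟫)
      ≤ ∑ k ∈ t, w k * (φ (a k) (b k) - φ x y) :=
    Finset.sum_le_sum fun k hk => mul_le_mul_of_nonneg_left (h.convex x y (a k) (b k)) (hw k hk)
  have h2 : ∑ k ∈ t, w k * (⟪gA x y, a k - x⟫ + ⟪gB x y, b k - y⟫) = 0 := by
    simp_rw [mul_add, ← real_inner_smul_right]
    rw [Finset.sum_add_distrib, ← inner_sum, ← inner_sum, hx', hy', inner_zero_right,
      inner_zero_right, add_zero]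
  simp_rw [mul_sub] at h1
  rw [h2, Finset.sum_sub_distrib, ← Finset.sum_mul] at h1
  rw [← div_eq_inv_mul, le_div_iff₀ hW]
  change 0 ≤ _ - W * _ at h1
  linarith

/-! ### The tuning -/

/-- The inverse of the step size. Its four summands control the curvature in the two blocks of
parameters, the variance of the averaged gradients, and the disagreement of the local copies. -/
noncomputable def invStep (c : Constants) : ℝ :=
  4 * c.ββ + 4 * (c.κ * c.βα) + c.σ ^ 2 / (c.M * c.target)
    + c.κ * √(c.βα * (c.G ^ 2 + c.σ ^ 2) / c.target)

/-- The step size; the value `1` is only used for constants that do not occur. -/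
noncomputable def stepSize (c : Constants) : ℝ := if 0 < invStep c then 1 / invStep c else 1

/-- The weight decay, which equals the contraction `η μω / 2` of one step; the value `0` is only
used for constants that do not occur. -/
noncomputable def weightDecay (c : Constants) : ℝ :=
  if stepSize c * c.μω / 2 ∈ Set.Ico (0 : ℝ) 1 then stepSize c * c.μω / 2 else 0

/-- The number of rounds after which the contraction outweighs the initial distance. -/
noncomputable def roundCount (c : Constants) : ℕ :=
  ⌈Real.log (2 + c.G ^ 2 / (c.μω * c.target)) / (weightDecay c * c.κ)⌉₊

/-- The rule that tunes the protocol. -/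
noncomputable def tuning (c : Constants) : Tuning where
  rounds := roundCount c
  step := stepSize c
  step_pos := by
    unfold stepSize
    split_ifs with h
    · positivity
    · exact one_pos
  decay := weightDecay c
  decay_mem := by
    unfold weightDecay
    split_ifs with h
    · exact h
    · simp

/-- The relations between the constants that hold in every problem. -/
structure Constants.Admissible (c : Constants) : Prop where
  M_pos : 0 < c.M
  κ_pos : 1 ≤ c.κ
  μω_pos : 0 < c.μω
  βα_pos : 0 < c.βα
  ββ_pos : 0 < c.ββ
  target_pos : 0 < c.target
  μω_le : c.μω ≤ c.βα

namespace Constants.Admissible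

variable {c : Constants} (h : c.Admissible)
include h

lemma invStep_pos : 0 < invStep c := by
  have := h.ββ_pos
  have := h.βα_pos
  have := h.target_pos
  unfold invStep
  positivity

lemma step_eq : (tuning c).step = 1 / invStep c := if_pos h.invStep_pos

lemma step_mul_le {x : ℝ} (hx : x ≤ invStep c) : x * (tuning c).step ≤ 1 := by
  rw [h.step_eq, mul_one_div, div_le_one h.invStep_pos]
  exact hx

lemma four_ββ_mul_step_le : 4 * c.ββ * (tuning c).step ≤ 1 := by
  have := h.βα_pos
  have := h.target_pos
  refine h.step_mul_le ?_
  unfold invStep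
  have h1 : 0 ≤ 4 * (c.κ * c.βα) := by positivity
  have h2 : 0 ≤ c.σ ^ 2 / (c.M * c.target) := by positivity
  have h3 : 0 ≤ c.κ * √(c.βα * (c.G ^ 2 + c.σ ^ 2) / c.target) := by positivity
  linarith

lemma four_βα_mul_step_le : 4 * (c.κ * c.βα) * (tuning c).step ≤ 1 := by
  have := h.ββ_pos
  have := h.target_pos
  refine h.step_mul_le ?_
  unfold invStep
  have h2 : 0 ≤ c.σ ^ 2 / (c.M * c.target) := by positivity
  have h3 : 0 ≤ c.κ * √(c.βα * (c.G ^ 2 + c.σ ^ 2) / c.target) := by positivity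
  linarith

lemma variance_mul_step_le : (tuning c).step * c.σ ^ 2 / c.M ≤ c.target := by
  have := h.ββ_pos
  have := h.βα_pos
  have := h.target_pos
  have hM : (0 : ℝ) < c.M := by exact_mod_cast h.M_pos
  have h1 : c.σ ^ 2 / (c.M * c.target) * (tuning c).step ≤ 1 := by
    refine h.step_mul_le ?_
    unfold invStep
    have h1 : 0 ≤ 4 * (c.κ * c.βα) := by positivity
    have h3 : 0 ≤ c.κ * √(c.βα * (c.G ^ 2 + c.σ ^ 2) / c.target) := by positivity
    linarith
  calc (tuning c).step * c.σ ^ 2 / c.M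
      = c.σ ^ 2 / (c.M * c.target) * (tuning c).step * c.target := by field_simp
    _ ≤ 1 * c.target := by gcongr
    _ = c.target := one_mul _

lemma drift_mul_step_le :
    c.βα * (c.κ * (tuning c).step) ^ 2 * (c.G ^ 2 + c.σ ^ 2) ≤ c.target := by
  have := h.ββ_pos
  have := h.βα_pos
  have := h.target_pos
  have h1 : c.κ * √(c.βα * (c.G ^ 2 + c.σ ^ 2) / c.target) * (tuning c).step ≤ 1 := by
    refine h.step_mul_le ?_
    unfold invStep
    have h1 : 0 ≤ 4 * (c.κ * c.βα) := by positivity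
    have h2 : 0 ≤ c.σ ^ 2 / (c.M * c.target) := by positivity
    linarith
  have h2 : (c.κ * √(c.βα * (c.G ^ 2 + c.σ ^ 2) / c.target) * (tuning c).step) ^ 2 ≤ 1 := by
    have := (tuning c).step_pos
    exact pow_le_one₀ (by positivity) h1
  rw [mul_pow, mul_pow, Real.sq_sqrt (by positivity)] at h2
  calc c.βα * (c.κ * (tuning c).step) ^ 2 * (c.G ^ 2 + c.σ ^ 2)
      = c.κ ^ 2 * (c.βα * (c.G ^ 2 + c.σ ^ 2) / c.target) * (tuning c).step ^ 2 * c.target := by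
        field_simp
    _ ≤ 1 * c.target := by gcongr
    _ = c.target := one_mul _

lemma decay_le_eighth : (tuning c).step * c.μω / 2 ≤ 1 / 8 := by
  have h1 := h.four_βα_mul_step_le
  have h2 := (tuning c).step_pos
  have h3 : c.μω ≤ c.κ * c.βα :=
    h.μω_le.trans (le_mul_of_one_le_left h.βα_pos.le (by exact_mod_cast h.κ_pos))
  have h4 : (tuning c).step * c.μω ≤ (tuning c).step * (c.κ * c.βα) := by gcongr
  linarith

lemma decay_eq : (tuning c).decay = (tuning c).step * c.μω / 2 := by
  have h1 := h.decay_le_eighth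
  have h2 := (tuning c).step_pos
  have h3 := h.μω_pos
  exact if_pos ⟨by change 0 ≤ (tuning c).step * c.μω / 2; positivity,
    h1.trans_lt (by norm_num)⟩

lemma decay_pos : 0 < (tuning c).decay := by
  rw [h.decay_eq]
  have h2 := (tuning c).step_pos
  have h3 := h.μω_pos
  positivity

lemma log_pos : 0 < Real.log (2 + c.G ^ 2 / (c.μω * c.target)) := by
  have := h.μω_pos
  have := h.target_pos
  refine Real.log_pos ?_
  have : 0 ≤ c.G ^ 2 / (c.μω * c.target) := by positivity
  linarith

/-- After all rounds the contraction is as small as the initial distance requires. -/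
lemma le_inv_pow : 2 + c.G ^ 2 / (c.μω * c.target)
    ≤ ((1 - (tuning c).decay) ^ ((tuning c).rounds * c.κ))⁻¹ := by
  have hμ := h.μω_pos
  have hε := h.target_pos
  have hκ : (0 : ℝ) < c.κ := by exact_mod_cast h.κ_pos
  have hq := h.decay_pos
  have hq1 : (tuning c).decay < 1 := (tuning c).decay_mem.2
  set q := (tuning c).decay
  set N := (tuning c).rounds * c.κ with hN
  have h1 : Real.log (2 + c.G ^ 2 / (c.μω * c.target)) ≤ q * N := by
    have h2 : Real.log (2 + c.G ^ 2 / (c.μω * c.target)) / (q * c.κ) ≤ (tuning c).rounds :=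
      Nat.le_ceil _
    rw [div_le_iff₀ (by positivity)] at h2
    rw [hN]
    push_cast
    linarith
  have hpos : 0 < 2 + c.G ^ 2 / (c.μω * c.target) := by positivity
  rw [le_inv_comm₀ hpos (pow_pos (by linarith) _)]
  calc (1 - q) ^ N ≤ Real.exp (-q) ^ N := by
        have : 0 ≤ 1 - q := by linarith
        gcongr
        exact Real.one_sub_le_exp_neg q
    _ = (Real.exp (q * N))⁻¹ := by
        rw [← Real.exp_nat_mul, ← Real.exp_neg]
        congr 1
        ring
    _ ≤ (2 + c.G ^ 2 / (c.μω * c.target))⁻¹ := by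
        gcongr
        rwa [← Real.log_le_iff_le_exp hpos]

/-- The number of rounds. Rounding up is harmless because `μω ≤ βα`. -/
lemma rounds_le : ((tuning c).rounds : ℝ) ≤ 18 * (Real.log (2 + c.G ^ 2 / (c.μω * c.target)) *
    (max (c.ββ / c.κ) c.βα / c.μω + c.σ ^ 2 / (c.μω * c.κ * c.M * c.target)
      + √(c.βα * (c.G ^ 2 + c.σ ^ 2) / (c.μω ^ 2 * c.target)))) := by
  have hμ := h.μω_pos
  have hε := h.target_pos
  have hβα := h.βα_pos
  have hββ := h.ββ_pos
  have hκ : (0 : ℝ) < c.κ := by exact_mod_cast h.κ_pos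
  have hM : (0 : ℝ) < c.M := by exact_mod_cast h.M_pos
  have hH := h.invStep_pos
  set L := Real.log (2 + c.G ^ 2 / (c.μω * c.target)) with hL
  have hLpos : 0 < L := h.log_pos
  have hlog : 1 / 2 ≤ L := by
    have h1 : Real.log 2 ≤ L := Real.log_le_log (by norm_num) (by
      have : 0 ≤ c.G ^ 2 / (c.μω * c.target) := by positivity
      linarith)
    linarith [Real.log_two_gt_d9]
  have hceil : ((tuning c).rounds : ℝ) ≤ L / ((tuning c).decay * c.κ) + 1 :=
    (Nat.ceil_lt_add_one (by have := h.decay_pos; positivity)).le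
  rw [h.decay_eq, h.step_eq] at hceil
  set m := max (c.ββ / c.κ) c.βα with hm
  have hm1 : c.ββ / c.κ ≤ m := le_max_left _ _
  have hm2 : c.βα ≤ m := le_max_right _ _
  have hroot : √(c.βα * (c.G ^ 2 + c.σ ^ 2) / (c.μω ^ 2 * c.target))
      = √(c.βα * (c.G ^ 2 + c.σ ^ 2) / c.target) / c.μω := by
    rw [mul_comm (c.μω ^ 2), ← div_div, Real.sqrt_div (by positivity), Real.sqrt_sq hμ.le]
  rw [hroot]
  set R := √(c.βα * (c.G ^ 2 + c.σ ^ 2) / c.target) with hR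
  have e1 : L / (1 / invStep c * c.μω / 2 * c.κ)
      = L * (8 * (c.ββ / c.κ) / c.μω + 8 * c.βα / c.μω
        + 2 * (c.σ ^ 2 / (c.μω * c.κ * c.M * c.target)) + 2 * (R / c.μω)) := by
    have : invStep c = 4 * c.ββ + 4 * (c.κ * c.βα) + c.σ ^ 2 / (c.M * c.target) + c.κ * R := rfl
    rw [this] at *
    field_simp
    ring
  rw [e1] at hceil
  have h1 : 1 ≤ L * (2 * (m / c.μω)) := by
    have h2 : 1 ≤ m / c.μω := by
      rw [one_le_div hμ]
      exact h.μω_le.trans hm2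
    nlinarith
  have h2 : L * (8 * (c.ββ / c.κ) / c.μω + 8 * c.βα / c.μω
        + 2 * (c.σ ^ 2 / (c.μω * c.κ * c.M * c.target)) + 2 * (R / c.μω))
      ≤ L * (8 * m / c.μω + 8 * m / c.μω
        + 2 * (c.σ ^ 2 / (c.μω * c.κ * c.M * c.target)) + 2 * (R / c.μω)) := by gcongr
  have h3 : 0 ≤ L * (c.σ ^ 2 / (c.μω * c.κ * c.M * c.target)) := by positivity
  have h4 : 0 ≤ L * (R / c.μω) := by positivity
  have e2 : 8 * m / c.μω = 8 * (m / c.μω) := by ring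
  rw [e2] at h2
  linarith

end Constants.Admissible

/-! ### Convergence of LSGD-PFL -/

namespace Bandit

variable {M K : ℕ} {X : Fin M → Type*} [∀ m, MeasurableSpace (X m)] {P : Bandit M K X}
  {n κ : ℕ} {μω βα ββ σ G ε : ℝ} {S : Dataset K X n}

/-- Jensen's inequality for the output of the protocol. -/
lemma empiricalLoss_output_le (h : P.LSGDCondition n κ μω βα ββ σ G) (hS : S.Valid) (c : Tuning)
    (hN : 0 < c.rounds * κ) (ξ : Fin M → Fin (c.rounds * κ) → Fin n) :
    P.empiricalLoss S (P.outputα S κ c ξ) (P.outputβ S κ c ξ)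
      ≤ (∑ k ∈ Finset.range (c.rounds * κ), ((1 - c.decay) ^ (k + 1))⁻¹)⁻¹ *
        ∑ k ∈ Finset.range (c.rounds * κ), ((1 - c.decay) ^ (k + 1))⁻¹ *
          P.empiricalLoss S (P.meanShared (P.iterate S κ c.step ξ k))
            (personalPart (P.iterate S κ c.step ξ k)) := by
  have hs : 0 < 1 - c.decay := by linarith [c.decay_mem.2]
  have hW : 0 < ∑ k ∈ Finset.range (c.rounds * κ), ((1 - c.decay) ^ (k + 1))⁻¹ :=
    Finset.sum_pos (fun k _ => by positivity) (Finset.nonempty_range_iff.2 hN.ne')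
  have key : ∀ m, P.localLoss S m (P.outputα S κ c ξ) (P.outputβ S κ c ξ m) ≤ _ := fun m =>
    (h.blockSmooth hS m).map_weighted_average_le (Finset.range (c.rounds * κ))
      (fun k => ((1 - c.decay) ^ (k + 1))⁻¹) (fun k _ => by positivity) hW
      (fun k => P.meanShared (P.iterate S κ c.step ξ k))
      (fun k => (P.iterate S κ c.step ξ k m).2)
  unfold empiricalLoss
  calc 1 / (M : ℝ) * ∑ m, P.localLoss S m (P.outputα S κ c ξ) (P.outputβ S κ c ξ m)
      ≤ 1 / (M : ℝ) * ∑ m, (∑ k ∈ Finset.range (c.rounds * κ), ((1 - c.decay) ^ (k + 1))⁻¹)⁻¹ *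
          ∑ k ∈ Finset.range (c.rounds * κ), ((1 - c.decay) ^ (k + 1))⁻¹ *
            P.localLoss S m (P.meanShared (P.iterate S κ c.step ξ k))
              (P.iterate S κ c.step ξ k m).2 :=
        mul_le_mul_of_nonneg_left (Finset.sum_le_sum fun m _ => key m) (by positivity)
    _ = _ := by
      rw [← Finset.mul_sum, Finset.sum_comm]
      simp_rw [Finset.mul_sum]
      refine Finset.sum_congr rfl fun k _ => Finset.sum_congr rfl fun m _ => ?_
      simp only [personalPart]
      ring

/-- The output of the protocol stays in the parameter region. -/
lemma output_mem (hP : P.Regular) (hM : 0 < M) (c : Tuning)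
    (hN : 0 < c.rounds * κ) (ξ : Fin M → Fin (c.rounds * κ) → Fin n)
    (hst : ∀ k ≤ c.rounds * κ, ∀ m, (P.iterate S κ c.step ξ k m).1 ∈ P.Ωα ∧
      (P.iterate S κ c.step ξ k m).2 ∈ P.Ωβ m) :
    P.outputα S κ c ξ ∈ P.Ωα ∧ ∀ m, P.outputβ S κ c ξ m ∈ P.Ωβ m := by
  have hs : 0 < 1 - c.decay := by linarith [c.decay_mem.2]
  have hW : 0 < ∑ k ∈ Finset.range (c.rounds * κ), ((1 - c.decay) ^ (k + 1))⁻¹ :=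
    Finset.sum_pos (fun k _ => by positivity) (Finset.nonempty_range_iff.2 hN.ne')
  constructor
  · exact hP.convexα.centerMass_mem (fun k _ => by positivity) hW fun k hk =>
      meanShared_mem hM hP.convexα fun m => (hst k (Finset.mem_range.1 hk).le m).1
  · intro m
    exact (hP.convexβ m).centerMass_mem (fun k _ => by positivity) hW fun k hk =>
      (hst k (Finset.mem_range.1 hk).le m).2

lemma stays_of_admissible (h : P.LSGDCondition n κ μω βα ββ σ G)
    (hc : Constants.Admissible ⟨M, κ, μω, βα, ββ, σ, G, ε⟩) (hS : S.Valid) (N : ℕ)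
    (ξ : Fin M → Fin N → Fin n) : ∀ k ≤ N, ∀ m,
      (P.iterate S κ (tuning ⟨M, κ, μω, βα, ββ, σ, G, ε⟩).step ξ k m).1 ∈ P.Ωα ∧
      (P.iterate S κ (tuning ⟨M, κ, μω, βα, ββ, σ, G, ε⟩).step ξ k m).2 ∈ P.Ωβ m := by
  have hββ : 0 < ββ := hc.ββ_pos
  have hβα : 0 < βα := hc.βα_pos
  have hκ : (0 : ℝ) < κ := by exact_mod_cast hc.κ_pos
  have hη := (tuning ⟨M, κ, μω, βα, ββ, σ, G, ε⟩).step_pos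
  refine h.stays S hS _ hη ?_ ?_ N ξ
  · rw [le_div_iff₀ hββ]
    have := hc.four_ββ_mul_step_le
    have h0 := mul_pos hη hββ
    dsimp only at this
    linarith
  · rw [le_div_iff₀ (by positivity)]
    have := hc.four_βα_mul_step_le
    have h0 := mul_pos hη (mul_pos hκ hβα)
    dsimp only at this
    linarith

lemma rounds_mul_pos (hc : Constants.Admissible ⟨M, κ, μω, βα, ββ, σ, G, ε⟩) :
    0 < (tuning ⟨M, κ, μω, βα, ββ, σ, G, ε⟩).rounds * κ := by
  have h1 := hc.κ_pos
  have h2 := hc.log_pos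
  have h3 := hc.decay_pos
  have h4 : (0 : ℝ) < κ := by exact_mod_cast hc.κ_pos
  have : 0 < (tuning ⟨M, κ, μω, βα, ββ, σ, G, ε⟩).rounds :=
    Nat.ceil_pos.2 (div_pos h2 (mul_pos h3 h4))
  exact Nat.mul_pos this h1

/-- The mean optimization error of LSGD-PFL with the tuning above is of the order of the target. -/
lemma expect_optimization_error_le (h : P.LSGDCondition n κ μω βα ββ σ G) (hP : P.Regular)
    [NeZero n] (hc : Constants.Admissible ⟨M, κ, μω, βα, ββ, σ, G, ε⟩) (hS : S.Valid)
    (α' : P.Shared) (b' : ∀ m, P.Personal m) :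
    𝔼 ξ, (P.empiricalLoss S (P.outputα S κ (tuning ⟨M, κ, μω, βα, ββ, σ, G, ε⟩) ξ)
      (P.outputβ S κ (tuning ⟨M, κ, μω, βα, ββ, σ, G, ε⟩) ξ) - P.empiricalLoss S α' b')
      ≤ 24 * ε := by
  have hM : 0 < M := hc.M_pos
  have hM' : (0 : ℝ) < M := by exact_mod_cast hM
  have hββ : 0 < ββ := hc.ββ_pos
  have hβα : 0 < βα := hc.βα_pos
  have hμ : 0 < μω := hc.μω_pos
  have hε : 0 < ε := hc.target_pos
  have hκ1 : 1 ≤ κ := hc.κ_pos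
  have hκ : (1 : ℝ) ≤ κ := by exact_mod_cast hκ1
  have hN := rounds_mul_pos hc
  have hpow := hc.le_inv_pow
  have hdecay := hc.decay_eq
  have hvar := hc.variance_mul_step_le
  have hdrift := hc.drift_mul_step_le
  have hηβ := hc.four_ββ_mul_step_le
  have hηα := hc.four_βα_mul_step_le
  have hqpos := hc.decay_pos
  have hstay := fun ξ => stays_of_admissible h hc hS
    ((tuning ⟨M, κ, μω, βα, ββ, σ, G, ε⟩).rounds * κ) ξ
  set c := tuning ⟨M, κ, μω, βα, ββ, σ, G, ε⟩
  dsimp only at hpow hdecay hvar hdrift hηβ hηα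
  have hη := c.step_pos
  set η := c.step
  have hs : 0 < 1 - c.decay := by linarith [c.decay_mem.2]
  have hηα' : 4 * βα * η ≤ 1 := by
    have : 4 * βα * η ≤ 4 * (κ * βα) * η := by
      gcongr
      exact le_mul_of_one_le_left hβα.le hκ
    linarith
  set N := c.rounds * κ
  obtain ⟨α, b, hmin⟩ := h.exists_minimizer hμ hS
  -- means of the squared distance and of the suboptimality after `k` local steps
  set r : ℕ → ℝ := fun k => 𝔼 ξ : Fin M → Fin N → Fin n, sqDist α b (P.iterate S κ η ξ k) with hr
  set δ : ℕ → ℝ := fun k => 𝔼 ξ : Fin M → Fin N → Fin n,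
    (P.empiricalLoss S (P.meanShared (P.iterate S κ η ξ k)) (personalPart (P.iterate S κ η ξ k))
      - P.empiricalLoss S α b) with hδ
  set e : ℝ := η * βα * (5 * κ * (4 * κ * η ^ 2 * G ^ 2 + η ^ 2 * σ ^ 2))
    + 2 * η ^ 2 * σ ^ 2 / M with he
  have hrec : ∀ k < N, r (k + 1) ≤ (1 - c.decay) * r k - η * δ k + e := by
    intro k hk
    have hd := expect_drift_iterate_le h hP hM hβα hββ hκ1 hS hη hηα hstay hk.le
    calc r (k + 1) = 𝔼 ξ : Fin M → Fin N → Fin n,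
          𝔼 idx, sqDist α b (P.advance S κ η k idx (P.iterate S κ η ξ k)) :=
          expect_iterate_succ S κ η hk _
      _ ≤ 𝔼 ξ : Fin M → Fin N → Fin n, ((1 - η * μω / 2) * sqDist α b (P.iterate S κ η ξ k)
          - η * (P.empiricalLoss S (P.meanShared (P.iterate S κ η ξ k))
            (personalPart (P.iterate S κ η ξ k)) - P.empiricalLoss S α b)
          + η * βα * drift (P.iterate S κ η ξ k) + 2 * η ^ 2 * σ ^ 2 / M) :=
          Finset.expect_le_expect fun ξ _ =>
            expect_sqDist_advance_le h hM hμ hβα hββ hS hmin hη hηα' hηβ (hstay ξ k hk.le) k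
      _ = (1 - c.decay) * r k - η * δ k
          + η * βα * (𝔼 ξ : Fin M → Fin N → Fin n, drift (P.iterate S κ η ξ k))
          + 2 * η ^ 2 * σ ^ 2 / M := by
          rw [Finset.expect_add_distrib, Finset.expect_add_distrib, Finset.expect_sub_distrib,
            ← Finset.mul_expect, ← Finset.mul_expect, ← Finset.mul_expect, Fintype.expect_const,
            hdecay]
      _ ≤ _ := by
          rw [he, ← add_assoc]
          gcongr
  have hsum := weighted_sum_le_of_recursion hs hrec
  have hW := mul_sum_weights hs N
  set W := ∑ k ∈ Finset.range N, ((1 - c.decay) ^ (k + 1))⁻¹ with hWdef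
  have hWpos : 0 < W :=
    Finset.sum_pos (fun k _ => by positivity) (Finset.nonempty_range_iff.2 hN.ne')
  have hrN : 0 ≤ r N := Finset.expect_nonneg fun ξ _ => sqDist_nonneg _ _ _
  have hr0 : r 0 ≤ 4 * G ^ 2 / μω ^ 2 := by
    have h0 := h.dist_start_sq_le hM hμ hS hmin hP.startα_mem hP.startβ_mem
    refine Finset.expect_le (Finset.univ_nonempty) fun ξ _ => ?_
    have e0 : P.meanShared (P.iterate S κ η ξ 0) = P.startα := by
      change (1 / (M : ℝ)) • ∑ _m : Fin M, P.startα = P.startα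
      rw [Finset.sum_const, Finset.card_univ, Fintype.card_fin, ← Nat.cast_smul_eq_nsmul ℝ,
        smul_smul, one_div_mul_cancel hM'.ne', one_smul]
    rw [sqDist, e0]
    exact h0
  have hinvpos : 0 < ((1 - c.decay) ^ N)⁻¹ := by positivity
  -- the initial distance, damped by the contraction
  have hinit : r 0 ≤ 2 * ε * (η * W) := by
    have hW' : η * W = 2 / μω * (((1 - c.decay) ^ N)⁻¹ - 1) := by
      rw [← hW, sub_sub_cancel, hdecay]
      field_simp
    have h1 : 1 + G ^ 2 / (μω * ε) ≤ ((1 - c.decay) ^ N)⁻¹ - 1 := by linarith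
    calc r 0 ≤ 4 * G ^ 2 / μω ^ 2 := hr0
      _ = 2 * ε * (2 / μω * (G ^ 2 / (μω * ε))) := by field_simp; ring
      _ ≤ 2 * ε * (2 / μω * (((1 - c.decay) ^ N)⁻¹ - 1)) := by
          gcongr
          linarith
      _ = _ := by rw [hW']
  have herr : e ≤ 22 * ε * η := by
    have h1 : 4 * κ * η ^ 2 * G ^ 2 + η ^ 2 * σ ^ 2 ≤ 4 * κ * η ^ 2 * (G ^ 2 + σ ^ 2) := by
      have : η ^ 2 * σ ^ 2 ≤ 4 * κ * (η ^ 2 * σ ^ 2) :=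
        le_mul_of_one_le_left (by positivity) (by linarith)
      linarith
    calc e ≤ η * βα * (5 * κ * (4 * κ * η ^ 2 * (G ^ 2 + σ ^ 2))) + 2 * η ^ 2 * σ ^ 2 / M := by
          rw [he]
          gcongr
      _ = η * (20 * (βα * (κ * η) ^ 2 * (G ^ 2 + σ ^ 2)) + 2 * (η * σ ^ 2 / M)) := by ring
      _ ≤ η * (20 * ε + 2 * ε) := by gcongr
      _ = 22 * ε * η := by ring
  have hδsum : ∑ k ∈ Finset.range N, ((1 - c.decay) ^ (k + 1))⁻¹ * δ k ≤ 24 * ε * W := by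
    have h1 : 0 ≤ ((1 - c.decay) ^ N)⁻¹ * r N := by positivity
    have h2 : e * W ≤ 22 * ε * η * W := by gcongr
    have h3 : η * ∑ k ∈ Finset.range N, ((1 - c.decay) ^ (k + 1))⁻¹ * δ k
        ≤ η * (24 * ε * W) := by
      linarith
    exact le_of_mul_le_mul_left h3 hη
  have hle : P.empiricalLoss S α b ≤ P.empiricalLoss S α' b' := by
    have := hmin α' b'
    have h0 : 0 ≤ μω / 2 * (‖α' - α‖ ^ 2 + ∑ m, ‖b' m - b m‖ ^ 2) := by positivity
    linarith
  calc 𝔼 ξ, (P.empiricalLoss S (P.outputα S κ c ξ) (P.outputβ S κ c ξ) - P.empiricalLoss S α' b')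
      ≤ 𝔼 ξ : Fin M → Fin N → Fin n, W⁻¹ * ∑ k ∈ Finset.range N, ((1 - c.decay) ^ (k + 1))⁻¹ *
          (P.empiricalLoss S (P.meanShared (P.iterate S κ η ξ k))
            (personalPart (P.iterate S κ η ξ k)) - P.empiricalLoss S α b) := by
        refine Finset.expect_le_expect fun ξ _ => ?_
        have h1 := empiricalLoss_output_le h hS c hN ξ
        have h2 : W⁻¹ * ∑ k ∈ Finset.range N, ((1 - c.decay) ^ (k + 1))⁻¹ *
            (P.empiricalLoss S (P.meanShared (P.iterate S κ η ξ k))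
              (personalPart (P.iterate S κ η ξ k)) - P.empiricalLoss S α b)
            = W⁻¹ * (∑ k ∈ Finset.range N, ((1 - c.decay) ^ (k + 1))⁻¹ *
            P.empiricalLoss S (P.meanShared (P.iterate S κ η ξ k))
              (personalPart (P.iterate S κ η ξ k))) - P.empiricalLoss S α b := by
          simp_rw [mul_sub]
          rw [Finset.sum_sub_distrib, ← Finset.sum_mul, mul_sub, ← mul_assoc, ← hWdef,
            inv_mul_cancel₀ hWpos.ne', one_mul]
        rw [h2]
        linarith
    _ = W⁻¹ * ∑ k ∈ Finset.range N, ((1 - c.decay) ^ (k + 1))⁻¹ * δ k := by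
        rw [← Finset.mul_expect, Finset.expect_sum_comm]
        simp_rw [← Finset.mul_expect]
        rfl
    _ ≤ W⁻¹ * (24 * ε * W) := by gcongr
    _ = 24 * ε := by field_simp

end Bandit

/-! ### Symmetrization -/

lemma uniformOn_univ_eq {Ω : Type*} [Fintype Ω] [MeasurableSpace Ω] :
    (uniformOn Set.univ : Measure Ω) = (Fintype.card Ω : ℝ≥0∞)⁻¹ • Measure.count := by
  simp [uniformOn, ProbabilityTheory.cond]

lemma integral_uniformOn_univ {Ω : Type*} [Fintype Ω] [MeasurableSpace Ω]
    [MeasurableSingletonClass Ω] (φ : Ω → ℝ) : ∫ x, φ x ∂uniformOn Set.univ = 𝔼 x, φ x := by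
  rw [uniformOn_univ_eq, integral_smul_measure, integral_count, Fintype.expect_eq_sum_div_card,
    ENNReal.toReal_inv, ENNReal.toReal_natCast, smul_eq_mul, div_eq_inv_mul]

lemma lintegral_ofReal_uniformOn_univ {Ω : Type*} [Fintype Ω] [MeasurableSpace Ω] [Nonempty Ω]
    [MeasurableSingletonClass Ω] {φ : Ω → ℝ} (hφ : ∀ x, 0 ≤ φ x) :
    ∫⁻ x, ENNReal.ofReal (φ x) ∂uniformOn Set.univ = ENNReal.ofReal (𝔼 x, φ x) := by
  rw [← integral_uniformOn_univ, ofReal_integral_eq_lintegral_ofReal .of_finite (.of_forall hφ)]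

/-- Pairing the coordinates of two product measures gives a product measure. -/
lemma measurePreserving_zip {ι : Type*} [Fintype ι] {α β : ι → Type*}
    [∀ i, MeasurableSpace (α i)] [∀ i, MeasurableSpace (β i)] (μ : ∀ i, Measure (α i))
    (ν : ∀ i, Measure (β i)) [∀ i, SigmaFinite (μ i)] [∀ i, SigmaFinite (ν i)] :
    MeasurePreserving (fun (p : (∀ i, α i) × (∀ i, β i)) i => (p.1 i, p.2 i))
      ((Measure.pi μ).prod (Measure.pi ν)) (Measure.pi fun i => (μ i).prod (ν i)) := by
  have hm : Measurable (fun (p : (∀ i, α i) × (∀ i, β i)) i => (p.1 i, p.2 i)) := by fun_prop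
  refine ⟨hm, (Measure.pi_eq_generateFrom (fun i => generateFrom_prod) (fun i => isPiSystem_prod)
    (fun i => (μ i).toFiniteSpanningSetsIn.prod (ν i).toFiniteSpanningSetsIn) fun s hs => ?_).symm⟩
  choose A hA B hB hAB using hs
  have hs' : s = fun i => A i ×ˢ B i := funext fun i => (hAB i).symm
  have hset : (fun (p : (∀ i, α i) × (∀ i, β i)) i => (p.1 i, p.2 i)) ⁻¹' Set.univ.pi s
      = Set.univ.pi A ×ˢ Set.univ.pi B := by
    ext p
    simp [hs', forall_and]
  rw [Measure.map_apply hm (MeasurableSet.univ_pi fun i => by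
    rw [hs']; exact (hA i).prod (hB i)), hset, Measure.prod_prod, Measure.pi_pi, Measure.pi_pi,
    ← Finset.prod_mul_distrib]
  simp [hs', Measure.prod_prod]

/-- If two samples agree in law and are independent, then exchanging some of their coordinates does
not change their joint law. -/
lemma measurePreserving_exchange {ι : Type*} [Fintype ι] {α : ι → Type*}
    [∀ i, MeasurableSpace (α i)] (μ : ∀ i, Measure (α i)) [∀ i, SigmaFinite (μ i)]
    {T : ∀ i, α i × α i → α i × α i}
    (hT : ∀ i, MeasurePreserving (T i) ((μ i).prod (μ i)) ((μ i).prod (μ i))) :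
    MeasurePreserving (fun p : (∀ i, α i) × (∀ i, α i) =>
        ((fun i => (T i (p.1 i, p.2 i)).1, fun i => (T i (p.1 i, p.2 i)).2) :
          (∀ i, α i) × (∀ i, α i)))
      ((Measure.pi μ).prod (Measure.pi μ)) ((Measure.pi μ).prod (Measure.pi μ)) := by
  set zip := fun (p : (∀ i, α i) × (∀ i, α i)) i => (p.1 i, p.2 i)
  set unzip : (∀ i, α i × α i) → (∀ i, α i) × (∀ i, α i) :=
    fun q => (fun i => (q i).1, fun i => (q i).2)
  have hz : MeasurePreserving zip _ _ := measurePreserving_zip μ μ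
  have hu : Measurable unzip := by fun_prop
  have hu' : MeasurePreserving unzip (Measure.pi fun i => (μ i).prod (μ i))
      ((Measure.pi μ).prod (Measure.pi μ)) := by
    refine ⟨hu, ?_⟩
    rw [← hz.map_eq, Measure.map_map hu hz.measurable]
    exact Measure.map_id
  exact hu'.comp ((measurePreserving_pi _ _ hT).comp hz)

lemma measurePreserving_exchange_nested {M n : ℕ} {Y : Fin M → Type*}
    [∀ m, MeasurableSpace (Y m)] (Q : ∀ m, Measure (Y m)) [∀ m, IsProbabilityMeasure (Q m)]
    (s : Fin M → Fin n → Bool) :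
    MeasurePreserving (fun p : (∀ m, Fin n → Y m) × (∀ m, Fin n → Y m) =>
        ((fun m i => if s m i then p.1 m i else p.2 m i,
          fun m i => if s m i then p.2 m i else p.1 m i) :
          (∀ m, Fin n → Y m) × (∀ m, Fin n → Y m)))
      ((Measure.pi fun m => Measure.pi fun _ : Fin n => Q m).prod
        (Measure.pi fun m => Measure.pi fun _ : Fin n => Q m))
      ((Measure.pi fun m => Measure.pi fun _ : Fin n => Q m).prod
        (Measure.pi fun m => Measure.pi fun _ : Fin n => Q m)) := by
  refine measurePreserving_exchange (fun m => Measure.pi fun _ : Fin n => Q m)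
    (T := fun m p => (fun i => if s m i then p.1 i else p.2 i,
      fun i => if s m i then p.2 i else p.1 i)) fun m => ?_
  have := measurePreserving_exchange (fun _ : Fin n => Q m)
    (T := fun i p => (if s m i then p.1 else p.2, if s m i then p.2 else p.1)) fun i => ?_
  · exact this
  · cases s m i
    · exact Measure.measurePreserving_swap
    · exact MeasurePreserving.id _

/-- By separability and continuity the supremum is one over a countable dense set. -/
lemma measurable_ciSup_of_continuous {Z W : Type*} [MeasurableSpace Z] [TopologicalSpace W]
    [TopologicalSpace.SeparableSpace W] {φ : W → Z → ℝ} (hmeas : ∀ w, Measurable (φ w))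
    (hcont : ∀ z, Continuous fun w => φ w z) : Measurable fun z => ⨆ w, φ w z := by
  obtain ⟨D, hDc, hD⟩ := TopologicalSpace.exists_countable_dense W
  have : Countable D := hDc
  have e : (fun z => ⨆ w, φ w z) = fun z => ⨆ w : D, φ w z :=
    funext fun z => (hD.ciSup' (hcont z)).symm
  rw [e]
  exact Measurable.iSup fun w => hmeas w

lemma bddAbove_of_abs_le {W : Type*} {φ : W → ℝ} {B : ℝ} (h : ∀ w, |φ w| ≤ B) :
    BddAbove (Set.range φ) := by
  refine ⟨B, ?_⟩
  rintro _ ⟨w, rfl⟩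
  exact (abs_le.1 (h w)).2

lemma abs_ciSup_le {W : Type*} [Nonempty W] {φ : W → ℝ} {B : ℝ} (h : ∀ w, |φ w| ≤ B) :
    |⨆ w, φ w| ≤ B := by
  obtain ⟨w⟩ := ‹Nonempty W›
  exact abs_le.2 ⟨(abs_le.1 (h w)).1.trans (le_ciSup (bddAbove_of_abs_le h) w),
    have : Nonempty W := ⟨w⟩; ciSup_le fun w => (abs_le.1 (h w)).2⟩

lemma abs_sign (s : Bool) : |Bandit.sign s| = 1 := by cases s <;> simp [Bandit.sign]

/-- Symmetrization: the mean of the largest difference of two independent empirical averages is at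
most twice the Rademacher complexity. -/
lemma integral_iSup_sub_le {M n : ℕ} {Y : Fin M → Type*} [∀ m, MeasurableSpace (Y m)]
    (Q : ∀ m, Measure (Y m)) [∀ m, IsProbabilityMeasure (Q m)] {W : Type*} [TopologicalSpace W]
    [TopologicalSpace.SeparableSpace W] [Nonempty W] {h : ∀ m, W → Y m → ℝ}
    (hmeas : ∀ m w, Measurable (h m w)) (hcont : ∀ m y, Continuous fun w => h m w y) {B c : ℝ}
    (hc : 0 ≤ c) (hB : ∀ m w y, |h m w y| ≤ B) :
    ∫ p : (∀ m, Fin n → Y m) × (∀ m, Fin n → Y m),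
        ⨆ w, ∑ m, c * ∑ i, (h m w (p.2 m i) - h m w (p.1 m i))
        ∂((Measure.pi fun m => Measure.pi fun _ : Fin n => Q m).prod
          (Measure.pi fun m => Measure.pi fun _ : Fin n => Q m))
      ≤ 2 * ∫ S : ∀ m, Fin n → Y m, ∫ s : Fin M → Fin n → Bool,
          ⨆ w, ∑ m, c * ∑ i, Bandit.sign (s m i) * h m w (S m i)
          ∂(uniformOn Set.univ) ∂(Measure.pi fun m => Measure.pi fun _ : Fin n => Q m) := by
  set μ := Measure.pi fun m => Measure.pi fun _ : Fin n => Q m with hμ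
  set rad : (Fin M → Fin n → Bool) → (∀ m, Fin n → Y m) → ℝ :=
    fun s S => ⨆ w, ∑ m, c * ∑ i, Bandit.sign (s m i) * h m w (S m i) with hrad
  set φ : (Fin M → Fin n → Bool) → W → (∀ m, Fin n → Y m) × (∀ m, Fin n → Y m) → ℝ :=
    fun s w p => ∑ m, c * ∑ i, Bandit.sign (s m i) * (h m w (p.2 m i) - h m w (p.1 m i)) with hφ
  have hmeas' : ∀ m w i, Measurable fun S : ∀ m, Fin n → Y m => h m w (S m i) := fun m w i =>
    (hmeas m w).comp ((measurable_pi_apply i).comp (measurable_pi_apply m))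
  have hradbd : ∀ (s : Fin M → Fin n → Bool) (w : W) (S : ∀ m, Fin n → Y m),
      |∑ m, c * ∑ i, Bandit.sign (s m i) * h m w (S m i)|
        ≤ ∑ _m : Fin M, c * ∑ _i : Fin n, B := by
    intro s w S
    refine (Finset.abs_sum_le_sum_abs _ _).trans (Finset.sum_le_sum fun m _ => ?_)
    rw [abs_mul, abs_of_nonneg hc]
    gcongr
    refine (Finset.abs_sum_le_sum_abs _ _).trans (Finset.sum_le_sum fun i _ => ?_)
    rw [abs_mul, abs_sign, one_mul]
    exact hB _ _ _
  have hφbd : ∀ s w p, |φ s w p| ≤ ∑ _m : Fin M, c * ∑ _i : Fin n, (B + B) := by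
    intro s w p
    refine (Finset.abs_sum_le_sum_abs _ _).trans (Finset.sum_le_sum fun m _ => ?_)
    rw [abs_mul, abs_of_nonneg hc]
    gcongr
    refine (Finset.abs_sum_le_sum_abs _ _).trans (Finset.sum_le_sum fun i _ => ?_)
    rw [abs_mul, abs_sign, one_mul]
    exact (abs_sub _ _).trans (add_le_add (hB _ _ _) (hB _ _ _))
  have hradmeas : ∀ s, Measurable (rad s) := fun s =>
    measurable_ciSup_of_continuous
      (fun w => Finset.measurable_fun_sum _ fun m _ =>
        (Finset.measurable_fun_sum _ fun i _ => (hmeas' m w i).const_mul _).const_mul _)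
      (fun S => by fun_prop)
  have hφmeas : ∀ s, Measurable fun p => ⨆ w, φ s w p := fun s =>
    measurable_ciSup_of_continuous
      (fun w => Finset.measurable_fun_sum _ fun m _ =>
        (Finset.measurable_fun_sum _ fun i _ =>
          (((hmeas' m w i).comp measurable_snd).sub
            ((hmeas' m w i).comp measurable_fst)).const_mul _).const_mul _)
      (fun p => by fun_prop)
  have hradint : ∀ s, Integrable (rad s) μ := fun s =>
    Integrable.of_bound (hradmeas s).aestronglyMeasurable (∑ _m : Fin M, c * ∑ _i : Fin n, B)
      (.of_forall fun S => abs_ciSup_le fun w => hradbd s w S)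
  have hφint : ∀ s, Integrable (fun p => ⨆ w, φ s w p) (μ.prod μ) := fun s =>
    Integrable.of_bound (hφmeas s).aestronglyMeasurable (∑ _m : Fin M, c * ∑ _i : Fin n, (B + B))
      (.of_forall fun p => abs_ciSup_le fun w => hφbd s w p)
  -- signs may be inserted, since exchanging the two samples of a coordinate preserves the law
  have hexch : ∀ s, ∫ p, ⨆ w, φ (fun _ _ => true) w p ∂(μ.prod μ)
      = ∫ p, ⨆ w, φ s w p ∂(μ.prod μ) := by
    intro s
    have hT := measurePreserving_exchange_nested Q s
    rw [← hμ] at hT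
    conv_lhs => rw [← hT.map_eq]
    rw [integral_map hT.measurable.aemeasurable (hφmeas _).aestronglyMeasurable]
    refine integral_congr_ae (.of_forall fun p => ?_)
    refine iSup_congr fun w => ?_
    refine Finset.sum_congr rfl fun m _ => ?_
    congr 1
    refine Finset.sum_congr rfl fun i _ => ?_
    cases hs : s m i <;> simp [Bandit.sign, hs]
  have hsplit : ∀ s, ∫ p, ⨆ w, φ s w p ∂(μ.prod μ)
      ≤ ∫ S, rad s S ∂μ + ∫ S, rad (fun m i => !s m i) S ∂μ := by
    intro s
    have i1 : Integrable (fun p : (∀ m, Fin n → Y m) × (∀ m, Fin n → Y m) => rad s p.2)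
        (μ.prod μ) := (hradint s).comp_snd μ
    have i2 : Integrable (fun p : (∀ m, Fin n → Y m) × (∀ m, Fin n → Y m) =>
        rad (fun m i => !s m i) p.1) (μ.prod μ) := (hradint _).comp_fst μ
    calc ∫ p, ⨆ w, φ s w p ∂(μ.prod μ)
        ≤ ∫ p, (rad s p.2 + rad (fun m i => !s m i) p.1) ∂(μ.prod μ) := by
          refine integral_mono (hφint s) (i1.add i2) fun p => ciSup_le fun w => ?_
          have e : φ s w p = ∑ m, c * ∑ i, Bandit.sign (s m i) * h m w (p.2 m i)
              + ∑ m, c * ∑ i, Bandit.sign (!s m i) * h m w (p.1 m i) := by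
            rw [← Finset.sum_add_distrib]
            refine Finset.sum_congr rfl fun m _ => ?_
            rw [← mul_add, ← Finset.sum_add_distrib]
            congr 1
            refine Finset.sum_congr rfl fun i _ => ?_
            cases s m i <;> simp [Bandit.sign] <;> ring
          rw [e]
          exact add_le_add (le_ciSup (bddAbove_of_abs_le fun w => hradbd s w p.2) w)
            (le_ciSup (bddAbove_of_abs_le fun w => hradbd (fun m i => !s m i) w p.1) w)
      _ = _ := by
          rw [integral_add i1 i2, integral_fun_snd (fun S => rad s S),
            integral_fun_fst (fun S => rad (fun m i => !s m i) S)]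
          simp
  have hneg : 𝔼 s : Fin M → Fin n → Bool, ∫ S, rad (fun m i => !s m i) S ∂μ
      = 𝔼 s, ∫ S, rad s S ∂μ := by
    have hinv : Function.Involutive fun (s : Fin M → Fin n → Bool) m i => !s m i := by
      intro s
      simp
    exact Finset.expect_equiv (hinv.toPerm _) (by simp) (by intro s _; rfl)
  have hmain : ∫ p, ⨆ w, φ (fun _ _ => true) w p ∂(μ.prod μ) ≤ 2 * 𝔼 s, ∫ S, rad s S ∂μ :=
    calc ∫ p, ⨆ w, φ (fun _ _ => true) w p ∂(μ.prod μ)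
        = 𝔼 _s : Fin M → Fin n → Bool, ∫ p, ⨆ w, φ (fun _ _ => true) w p ∂(μ.prod μ) := by
          rw [Fintype.expect_const]
      _ ≤ 𝔼 s : Fin M → Fin n → Bool,
          (∫ S, rad s S ∂μ + ∫ S, rad (fun m i => !s m i) S ∂μ) :=
          Finset.expect_le_expect fun s _ => (hexch s).le.trans (hsplit s)
      _ = 2 * 𝔼 s, ∫ S, rad s S ∂μ := by
          rw [Finset.expect_add_distrib, hneg, two_mul]
  simp_rw [integral_uniformOn_univ]
  have e1 : ∫ S, 𝔼 s, rad s S ∂μ = 𝔼 s, ∫ S, rad s S ∂μ := by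
    simp_rw [Fintype.expect_eq_sum_div_card]
    rw [integral_div, integral_finsetSum _ fun s _ => hradint s]
  have e2 : ∀ p : (∀ m, Fin n → Y m) × (∀ m, Fin n → Y m),
      ⨆ w, ∑ m, c * ∑ i, (h m w (p.2 m i) - h m w (p.1 m i)) = ⨆ w, φ (fun _ _ => true) w p := by
    intro p
    simp [hφ, Bandit.sign]
  simp_rw [e2]
  exact hmain.trans_eq (by rw [← e1])

/-! ### The law of a sample -/

section SampleLaw

variable {K : ℕ} {Y : Type*} [MeasurableSpace Y] {D : Measure (Y × (Fin K → ℝ))}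
  {p : Y → Fin K → ℝ}

lemma measurable_observe (a : Fin K) :
    Measurable fun z : Y × (Fin K → ℝ) => ((z.1, a, z.2 a) : Y × Fin K × ℝ) :=
  measurable_fst.prodMk (measurable_const.prodMk ((measurable_pi_apply a).comp measurable_snd))

lemma measurable_sampleKernel (hp : ∀ a, Measurable fun x => p x a) :
    Measurable fun z : Y × (Fin K → ℝ) =>
      ∑ a, ENNReal.ofReal (p z.1 a) • (Measure.dirac (z.1, a, z.2 a) : Measure (Y × Fin K × ℝ)) := by
  refine Measure.measurable_of_measurable_coe _ fun s hs => ?_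
  simp only [Measure.coe_finsetSum, Finset.sum_apply, Measure.smul_apply, smul_eq_mul]
  refine Finset.measurable_fun_sum _ fun a _ => ?_
  exact ((hp a).comp measurable_fst).ennreal_ofReal.mul
    ((Measure.measurable_coe hs).comp (Measure.measurable_dirac.comp (measurable_observe a)))

/-- The law of a sample, as a sum over the arms. -/
lemma sampleLaw_eq_sum (hp : ∀ a, Measurable fun x => p x a) :
    sampleLaw D p = ∑ a, (D.withDensity fun z => ENNReal.ofReal (p z.1 a)).map
      fun z => (z.1, a, z.2 a) := by
  ext s hs
  rw [sampleLaw, Measure.bind_apply hs (measurable_sampleKernel hp).aemeasurable]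
  simp only [Measure.coe_finsetSum, Finset.sum_apply, Measure.smul_apply, smul_eq_mul]
  have hm : ∀ a, Measurable fun z : Y × (Fin K → ℝ) => ENNReal.ofReal (p z.1 a) := fun a =>
    ((hp a).comp measurable_fst).ennreal_ofReal
  rw [lintegral_finsetSum]
  · refine Finset.sum_congr rfl fun a _ => ?_
    rw [Measure.map_apply (measurable_observe a) hs, withDensity_apply _ (measurable_observe a hs),
      ← lintegral_indicator (measurable_observe a hs)]
    refine lintegral_congr fun z => ?_
    rw [Measure.dirac_apply' _ hs]
    by_cases hz : (z.1, a, z.2 a) ∈ s <;> simp [Set.indicator, hz]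
  · intro a _
    exact (hm a).mul
      ((Measure.measurable_coe hs).comp (Measure.measurable_dirac.comp (measurable_observe a)))

lemma isProbabilityMeasure_sampleLaw [IsProbabilityMeasure D]
    (hp : ∀ a, Measurable fun x => p x a) (hp1 : ∀ x, p x ∈ stdSimplex ℝ (Fin K)) :
    IsProbabilityMeasure (sampleLaw D p) := by
  refine ⟨?_⟩
  rw [sampleLaw, Measure.bind_apply .univ (measurable_sampleKernel hp).aemeasurable]
  simp only [Measure.coe_finsetSum, Finset.sum_apply, Measure.smul_apply, smul_eq_mul,
    measure_univ, mul_one]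
  have : ∀ z : Y × (Fin K → ℝ), ∑ a, ENNReal.ofReal (p z.1 a) = 1 := fun z => by
    rw [← ENNReal.ofReal_sum_of_nonneg fun a _ => (hp1 z.1).1 a, (hp1 z.1).2, ENNReal.ofReal_one]
  simp [this]

lemma lintegral_sampleLaw (hp : ∀ a, Measurable fun x => p x a) {φ : Y × Fin K × ℝ → ℝ≥0∞}
    (hφ : Measurable φ) :
    ∫⁻ s, φ s ∂sampleLaw D p = ∫⁻ z, ∑ a, ENNReal.ofReal (p z.1 a) * φ (z.1, a, z.2 a) ∂D := by
  have hm : ∀ a, Measurable fun z : Y × (Fin K → ℝ) => ENNReal.ofReal (p z.1 a) := fun a =>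
    ((hp a).comp measurable_fst).ennreal_ofReal
  rw [sampleLaw_eq_sum hp, lintegral_finsetSum_measure, lintegral_finsetSum]
  · refine Finset.sum_congr rfl fun a _ => ?_
    rw [lintegral_map hφ (measurable_observe a)]
    exact lintegral_withDensity_eq_lintegral_mul _ (hm a) (hφ.comp (measurable_observe a))
  · intro a _
    exact (hm a).mul (hφ.comp (measurable_observe a))

lemma integral_sampleLaw [IsProbabilityMeasure D] (hp : ∀ a, Measurable fun x => p x a)
    (hp1 : ∀ x, p x ∈ stdSimplex ℝ (Fin K)) {φ : Y × Fin K × ℝ → ℝ} (hφ : Measurable φ) {C : ℝ}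
    (hC : ∀ s, |φ s| ≤ C) :
    ∫ s, φ s ∂sampleLaw D p = ∫ z, ∑ a, p z.1 a * φ (z.1, a, z.2 a) ∂D := by
  have hm : ∀ a, Measurable fun z : Y × (Fin K → ℝ) => ENNReal.ofReal (p z.1 a) := fun a =>
    ((hp a).comp measurable_fst).ennreal_ofReal
  have hle : ∀ z : Y × (Fin K → ℝ), ∀ a, p z.1 a ≤ 1 := fun z a =>
    (Finset.single_le_sum (fun a _ => (hp1 z.1).1 a) (Finset.mem_univ a)).trans_eq (hp1 z.1).2
  have hfin : ∀ a, IsFiniteMeasure ((D.withDensity fun z => ENNReal.ofReal (p z.1 a)).map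
      fun z => ((z.1, a, z.2 a) : Y × Fin K × ℝ)) := fun a => by
    have : IsFiniteMeasure (D.withDensity fun z => ENNReal.ofReal (p z.1 a)) := by
      refine isFiniteMeasure_withDensity (ne_top_of_le_ne_top ENNReal.one_ne_top
        ((lintegral_mono fun z => ENNReal.ofReal_le_one.2 (hle z a)).trans ?_))
      simp
    infer_instance
  rw [sampleLaw_eq_sum hp, integral_finsetSum_measure, integral_finsetSum]
  · refine Finset.sum_congr rfl fun a _ => ?_
    rw [integral_map (measurable_observe a).aemeasurable hφ.aestronglyMeasurable,
      integral_withDensity_eq_integral_toReal_smul (hm a) (.of_forall fun z => ENNReal.ofReal_lt_top)]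
    refine integral_congr_ae (.of_forall fun z => ?_)
    simp only [ENNReal.toReal_ofReal ((hp1 z.1).1 a), smul_eq_mul]
  · intro a _
    refine Integrable.of_bound (((hp a).comp measurable_fst).mul
      (hφ.comp (measurable_observe a))).aestronglyMeasurable C (.of_forall fun z => ?_)
    have h1 := hC (z.1, a, z.2 a)
    rw [Real.norm_eq_abs]
    change |p z.1 a * φ (z.1, a, z.2 a)| ≤ C
    rw [abs_mul, abs_of_nonneg ((hp1 z.1).1 a)]
    exact (mul_le_of_le_one_left (abs_nonneg _) (hle z a)).trans h1
  · intro a _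
    have := hfin a
    exact Integrable.of_bound hφ.aestronglyMeasurable C (.of_forall hC)

lemma ae_sampleLaw_reward_mem (hp : ∀ a, Measurable fun x => p x a)
    (hD : ∀ᵐ z ∂D, ∀ a, z.2 a ∈ Set.Icc (0 : ℝ) 1) :
    ∀ᵐ s ∂sampleLaw D p, s.2.2 ∈ Set.Icc (0 : ℝ) 1 := by
  have hms : MeasurableSet {s : Y × Fin K × ℝ | s.2.2 ∈ Set.Icc (0 : ℝ) 1} :=
    measurableSet_Icc.preimage (measurable_snd.comp measurable_snd)
  rw [ae_iff]
  change sampleLaw D p {s : Y × Fin K × ℝ | s.2.2 ∈ Set.Icc (0 : ℝ) 1}ᶜ = 0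
  rw [sampleLaw, Measure.bind_apply hms.compl (measurable_sampleKernel hp).aemeasurable]
  refine (lintegral_eq_zero_iff
    ((Measure.measurable_coe hms.compl).comp (measurable_sampleKernel hp))).2 ?_
  filter_upwards [hD] with z hz
  simp only [Function.comp_apply, Measure.coe_finsetSum, Finset.sum_apply, Measure.smul_apply,
    smul_eq_mul, Pi.zero_apply]
  refine Finset.sum_eq_zero fun a _ => ?_
  rw [Measure.dirac_apply' _ hms.compl, Set.indicator_of_notMem, mul_zero]
  simpa using hz a

/-- If the predictions `g'` minimize the conditional expected loss and the loss is `μf`-strongly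
convex (in the midpoint form `hmid`), then the excess risk of any predictions `g` controls their
mean squared distance to `g'`. -/
lemma sq_dist_le_excess_risk [IsProbabilityMeasure D] (hp : ∀ a, Measurable fun x => p x a)
    (hp1 : ∀ x, p x ∈ stdSimplex ℝ (Fin K)) {ℓ : ℝ → ℝ → ℝ} (hℓ : Measurable (Function.uncurry ℓ))
    {B C μf : ℝ} (hC : ∀ z r, |z| ≤ B → |ℓ z r| ≤ C)
    (hmid : ∀ z z' r, ℓ ((z + z') / 2) r ≤ (ℓ z r + ℓ z' r) / 2 - μf / 8 * (z - z') ^ 2)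
    {g g' : Y → Fin K → ℝ} (hg : ∀ a, Measurable fun x => g x a)
    (hg' : ∀ a, Measurable fun x => g' x a) (hgB : ∀ x a, |g x a| ≤ B)
    (hgB' : ∀ x a, |g' x a| ≤ B)
    (hopt : ∀ᵐ x ∂D.fst, ∀ a, ∀ y : ℝ,
      ∫ r, ℓ (g' x a) (r a) ∂(D.condKernel x) ≤ ∫ r, ℓ y (r a) ∂(D.condKernel x)) :
    μf / 4 * ∫ x, ∑ a, p x a * (g x a - g' x a) ^ 2 ∂D.fst
      ≤ ∫ s, ℓ (g s.1 s.2.1) s.2.2 ∂sampleLaw D p - ∫ s, ℓ (g' s.1 s.2.1) s.2.2 ∂sampleLaw D p := by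
  have hle : ∀ x, ∀ a, p x a ≤ 1 := fun x a =>
    (Finset.single_le_sum (fun a _ => (hp1 x).1 a) (Finset.mem_univ a)).trans_eq (hp1 x).2
  -- facts that hold for all bounded predictions
  have meas1 : ∀ u : Y → Fin K → ℝ, (∀ a, Measurable fun x => u x a) →
      Measurable fun s : Y × Fin K × ℝ => ℓ (u s.1 s.2.1) s.2.2 := by
    intro u hu
    have h1 : Measurable fun q : Y × Fin K => u q.1 q.2 :=
      measurable_from_prod_countable_left fun a => hu a
    exact hℓ.comp ((h1.comp (measurable_fst.prodMk (measurable_fst.comp measurable_snd))).prodMk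
      (measurable_snd.comp measurable_snd))
  have risk : ∀ u : Y → Fin K → ℝ, (∀ a, Measurable fun x => u x a) → (∀ x a, |u x a| ≤ B) →
      ∫ s, ℓ (u s.1 s.2.1) s.2.2 ∂sampleLaw D p
        = ∫ z, ∑ a, p z.1 a * ℓ (u z.1 a) (z.2 a) ∂D := fun u hu hB =>
    integral_sampleLaw hp hp1 (meas1 u hu) (C := C) fun s => hC _ _ (hB _ _)
  have int : ∀ u : Y → Fin K → ℝ, (∀ a, Measurable fun x => u x a) → (∀ x a, |u x a| ≤ B) →
      Integrable (fun z => ∑ a, p z.1 a * ℓ (u z.1 a) (z.2 a)) D := by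
    intro u hu hB
    refine integrable_finsetSum _ fun a _ => ?_
    refine Integrable.of_bound (((hp a).comp measurable_fst).mul
      ((meas1 u hu).comp (measurable_observe a))).aestronglyMeasurable C (.of_forall fun z => ?_)
    change |p z.1 a * ℓ (u z.1 a) (z.2 a)| ≤ C
    rw [abs_mul, abs_of_nonneg ((hp1 z.1).1 a)]
    exact (mul_le_of_le_one_left (abs_nonneg _) (hle z.1 a)).trans (hC _ _ (hB _ _))
  set v : Y → Fin K → ℝ := fun x a => (g x a + g' x a) / 2 with hv
  have hvm : ∀ a, Measurable fun x => v x a := fun a => ((hg a).add (hg' a)).div_const 2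
  have hvB : ∀ x a, |v x a| ≤ B := by
    intro x a
    have h1 := abs_le.1 (hgB x a)
    have h2 := abs_le.1 (hgB' x a)
    rw [hv, abs_le]
    constructor <;> dsimp only <;> linarith
  have hopt' : ∫ z, ∑ a, p z.1 a * ℓ (g' z.1 a) (z.2 a) ∂D
      ≤ ∫ z, ∑ a, p z.1 a * ℓ (v z.1 a) (z.2 a) ∂D := by
    rw [← Measure.integral_condKernel (int g' hg' hgB'), ← Measure.integral_condKernel (int v hvm hvB)]
    refine integral_mono_ae (int g' hg' hgB').integral_condKernel
      (int v hvm hvB).integral_condKernel ?_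
    filter_upwards [hopt] with x hx
    have hi : ∀ (y : ℝ) (a : Fin K), |y| ≤ B →
        Integrable (fun r : Fin K → ℝ => ℓ y (r a)) (D.condKernel x) := fun y a hy =>
      Integrable.of_bound ((hℓ.comp (measurable_const.prodMk
        (measurable_pi_apply a))).aestronglyMeasurable) C (.of_forall fun r => hC _ _ hy)
    rw [integral_finsetSum _ fun a _ => (hi _ a (hgB' x a)).const_mul _,
      integral_finsetSum _ fun a _ => (hi _ a (hvB x a)).const_mul _]
    refine Finset.sum_le_sum fun a _ => ?_
    rw [integral_const_mul, integral_const_mul]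
    exact mul_le_mul_of_nonneg_left (hx a _) ((hp1 x).1 a)
  have hsqm : Measurable fun x => ∑ a, p x a * (g x a - g' x a) ^ 2 :=
    Finset.measurable_fun_sum _ fun a _ => (hp a).mul (((hg a).sub (hg' a)).pow_const 2)
  have hfst : ∫ x, ∑ a, p x a * (g x a - g' x a) ^ 2 ∂D.fst
      = ∫ z, ∑ a, p z.1 a * (g z.1 a - g' z.1 a) ^ 2 ∂D := by
    rw [Measure.fst, integral_map measurable_fst.aemeasurable hsqm.aestronglyMeasurable]
  have hsqi : Integrable (fun z : Y × (Fin K → ℝ) => ∑ a, p z.1 a * (g z.1 a - g' z.1 a) ^ 2) D := by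
    refine Integrable.of_bound (hsqm.comp measurable_fst).aestronglyMeasurable
      (∑ _a : Fin K, (2 * B) ^ 2) (.of_forall fun z => ?_)
    rw [Real.norm_eq_abs]
    refine (Finset.abs_sum_le_sum_abs _ _).trans (Finset.sum_le_sum fun a _ => ?_)
    rw [abs_mul, abs_of_nonneg ((hp1 z.1).1 a), abs_of_nonneg (sq_nonneg _)]
    refine (mul_le_of_le_one_left (sq_nonneg _) (hle z.1 a)).trans ?_
    rw [← sq_abs]
    have h1 := abs_sub (g z.1 a) (g' z.1 a)
    have h2 := hgB z.1 a
    have h3 := hgB' z.1 a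
    gcongr
    linarith
  have hmid' : ∫ z, ∑ a, p z.1 a * ℓ (v z.1 a) (z.2 a) ∂D
      ≤ (∫ z, ∑ a, p z.1 a * ℓ (g z.1 a) (z.2 a) ∂D
          + ∫ z, ∑ a, p z.1 a * ℓ (g' z.1 a) (z.2 a) ∂D) / 2
        - μf / 8 * ∫ z, ∑ a, p z.1 a * (g z.1 a - g' z.1 a) ^ 2 ∂D := by
    have hadd : Integrable (fun z => (∑ a, p z.1 a * ℓ (g z.1 a) (z.2 a)
        + ∑ a, p z.1 a * ℓ (g' z.1 a) (z.2 a)) / 2) D :=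
      ((int g hg hgB).add (int g' hg' hgB')).div_const 2
    rw [← integral_add (int g hg hgB) (int g' hg' hgB'), ← integral_div, ← integral_const_mul,
      ← integral_sub hadd (hsqi.const_mul _)]
    refine integral_mono (int v hvm hvB) (hadd.sub (hsqi.const_mul _)) fun z => ?_
    dsimp only
    rw [← Finset.sum_add_distrib, Finset.sum_div, Finset.mul_sum, ← Finset.sum_sub_distrib]
    refine Finset.sum_le_sum fun a _ => ?_
    have := mul_le_mul_of_nonneg_left (hmid (g z.1 a) (g' z.1 a) (z.2 a)) ((hp1 z.1).1 a)
    refine this.trans_eq ?_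
    ring
  rw [risk g hg hgB, risk g' hg' hgB', hfst]
  linarith

end SampleLaw

namespace Bandit

variable {M K : ℕ} {X : Fin M → Type*} [∀ m, MeasurableSpace (X m)] {P : Bandit M K X}
  {n κ : ℕ} {μω βα ββ σ G : ℝ}

/-! ### The loss with rewards projected to the unit interval -/

/-- The loss as a function of the reward projected to `[0, 1]`, so that the conditions on rewards
in `[0, 1]` hold for all rewards. -/
noncomputable def clippedLoss (P : Bandit M K X) (m : Fin M) (z r : ℝ) : ℝ :=
  P.ℓ m z (max 0 (min r 1))

lemma clip_mem (r : ℝ) : max 0 (min r 1) ∈ Set.Icc (0 : ℝ) 1 :=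
  ⟨le_max_left _ _, max_le zero_le_one (min_le_right _ _)⟩

lemma clip_of_mem {r : ℝ} (hr : r ∈ Set.Icc (0 : ℝ) 1) : max 0 (min r 1) = r := by
  rw [min_eq_left hr.2, max_eq_right hr.1]

lemma clippedLoss_of_mem (m : Fin M) (z : ℝ) {r : ℝ} (hr : r ∈ Set.Icc (0 : ℝ) 1) :
    P.clippedLoss m z r = P.ℓ m z r := by
  rw [clippedLoss, clip_of_mem hr]

section Loss

variable {α : P.Shared} {b : ∀ m, P.Personal m} {μf : ℝ}

lemma measurable_clippedLoss (hP : P.Regular) (hL : P.LossCondition α b μf) (m : Fin M) :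
    Measurable (Function.uncurry (P.clippedLoss m)) :=
  measurable_uncurry_of_continuous_of_measurable
    (fun r => (hL.differentiable m _ (clip_mem r)).continuous)
    (fun z => (hP.measurable_loss m z).comp
      (measurable_const.max (measurable_id.min measurable_const)))

lemma clippedLoss_midpoint_le (hL : P.LossCondition α b μf) (m : Fin M) (z z' r : ℝ) :
    P.clippedLoss m ((z + z') / 2) r
      ≤ (P.clippedLoss m z r + P.clippedLoss m z' r) / 2 - μf / 8 * (z - z') ^ 2 := by
  have h1 := hL.strongly_convex m _ (clip_mem r) ((z + z') / 2) z
  have h2 := hL.strongly_convex m _ (clip_mem r) ((z + z') / 2) z'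
  unfold clippedLoss
  set d := deriv (fun y => P.ℓ m y (max 0 (min r 1))) ((z + z') / 2)
  have e1 : z - (z + z') / 2 = (z - z') / 2 := by ring
  have e2 : z' - (z + z') / 2 = -((z - z') / 2) := by ring
  rw [e1] at h1
  rw [e2] at h2
  have e3 : μf / 2 * ((z - z') / 2) ^ 2 = μf / 8 * (z - z') ^ 2 := by ring
  have e4 : μf / 2 * (-((z - z') / 2)) ^ 2 = μf / 8 * (z - z') ^ 2 := by ring
  rw [e3] at h1
  rw [e4] at h2
  linarith

/-- A convex loss that is bounded in the reward at each prediction is bounded for bounded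
predictions. -/
lemma exists_abs_clippedLoss_le (hP : P.Regular) (hL : P.LossCondition α b μf) (hμf : 0 < μf)
    (B : ℝ) : ∃ C, ∀ m z r, |z| ≤ B → |P.clippedLoss m z r| ≤ C := by
  have key : ∀ m, ∃ C, 0 ≤ C ∧ ∀ z r, |z| ≤ B → |P.clippedLoss m z r| ≤ C := by
    intro m
    have hbd : ∀ y, ∃ C, ∀ r, |P.clippedLoss m y r| ≤ C := fun y => by
      obtain ⟨C, hC⟩ := hP.bounded_loss m y
      exact ⟨C, fun r => hC _ (clip_mem r)⟩
    obtain ⟨C1, h1⟩ := hbd B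
    obtain ⟨C2, h2⟩ := hbd (-B)
    obtain ⟨C0, h0⟩ := hbd 0
    have hup : ∀ z r, |z| ≤ B → P.clippedLoss m z r ≤ C1 + C2 := by
      intro z r hz
      have hz' := abs_le.1 hz
      have p1 : 0 ≤ C1 := (abs_nonneg _).trans (h1 r)
      have p2 : 0 ≤ C2 := (abs_nonneg _).trans (h2 r)
      have s1 := hL.strongly_convex m _ (clip_mem r) z B
      have s2 := hL.strongly_convex m _ (clip_mem r) z (-B)
      have b1 := (abs_le.1 (h1 r)).2
      have b2 := (abs_le.1 (h2 r)).2
      unfold clippedLoss at *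
      set d := deriv (fun y => P.ℓ m y (max 0 (min r 1))) z
      have q1 : 0 ≤ μf / 2 * (B - z) ^ 2 := by positivity
      have q2 : 0 ≤ μf / 2 * (-B - z) ^ 2 := by positivity
      rcases le_total 0 d with hd | hd
      · have := mul_nonneg hd (sub_nonneg.2 hz'.2)
        linarith
      · have : 0 ≤ d * (-B - z) := mul_nonneg_of_nonpos_of_nonpos hd (by linarith)
        linarith
    refine ⟨|C1| + |C2| + 2 * |C0|, by positivity, fun z r hz => ?_⟩
    have u1 := hup z r hz
    have u2 := hup (-z) r (by rwa [abs_neg])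
    have hm := clippedLoss_midpoint_le hL m z (-z) r
    rw [add_neg_cancel, zero_div] at hm
    have b0 := (abs_le.1 (h0 r)).1
    have q : 0 ≤ μf / 8 * (z - -z) ^ 2 := by positivity
    have a1 := le_abs_self C1
    have a2 := le_abs_self C2
    have a0 := le_abs_self C0
    have n0 := abs_nonneg C0
    rw [abs_le]
    constructor <;> linarith
  choose C hC0 hC using key
  exact ⟨∑ m, C m, fun m z r hz => (hC m z r hz).trans
    (Finset.single_le_sum (fun m _ => hC0 m) (Finset.mem_univ m))⟩

end Loss

/-- The clipped loss on one sample, as a function of parameters in the parameter region. -/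
noncomputable def regionLoss (P : Bandit M K X) (m : Fin M) (w : P.Ωα × (∀ m, P.Ωβ m))
    (s : X m × Fin K × ℝ) : ℝ :=
  P.clippedLoss m (P.f m w.1 (w.2 m) s.1 s.2.1) s.2.2

lemma regionLoss_of_mem (m : Fin M) (w : P.Ωα × (∀ m, P.Ωβ m)) {s : X m × Fin K × ℝ}
    (hs : s.2.2 ∈ Set.Icc (0 : ℝ) 1) : P.regionLoss m w s = P.sampleLoss m s w.1 (w.2 m) :=
  clippedLoss_of_mem m _ hs

lemma measurable_f_apply (hP : P.Regular) (m : Fin M) (α : P.Shared) (b : P.Personal m)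
    (a : Fin K) : Measurable fun x => P.f m α b x a :=
  (hP.measurable_f m a).comp (measurable_prodMk_left (x := ((α, b) : P.Shared × P.Personal m)))

lemma measurable_regionLoss {α : P.Shared} {b : ∀ m, P.Personal m} {μf : ℝ} (hP : P.Regular)
    (hL : P.LossCondition α b μf) (m : Fin M) (w : P.Ωα × (∀ m, P.Ωβ m)) :
    Measurable (P.regionLoss m w) := by
  have h1 : Measurable fun q : X m × Fin K => P.f m w.1 (w.2 m) q.1 q.2 :=
    measurable_from_prod_countable_left fun a => measurable_f_apply hP m _ _ a
  exact (measurable_clippedLoss hP hL m).comp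
    ((h1.comp (measurable_fst.prodMk (measurable_fst.comp measurable_snd))).prodMk
      (measurable_snd.comp measurable_snd))

lemma continuous_regionLoss (h : P.LSGDCondition n κ μω βα ββ σ G) (m : Fin M)
    (s : X m × Fin K × ℝ) : Continuous fun w => P.regionLoss m w s := by
  have h1 := (h.differentiable m (s.1, s.2.1, max 0 (min s.2.2 1)) (clip_mem _)).continuous
  have h2 : Continuous fun w : P.Ωα × (∀ m, P.Ωβ m) =>
      (((w.1 : P.Shared), (w.2 m : P.Personal m)) : P.Shared × P.Personal m) := by fun_prop
  exact h1.comp h2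

/-! ### The estimation error of an epoch -/

lemma isProbabilityMeasure_datasetLaw {D : ∀ m, Measure (X m × (Fin K → ℝ))}
    [∀ m, IsProbabilityMeasure (D m)]
    {p : ∀ m, X m → Fin K → ℝ} (hp : ∀ m a, Measurable fun x => p m x a)
    (hp1 : ∀ m x, p m x ∈ stdSimplex ℝ (Fin K)) :
    IsProbabilityMeasure (datasetLaw n D p) := by
  have hQ : ∀ m, IsProbabilityMeasure (sampleLaw (D m) (p m)) := fun m =>
    isProbabilityMeasure_sampleLaw (hp m) (hp1 m)
  unfold datasetLaw
  infer_instance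

lemma measurePreserving_sample {D : ∀ m, Measure (X m × (Fin K → ℝ))}
    [∀ m, IsProbabilityMeasure (D m)]
    {p : ∀ m, X m → Fin K → ℝ} (hp : ∀ m a, Measurable fun x => p m x a)
    (hp1 : ∀ m x, p m x ∈ stdSimplex ℝ (Fin K)) (m : Fin M) (i : Fin n) :
    MeasurePreserving (fun S : Dataset K X n => S m i) (datasetLaw n D p)
      (sampleLaw (D m) (p m)) := by
  have hQ : ∀ m, IsProbabilityMeasure (sampleLaw (D m) (p m)) := fun m =>
    isProbabilityMeasure_sampleLaw (hp m) (hp1 m)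
  have h1 := measurePreserving_eval (fun m => Measure.pi fun _ : Fin n => sampleLaw (D m) (p m)) m
  have h2 := measurePreserving_eval (fun _ : Fin n => sampleLaw (D m) (p m)) i
  exact h2.comp h1

lemma ae_valid_datasetLaw {D : ∀ m, Measure (X m × (Fin K → ℝ))} [∀ m, IsProbabilityMeasure (D m)]
    {p : ∀ m, X m → Fin K → ℝ} (hp : ∀ m a, Measurable fun x => p m x a)
    (hp1 : ∀ m x, p m x ∈ stdSimplex ℝ (Fin K))
    (hD : ∀ m, ∀ᵐ z ∂D m, ∀ a, z.2 a ∈ Set.Icc (0 : ℝ) 1) :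
    ∀ᵐ S ∂datasetLaw n D p, Dataset.Valid S :=
  ae_all_iff.2 fun m => ae_all_iff.2 fun i =>
    (measurePreserving_sample hp hp1 m i).quasiMeasurePreserving.ae
      (ae_sampleLaw_reward_mem (hp m) (hD m))

/-- The supremum in the definition of the complexity is attained as a bound: an unbounded set would
have the supremum `0`. -/
lemma rademacherAt_le (hR : 0 < P.rademacher n) {D' : ∀ m, Measure (X m × (Fin K → ℝ))}
    {p : ∀ m, X m → Fin K → ℝ} (h1 : ∀ m, IsProbabilityMeasure (D' m))
    (h2 : ∀ m, ∀ᵐ z ∂D' m, ∀ a, z.2 a ∈ Set.Icc (0 : ℝ) 1)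
    (h3 : ∀ m a, Measurable fun x => p m x a) (h4 : ∀ m x, p m x ∈ stdSimplex ℝ (Fin K)) :
    P.rademacherAt n D' p ≤ P.rademacher n := by
  refine le_csSup ?_ ⟨D', p, h1, h2, h3, h4, rfl⟩
  by_contra hb
  rw [rademacher, Real.sSup_of_not_bddAbove hb] at hR
  exact lt_irrefl _ hR

/-- Sum over the agents of the mean squared distances of two predictions, where the contexts follow
the law of the problem and the arms are selected by `p`. -/
noncomputable def predictionError (P : Bandit M K X) (p : ∀ m, X m → Fin K → ℝ) (α' : P.Shared)
    (b' : ∀ m, P.Personal m) (α : P.Shared) (b : ∀ m, P.Personal m) : ℝ :=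
  ∑ m, ∫ x, ∑ a, p m x a * (P.f m α' (b' m) x a - P.f m α (b m) x a) ^ 2 ∂(P.D m).fst

lemma predictionError_nonneg {p : ∀ m, X m → Fin K → ℝ}
    (hp1 : ∀ m x, p m x ∈ stdSimplex ℝ (Fin K)) (α' : P.Shared) (b' : ∀ m, P.Personal m)
    (α : P.Shared) (b : ∀ m, P.Personal m) : 0 ≤ P.predictionError p α' b' α b :=
  Finset.sum_nonneg fun m _ => integral_nonneg fun x => Finset.sum_nonneg fun a _ =>
    mul_nonneg ((hp1 m x).1 a) (sq_nonneg _)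

section Estimation

variable {α : P.Shared} {b : ∀ m, P.Personal m} {μf : ℝ} {p : ∀ m, X m → Fin K → ℝ}

lemma predictionError_le (hP : P.Regular) (ht : P.TrueParameter α b) (hL : P.LossCondition α b μf)
    (hμf : 0 < μf) (hp : ∀ m a, Measurable fun x => p m x a)
    (hp1 : ∀ m x, p m x ∈ stdSimplex ℝ (Fin K)) (w : P.Ωα × (∀ m, P.Ωβ m)) :
    μf / 4 * P.predictionError p w.1 (fun m => w.2 m) α b
      ≤ ∑ m, (∫ s, P.regionLoss m w s ∂sampleLaw (P.D m) (p m)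
        - ∫ s, P.regionLoss m (⟨α, ht.memα⟩, fun m => ⟨b m, ht.memβ m⟩) s
          ∂sampleLaw (P.D m) (p m)) := by
  obtain ⟨B, hB⟩ := hP.bounded_f
  obtain ⟨C, hC⟩ := exists_abs_clippedLoss_le hP hL hμf B
  rw [predictionError, Finset.mul_sum]
  refine Finset.sum_le_sum fun m _ => ?_
  refine sq_dist_le_excess_risk (hp m) (hp1 m) (measurable_clippedLoss hP hL m) (hC m)
    (clippedLoss_midpoint_le hL m) (measurable_f_apply hP m _ _) (measurable_f_apply hP m _ _)
    (fun x a => hB m _ w.1.2 _ (w.2 m).2 x a)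
    (fun x a => hB m _ ht.memα _ (ht.memβ m) x a) ?_
  have hmem : ∀ᵐ x ∂(P.D m).fst, ∀ᵐ r ∂(P.D m).condKernel x, ∀ a, r a ∈ Set.Icc (0 : ℝ) 1 := by
    have h1 := hP.reward_mem m
    rw [← (P.D m).disintegrate (P.D m).condKernel] at h1
    exact Measure.ae_ae_of_ae_compProd h1
  filter_upwards [hL.optimal m, hmem] with x hx hr a y
  have e : ∀ z : ℝ, ∫ r, P.clippedLoss m z (r a) ∂((P.D m).condKernel x)
      = ∫ r, P.ℓ m z (r a) ∂((P.D m).condKernel x) := fun z =>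
    integral_congr_ae (hr.mono fun r hr => clippedLoss_of_mem m z (hr a))
  rw [e, e]
  exact hx a y

lemma rademacherAt_eq {D' : ∀ m, Measure (X m × (Fin K → ℝ))} [∀ m, IsProbabilityMeasure (D' m)]
    (hD : ∀ m, ∀ᵐ z ∂D' m, ∀ a, z.2 a ∈ Set.Icc (0 : ℝ) 1)
    (hp : ∀ m a, Measurable fun x => p m x a) (hp1 : ∀ m x, p m x ∈ stdSimplex ℝ (Fin K)) :
    P.rademacherAt n D' p = ∫ S : Dataset K X n, ∫ s : Fin M → Fin n → Bool,
      ⨆ w : P.Ωα × (∀ m, P.Ωβ m),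
        ∑ m, 1 / ((M : ℝ) * n) * ∑ i, sign (s m i) * P.regionLoss m w (S m i)
      ∂(uniformOn Set.univ) ∂(datasetLaw n D' p) := by
  refine integral_congr_ae ?_
  filter_upwards [ae_valid_datasetLaw hp hp1 hD] with S hS
  refine integral_congr_ae (.of_forall fun s => ?_)
  refine iSup_congr fun w => Finset.sum_congr rfl fun m _ => ?_
  congr 1
  refine Finset.sum_congr rfl fun i _ => ?_
  rw [regionLoss_of_mem m w (hS m i)]

lemma sum_regionLoss_eq_empiricalLoss {S : Dataset K X n} (hS : S.Valid)
    (w : P.Ωα × (∀ m, P.Ωβ m)) :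
    ∑ m, 1 / ((M : ℝ) * n) * ∑ i, P.regionLoss m w (S m i)
      = P.empiricalLoss S w.1 fun m => w.2 m := by
  rw [empiricalLoss, Finset.mul_sum]
  refine Finset.sum_congr rfl fun m _ => ?_
  rw [localLoss, ← mul_assoc, one_div_mul_one_div]
  congr 1
  exact Finset.sum_congr rfl fun i _ => regionLoss_of_mem m w (hS m i)

/-- With the tuned protocol, the mean prediction error after an epoch is of the order of the
complexity, whatever the arm selection rule of the epoch is. The excess risk is split into a
uniform deviation, the optimization error, and the deviation at the true parameters. -/
theorem lintegral_predictionError_output_le [NeZero n] (hP : P.Regular) (ht : P.TrueParameter α b)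
    (hL : P.LossCondition α b μf) (hμf : 0 < μf) (h : P.LSGDCondition n κ μω βα ββ σ G)
    (hc : Constants.Admissible ⟨M, κ, μω, βα, ββ, σ, G, P.rademacher n⟩)
    (hp : ∀ m a, Measurable fun x => p m x a) (hp1 : ∀ m x, p m x ∈ stdSimplex ℝ (Fin K)) :
    ∫⁻ d : Dataset K X n × (Fin M →
        Fin ((tuning ⟨M, κ, μω, βα, ββ, σ, G, P.rademacher n⟩).rounds * κ) → Fin n),
      ENNReal.ofReal (P.predictionError p
        (P.outputα d.1 κ (tuning ⟨M, κ, μω, βα, ββ, σ, G, P.rademacher n⟩) d.2)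
        (P.outputβ d.1 κ (tuning ⟨M, κ, μω, βα, ββ, σ, G, P.rademacher n⟩) d.2) α b)
      ∂((datasetLaw n P.D p).prod (uniformOn Set.univ))
      ≤ ENNReal.ofReal (104 * M * P.rademacher n / μf) := by
  obtain ⟨B, hB⟩ := hP.bounded_f
  obtain ⟨C, hC⟩ := exists_abs_clippedLoss_le hP hL hμf B
  have hM : 0 < M := hc.M_pos
  have hM' : (0 : ℝ) < M := by exact_mod_cast hM
  have hn : (0 : ℝ) < n := by exact_mod_cast NeZero.pos n
  set R := P.rademacher n with hR
  have hRpos : 0 < R := hc.target_pos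
  have hstay := fun (S : Dataset K X n) (hS : S.Valid) ξ => output_mem hP hM
    (tuning ⟨M, κ, μω, βα, ββ, σ, G, R⟩) (rounds_mul_pos hc) ξ (stays_of_admissible h hc hS _ ξ)
  have hopt := fun (S : Dataset K X n) (hS : S.Valid) =>
    expect_optimization_error_le h hP hc hS α b
  set c := tuning ⟨M, κ, μω, βα, ββ, σ, G, R⟩
  have hQ : ∀ m, IsProbabilityMeasure (sampleLaw (P.D m) (p m)) := fun m =>
    isProbabilityMeasure_sampleLaw (hp m) (hp1 m)
  have hμ : IsProbabilityMeasure (datasetLaw n P.D p) := isProbabilityMeasure_datasetLaw hp hp1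
  set μ := datasetLaw n P.D p with hμdef
  set w₀ : P.Ωα × (∀ m, P.Ωβ m) := (⟨α, ht.memα⟩, fun m => ⟨b m, ht.memβ m⟩) with hw₀
  have : Nonempty (P.Ωα × (∀ m, P.Ωβ m)) := ⟨w₀⟩
  have hbd : ∀ m w s, |P.regionLoss m w s| ≤ C := fun m w s =>
    hC m _ _ (hB m _ w.1.2 _ (w.2 m).2 _ _)
  have hmeas := measurable_regionLoss hP hL
  -- the empirical and the population risk
  set emp : (P.Ωα × (∀ m, P.Ωβ m)) → Dataset K X n → ℝ := fun w S =>
    ∑ m, 1 / ((M : ℝ) * n) * ∑ i, P.regionLoss m w (S m i) with hemp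
  have hint1 : ∀ m w i, Integrable (fun S : Dataset K X n => P.regionLoss m w (S m i)) μ :=
    fun m w i => Integrable.of_bound ((hmeas m w).comp
      (measurePreserving_sample (D := P.D) hp hp1 m i).measurable).aestronglyMeasurable C
        (.of_forall fun S => hbd _ _ _)
  have hempint : ∀ w, Integrable (emp w) μ := fun w =>
    integrable_finsetSum _ fun m _ => (integrable_finsetSum _ fun i _ => hint1 m w i).const_mul _
  have hpop : ∀ w, ∫ S, emp w S ∂μ
      = 1 / (M : ℝ) * ∑ m, ∫ s, P.regionLoss m w s ∂sampleLaw (P.D m) (p m) := by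
    intro w
    rw [hemp, integral_finsetSum _ fun m _ =>
      (integrable_finsetSum _ fun i _ => hint1 m w i).const_mul _, Finset.mul_sum]
    refine Finset.sum_congr rfl fun m _ => ?_
    rw [integral_const_mul, integral_finsetSum _ fun i _ => hint1 m w i]
    have e : ∀ i, ∫ S : Dataset K X n, P.regionLoss m w (S m i) ∂μ
        = ∫ s, P.regionLoss m w s ∂sampleLaw (P.D m) (p m) := by
      intro i
      have hmp := measurePreserving_sample (n := n) (D := P.D) hp hp1 m i
      rw [← hmp.map_eq, integral_map hmp.measurable.aemeasurable
        (hmeas m w).aestronglyMeasurable]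
    simp_rw [e]
    rw [Finset.sum_const, Finset.card_univ, Fintype.card_fin, nsmul_eq_mul]
    field_simp
  -- the uniform deviation
  set Gap : Dataset K X n × Dataset K X n → ℝ := fun q =>
    ⨆ w, ∑ m, 1 / ((M : ℝ) * n) * ∑ i, (P.regionLoss m w (q.2 m i) - P.regionLoss m w (q.1 m i))
    with hGap
  have hGapsub : ∀ (q : Dataset K X n × Dataset K X n) w,
      ∑ m, 1 / ((M : ℝ) * n) * ∑ i, (P.regionLoss m w (q.2 m i) - P.regionLoss m w (q.1 m i))
        = emp w q.2 - emp w q.1 := by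
    intro q w
    simp only [hemp, Finset.sum_sub_distrib, mul_sub]
  have hempbd : ∀ w S, |emp w S| ≤ ∑ _m : Fin M, 1 / ((M : ℝ) * n) * ∑ _i : Fin n, C := by
    intro w S
    refine (Finset.abs_sum_le_sum_abs _ _).trans (Finset.sum_le_sum fun m _ => ?_)
    rw [abs_mul, abs_of_nonneg (by positivity)]
    gcongr
    exact (Finset.abs_sum_le_sum_abs _ _).trans (Finset.sum_le_sum fun i _ => hbd _ _ _)
  set C' := ∑ _m : Fin M, 1 / ((M : ℝ) * n) * ∑ _i : Fin n, C
  have hdiffbd : ∀ (q : Dataset K X n × Dataset K X n) w, |emp w q.2 - emp w q.1| ≤ C' + C' :=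
    fun q w => (abs_sub _ _).trans (add_le_add (hempbd _ _) (hempbd _ _))
  have hGapbd : ∀ q, |Gap q| ≤ C' + C' := fun q => by
    simp only [hGap, hGapsub]
    exact abs_ciSup_le fun w => hdiffbd q w
  have hle_Gap : ∀ (S S' : Dataset K X n) w, emp w S' - emp w S ≤ Gap (S, S') := by
    intro S S' w
    simp only [hGap, hGapsub]
    exact le_ciSup (bddAbove_of_abs_le fun w => hdiffbd (S, S') w) w
  have hGapmeas : Measurable Gap := by
    refine measurable_ciSup_of_continuous (fun w => ?_) fun q => ?_
    · refine Finset.measurable_fun_sum _ fun m _ =>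
        (Finset.measurable_fun_sum _ fun i _ => Measurable.sub ?_ ?_).const_mul _
      · exact (hmeas m w).comp ((measurable_pi_apply i).comp ((measurable_pi_apply m).comp
          measurable_snd))
      · exact (hmeas m w).comp ((measurable_pi_apply i).comp ((measurable_pi_apply m).comp
          measurable_fst))
    · have hcont := continuous_regionLoss h
      exact continuous_finsetSum _ fun m _ => continuous_const.mul
        (continuous_finsetSum _ fun i _ => (hcont m _).sub (hcont m _))
  have hGapint : Integrable Gap (μ.prod μ) :=
    Integrable.of_bound hGapmeas.aestronglyMeasurable (C' + C') (.of_forall hGapbd)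
  have hGapR : ∫ S, ∫ S', Gap (S, S') ∂μ ∂μ ≤ 2 * R := by
    rw [← integral_prod _ hGapint]
    have h1 := integral_iSup_sub_le (n := n) (fun m => sampleLaw (P.D m) (p m)) hmeas
      (continuous_regionLoss h) (c := 1 / ((M : ℝ) * n)) (by positivity) hbd
    have h2 := rademacherAt_le hRpos (fun m => P.isProb m) hP.reward_mem hp hp1
    rw [rademacherAt_eq hP.reward_mem hp hp1] at h2
    exact h1.trans (mul_le_mul_of_nonneg_left h2 zero_le_two)
  -- bound for a fixed dataset
  have hfix : ∀ S : Dataset K X n, S.Valid →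
      𝔼 ξ, P.predictionError p (P.outputα S κ c ξ) (P.outputβ S κ c ξ) α b
        ≤ 4 * M / μf * (∫ S', Gap (S, S') ∂μ + 24 * R + (emp w₀ S - ∫ S', emp w₀ S' ∂μ)) := by
    intro S hS
    have h1 : ∀ ξ, P.predictionError p (P.outputα S κ c ξ) (P.outputβ S κ c ξ) α b
        ≤ 4 * M / μf * (∫ S', Gap (S, S') ∂μ
          + (P.empiricalLoss S (P.outputα S κ c ξ) (P.outputβ S κ c ξ) - P.empiricalLoss S α b)
          + (emp w₀ S - ∫ S', emp w₀ S' ∂μ)) := by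
      intro ξ
      obtain ⟨hα, hβ⟩ := hstay S hS ξ
      set w : P.Ωα × (∀ m, P.Ωβ m) :=
        (⟨P.outputα S κ c ξ, hα⟩, fun m => ⟨P.outputβ S κ c ξ m, hβ m⟩)
      have h2 := predictionError_le hP ht hL hμf hp hp1 w
      rw [Finset.sum_sub_distrib] at h2
      have h3 : ∀ w, ∑ m, ∫ s, P.regionLoss m w s ∂sampleLaw (P.D m) (p m)
          = M * ∫ S, emp w S ∂μ := by
        intro w
        rw [hpop]
        field_simp
      rw [h3, h3] at h2
      have h4 : ∫ S', emp w S' ∂μ - emp w S ≤ ∫ S', Gap (S, S') ∂μ := by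
        have e : ∫ S', (emp w S' - emp w S) ∂μ = ∫ S', emp w S' ∂μ - emp w S := by
          rw [integral_sub (hempint w) (integrable_const _)]
          simp
        rw [← e]
        refine integral_mono ((hempint w).sub (integrable_const _)) ?_ fun S' => hle_Gap S S' w
        exact Integrable.of_bound (hGapmeas.comp measurable_prodMk_left).aestronglyMeasurable
          (C' + C') (.of_forall fun S' => hGapbd _)
      have h5 : emp w S = P.empiricalLoss S (P.outputα S κ c ξ) (P.outputβ S κ c ξ) :=
        sum_regionLoss_eq_empiricalLoss hS w
      have h6 : emp w₀ S = P.empiricalLoss S α b := sum_regionLoss_eq_empiricalLoss hS w₀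
      have h7 : P.predictionError p (P.outputα S κ c ξ) (P.outputβ S κ c ξ) α b
          ≤ 4 * M / μf * (∫ S', emp w S' ∂μ - ∫ S', emp w₀ S' ∂μ) := by
        have e : P.predictionError p (P.outputα S κ c ξ) (P.outputβ S κ c ξ) α b
            = 4 / μf * (μf / 4 * P.predictionError p w.1 (fun m => w.2 m) α b) := by
          field_simp
          rfl
        rw [e]
        calc 4 / μf * (μf / 4 * P.predictionError p w.1 (fun m => w.2 m) α b)
            ≤ 4 / μf * (M * ∫ S, emp w S ∂μ - M * ∫ S, emp w₀ S ∂μ) := by gcongr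
          _ = _ := by ring
      refine h7.trans ?_
      gcongr
      linarith
    calc 𝔼 ξ, P.predictionError p (P.outputα S κ c ξ) (P.outputβ S κ c ξ) α b
        ≤ 𝔼 ξ, 4 * M / μf * (∫ S', Gap (S, S') ∂μ
          + (P.empiricalLoss S (P.outputα S κ c ξ) (P.outputβ S κ c ξ) - P.empiricalLoss S α b)
          + (emp w₀ S - ∫ S', emp w₀ S' ∂μ)) := Finset.expect_le_expect fun ξ _ => h1 ξ
      _ = 4 * M / μf * (∫ S', Gap (S, S') ∂μ
          + 𝔼 ξ, (P.empiricalLoss S (P.outputα S κ c ξ) (P.outputβ S κ c ξ)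
            - P.empiricalLoss S α b) + (emp w₀ S - ∫ S', emp w₀ S' ∂μ)) := by
          rw [← Finset.mul_expect, Finset.expect_add_distrib, Finset.expect_add_distrib,
            Fintype.expect_const, Fintype.expect_const]
      _ ≤ _ := by
          gcongr
          exact hopt S hS
  have hnn : ∀ (S : Dataset K X n) ξ,
      0 ≤ P.predictionError p (P.outputα S κ c ξ) (P.outputβ S κ c ξ) α b := fun S ξ =>
    predictionError_nonneg hp1 _ _ _ _
  have hi1 : Integrable (fun S => ∫ S', Gap (S, S') ∂μ + 24 * R) μ :=
    hGapint.integral_prod_left.add (integrable_const _)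
  have hi2 : Integrable (fun S => emp w₀ S - ∫ S', emp w₀ S' ∂μ) μ :=
    (hempint w₀).sub (integrable_const _)
  have hbint : Integrable (fun S => 4 * M / μf * (∫ S', Gap (S, S') ∂μ + 24 * R
      + (emp w₀ S - ∫ S', emp w₀ S' ∂μ))) μ :=
    (hi1.add hi2).const_mul _
  calc ∫⁻ d, ENNReal.ofReal (P.predictionError p (P.outputα d.1 κ c d.2) (P.outputβ d.1 κ c d.2)
        α b) ∂(μ.prod (uniformOn Set.univ))
      ≤ ∫⁻ S, ∫⁻ ξ, ENNReal.ofReal (P.predictionError p (P.outputα S κ c ξ) (P.outputβ S κ c ξ)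
          α b) ∂(uniformOn Set.univ) ∂μ := lintegral_prod_le _
    _ ≤ ∫⁻ S, ENNReal.ofReal (4 * M / μf * (∫ S', Gap (S, S') ∂μ + 24 * R
          + (emp w₀ S - ∫ S', emp w₀ S' ∂μ))) ∂μ := by
        refine lintegral_mono_ae ?_
        filter_upwards [ae_valid_datasetLaw hp hp1 hP.reward_mem] with S hS
        rw [lintegral_ofReal_uniformOn_univ (hnn S)]
        exact ENNReal.ofReal_le_ofReal (hfix S hS)
    _ = ENNReal.ofReal (∫ S, 4 * M / μf * (∫ S', Gap (S, S') ∂μ + 24 * R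
          + (emp w₀ S - ∫ S', emp w₀ S' ∂μ)) ∂μ) := by
        rw [ofReal_integral_eq_lintegral_ofReal hbint]
        filter_upwards [ae_valid_datasetLaw hp hp1 hP.reward_mem] with S hS
        exact (Finset.expect_nonneg fun ξ _ => hnn S ξ).trans (hfix S hS)
    _ ≤ ENNReal.ofReal (104 * M * R / μf) := by
        refine ENNReal.ofReal_le_ofReal ?_
        rw [integral_const_mul, integral_add hi1 hi2,
          integral_add hGapint.integral_prod_left (integrable_const _),
          integral_sub (hempint w₀) (integrable_const _)]
        simp only [integral_const, probReal_univ, one_smul, sub_self, add_zero]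
        calc 4 * M / μf * (∫ S, ∫ S', Gap (S, S') ∂μ ∂μ + 24 * R)
            ≤ 4 * M / μf * (2 * R + 24 * R) := by gcongr
          _ = 104 * M * R / μf := by ring

end Estimation

end Bandit

/-! ### Inverse gap weighting in a fixed context -/

section InverseGap

variable {K : ℕ} [NeZero K]

lemma le_greedy (v : Fin K → ℝ) (a : Fin K) : v a ≤ v (greedy v) := by
  have hne : {a | ∀ b, v b ≤ v a}.Nonempty := Finite.exists_max v
  exact (hne.csInf_mem (Set.toFinite _)) a

lemma greedy_eq_iff (v : Fin K → ℝ) (a : Fin K) :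
    greedy v = a ↔ (∀ b, v b ≤ v a) ∧ ∀ c < a, ¬∀ b, v b ≤ v c := by
  constructor
  · rintro rfl
    exact ⟨le_greedy v, fun c hc h => hc.not_ge (csInf_le (Set.toFinite _).bddBelow h)⟩
  · rintro ⟨h1, h2⟩
    refine le_antisymm (csInf_le (Set.toFinite _).bddBelow h1) ?_
    by_contra! hlt
    exact h2 _ hlt (le_greedy v)

lemma measurable_greedy : Measurable (greedy : (Fin K → ℝ) → Fin K) := by
  refine measurable_to_countable' fun a => ?_
  have e : greedy ⁻¹' {a} = {v : Fin K → ℝ | (∀ b, v b ≤ v a) ∧ ∀ c < a, ¬∀ b, v b ≤ v c} := by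
    ext v
    exact greedy_eq_iff v a
  rw [e]
  have h : ∀ c : Fin K, MeasurableSet {v : Fin K → ℝ | ∀ b, v b ≤ v c} := fun c => by
    rw [Set.ofPred_forall]
    exact MeasurableSet.iInter fun b =>
      measurableSet_le (measurable_pi_apply b) (measurable_pi_apply c)
  refine (h a).inter ?_
  change MeasurableSet {v : Fin K → ℝ | ∀ c < a, ¬∀ b, v b ≤ v c}
  simp only [Set.ofPred_forall]
  exact MeasurableSet.iInter fun c => MeasurableSet.iInter fun _ => (h c).compl

/-- The loss of arm `a` for the rewards `v`. -/
noncomputable def gapOf (v : Fin K → ℝ) (a : Fin K) : ℝ := v (greedy v) - v a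

lemma gapOf_nonneg (v : Fin K → ℝ) (a : Fin K) : 0 ≤ gapOf v a := sub_nonneg.2 (le_greedy v a)

lemma gapOf_greedy (v : Fin K → ℝ) : gapOf v (greedy v) = 0 := sub_self _

lemma measurable_gapOf (a : Fin K) : Measurable fun v : Fin K → ℝ => gapOf v a := by
  have h1 : Measurable fun q : (Fin K → ℝ) × Fin K => q.1 q.2 :=
    measurable_from_prod_countable_left fun a => measurable_pi_apply a
  exact (h1.comp (measurable_id.prodMk measurable_greedy)).sub (measurable_pi_apply a)

lemma measurable_igw (γ : ℝ) (a : Fin K) : Measurable fun v : Fin K → ℝ => igw γ v a := by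
  have h1 : Measurable fun q : (Fin K → ℝ) × Fin K =>
      if a = q.2 then 1 - ∑ b ∈ Finset.univ.erase q.2, 1 / ((K : ℝ) + γ * (q.1 q.2 - q.1 b))
      else 1 / ((K : ℝ) + γ * (q.1 q.2 - q.1 a)) := by
    refine measurable_from_prod_countable_left fun g => ?_
    by_cases h : a = g
    · simp only [h, if_true]
      fun_prop
    · simp only [h, if_false]
      fun_prop
  exact h1.comp (measurable_id.prodMk measurable_greedy)

variable {γ : ℝ} (hγ : 0 ≤ γ)
include hγ

lemma add_mul_gapOf_pos (v : Fin K → ℝ) (a : Fin K) : 0 < (K : ℝ) + γ * gapOf v a := by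
  have hK : (0 : ℝ) < K := by exact_mod_cast NeZero.pos K
  have := mul_nonneg hγ (gapOf_nonneg v a)
  linarith

lemma one_div_le_igw_greedy (v : Fin K → ℝ) : 1 / (K : ℝ) ≤ igw γ v (greedy v) := by
  have hK : (0 : ℝ) < K := by exact_mod_cast NeZero.pos K
  rw [igw, if_pos rfl]
  have h1 : ∑ b ∈ Finset.univ.erase (greedy v), 1 / ((K : ℝ) + γ * (v (greedy v) - v b))
      ≤ ∑ _b ∈ Finset.univ.erase (greedy v), 1 / (K : ℝ) := by
    refine Finset.sum_le_sum fun b _ => ?_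
    refine one_div_le_one_div_of_le hK ?_
    have := mul_nonneg hγ (gapOf_nonneg v b)
    rw [gapOf] at this
    linarith
  rw [Finset.sum_const, Finset.card_erase_of_mem (Finset.mem_univ _), Finset.card_univ,
    Fintype.card_fin, nsmul_eq_mul, Nat.cast_sub NeZero.one_le, Nat.cast_one] at h1
  have e : ((K : ℝ) - 1) * (1 / K) = 1 - 1 / K := by field_simp
  rw [e] at h1
  linarith

lemma igw_mem_stdSimplex (v : Fin K → ℝ) : igw γ v ∈ stdSimplex ℝ (Fin K) := by
  refine ⟨fun a => ?_, ?_⟩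
  · by_cases ha : a = greedy v
    · rw [ha]
      exact le_trans (by positivity) (one_div_le_igw_greedy hγ v)
    · rw [igw, if_neg ha]
      exact (one_div_pos.2 (add_mul_gapOf_pos hγ v a)).le
  · rw [← Finset.add_sum_erase _ _ (Finset.mem_univ (greedy v)), igw, if_pos rfl]
    have : ∑ b ∈ Finset.univ.erase (greedy v), igw γ v b
        = ∑ b ∈ Finset.univ.erase (greedy v), 1 / ((K : ℝ) + γ * (v (greedy v) - v b)) :=
      Finset.sum_congr rfl fun b hb => by rw [igw, if_neg (Finset.ne_of_mem_erase hb)]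
    rw [this, sub_add_cancel]

/-- Every arm is explored at least in inverse proportion to its estimated gap. -/
lemma one_le_igw_mul (v : Fin K → ℝ) (a : Fin K) :
    1 ≤ igw γ v a * ((K : ℝ) + γ * gapOf v a) := by
  have hK : (0 : ℝ) < K := by exact_mod_cast NeZero.pos K
  by_cases ha : a = greedy v
  · rw [ha, gapOf_greedy, mul_zero, add_zero]
    have := one_div_le_igw_greedy hγ v
    rwa [div_le_iff₀ hK] at this
  · rw [igw, if_neg ha]
    exact (one_div_mul_cancel (add_mul_gapOf_pos hγ v a).ne').ge

/-- The arms that inverse gap weighting selects have small estimated gaps in mean. -/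
lemma sum_igw_mul_gapOf_le (v : Fin K → ℝ) : ∑ a, igw γ v a * (γ * gapOf v a) ≤ K := by
  calc ∑ a, igw γ v a * (γ * gapOf v a) ≤ ∑ _a : Fin K, (1 : ℝ) := by
        refine Finset.sum_le_sum fun a _ => ?_
        by_cases ha : a = greedy v
        · rw [ha, gapOf_greedy]
          simp
        · rw [igw, if_neg ha, one_div_mul_eq_div]
          change γ * gapOf v a / ((K : ℝ) + γ * gapOf v a) ≤ 1
          rw [div_le_one (add_mul_gapOf_pos hγ v a)]
          simp
    _ = K := by simp

omit hγ in
/-- The least `D` such that, for all arms, the gaps of `u` and `v` scaled by `γ` are at most twice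
each other up to `D`. -/
noncomputable def gapDistortion (γ : ℝ) (u v : Fin K → ℝ) : ℝ :=
  Finset.univ.sup' Finset.univ_nonempty fun a =>
    max (γ * gapOf u a - 2 * (γ * gapOf v a)) (γ * gapOf v a - 2 * (γ * gapOf u a))

omit hγ in
lemma mul_gapOf_le_left (γ : ℝ) (u v : Fin K → ℝ) (a : Fin K) :
    γ * gapOf u a ≤ 2 * (γ * gapOf v a) + gapDistortion γ u v := by
  have := (le_max_left _ _).trans (Finset.le_sup' (fun a => max (γ * gapOf u a - 2 * (γ * gapOf v a))
    (γ * gapOf v a - 2 * (γ * gapOf u a))) (Finset.mem_univ a))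
  change _ ≤ gapDistortion γ u v at this
  linarith

omit hγ in
lemma mul_gapOf_le_right (γ : ℝ) (u v : Fin K → ℝ) (a : Fin K) :
    γ * gapOf v a ≤ 2 * (γ * gapOf u a) + gapDistortion γ u v := by
  have := (le_max_right _ _).trans (Finset.le_sup' (fun a => max
    (γ * gapOf u a - 2 * (γ * gapOf v a)) (γ * gapOf v a - 2 * (γ * gapOf u a)))
    (Finset.mem_univ a))
  change _ ≤ gapDistortion γ u v at this
  linarith

omit hγ in
lemma gapDistortion_zero (u v : Fin K → ℝ) : gapDistortion 0 u v = 0 := by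
  simp [gapDistortion]

lemma gapDistortion_nonneg (u v : Fin K → ℝ) : 0 ≤ gapDistortion γ u v := by
  have h := mul_gapOf_le_right γ u v (greedy u)
  rw [gapOf_greedy, mul_zero, mul_zero, zero_add] at h
  exact (mul_nonneg hγ (gapOf_nonneg v _)).trans h

/-- From one epoch to the next the distortion is halved, up to the number of arms and to the error
of the new estimate `v'` under the arm selection of the old estimate `v`. The new error in one arm
is bounded by the old estimated gap of this arm, because arms are explored in inverse proportion to
it, and the old estimated gap by the true gap through the old distortion. -/
lemma gapDistortion_step_le {γ' : ℝ} (hγγ' : γ ≤ γ') (u v v' : Fin K → ℝ) :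
    gapDistortion γ' u v' ≤ gapDistortion γ u v / 2 + K / 2
      + 8 * γ' ^ 2 * ∑ a, igw γ v a * (v' a - u a) ^ 2 := by
  set D := gapDistortion γ u v
  set Δ := ∑ a, igw γ v a * (v' a - u a) ^ 2 with hΔ
  have hγ' : 0 ≤ γ' := hγ.trans hγγ'
  have hΔ0 : 0 ≤ Δ := Finset.sum_nonneg fun a _ =>
    mul_nonneg ((igw_mem_stdSimplex hγ v).1 a) (sq_nonneg _)
  have herr : ∀ a, γ' * |v' a - u a|
      ≤ (K + D) / 8 + γ' * gapOf u a / 4 + 2 * (γ' ^ 2 * Δ) := by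
    intro a
    set V := (K : ℝ) + γ * gapOf v a with hV
    have hVpos : 0 < V := add_mul_gapOf_pos hγ v a
    have h1 : (v' a - u a) ^ 2 ≤ V * Δ := by
      have h2 : igw γ v a * (v' a - u a) ^ 2 ≤ Δ :=
        Finset.single_le_sum (f := fun a => igw γ v a * (v' a - u a) ^ 2)
          (fun a _ => mul_nonneg ((igw_mem_stdSimplex hγ v).1 a) (sq_nonneg _))
          (Finset.mem_univ a)
      calc (v' a - u a) ^ 2 ≤ (igw γ v a * V) * (v' a - u a) ^ 2 :=
            le_mul_of_one_le_left (sq_nonneg _) (one_le_igw_mul hγ v a)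
        _ = V * (igw γ v a * (v' a - u a) ^ 2) := by ring
        _ ≤ V * Δ := by gcongr
    have h2 : γ' * |v' a - u a| ≤ V / 8 + 2 * (γ' ^ 2 * Δ) := by
      refine abs_le_of_sq_le_sq' ?_ (by positivity) |>.2
      rw [mul_pow, sq_abs]
      calc γ' ^ 2 * (v' a - u a) ^ 2 ≤ γ' ^ 2 * (V * Δ) := by gcongr
        _ ≤ (V / 8 + 2 * (γ' ^ 2 * Δ)) ^ 2 := by
          have := sq_nonneg (V / 8 - 2 * (γ' ^ 2 * Δ))
          linarith
    have h3 : γ * gapOf v a ≤ 2 * (γ * gapOf u a) + D := mul_gapOf_le_right γ u v a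
    have h4 : γ * gapOf u a ≤ γ' * gapOf u a :=
      mul_le_mul_of_nonneg_right hγγ' (gapOf_nonneg u a)
    linarith
  have hdiff : ∀ a, |γ' * (v' a - u a)| = γ' * |v' a - u a| := fun a => by
    rw [abs_mul, abs_of_nonneg hγ']
  have hu0 : γ' * gapOf u (greedy u) = 0 := by rw [gapOf_greedy, mul_zero]
  have hfirst : ∀ a, γ' * gapOf u a ≤ 4 / 3 * (γ' * gapOf v' a) + (K + D) / 3
      + 16 / 3 * (γ' ^ 2 * Δ) := by
    intro a
    have h1 := herr a
    have h2 := herr (greedy u)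
    have h3 : γ' * v' (greedy u) ≤ γ' * v' (greedy v') :=
      mul_le_mul_of_nonneg_left (le_greedy v' _) hγ'
    have h4 := (abs_le.1 (hdiff a).le).2
    have h5 := (abs_le.1 (hdiff (greedy u)).le).1
    rw [hu0] at h2
    unfold gapOf at *
    linarith
  refine Finset.sup'_le _ _ fun a _ => max_le ?_ ?_
  · have h1 := hfirst a
    have h2 := mul_nonneg hγ' (gapOf_nonneg v' a)
    have h3 := gapDistortion_nonneg hγ u v
    have h4 : (0 : ℝ) ≤ K := Nat.cast_nonneg K
    have h5 : 0 ≤ γ' ^ 2 * Δ := by positivity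
    change 0 ≤ D at h3
    linarith
  · have h1 := herr a
    have h2 := herr (greedy v')
    have h3 := hfirst (greedy v')
    have h4 : γ' * u (greedy v') ≤ γ' * u (greedy u) :=
      mul_le_mul_of_nonneg_left (le_greedy u _) hγ'
    have h5 := (abs_le.1 (hdiff a).le).1
    have h6 := (abs_le.1 (hdiff (greedy v')).le).2
    have h7 : γ' * gapOf v' (greedy v') = 0 := by rw [gapOf_greedy, mul_zero]
    rw [h7] at h3
    have h8 := mul_nonneg hγ' (gapOf_nonneg u a)
    have h9 := gapDistortion_nonneg hγ u v
    have h10 : (0 : ℝ) ≤ K := Nat.cast_nonneg K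
    have h11 : 0 ≤ γ' ^ 2 * Δ := by positivity
    change 0 ≤ D at h9
    unfold gapOf at *
    linarith

/-- Loss of inverse gap weighting with estimate `v` for the true rewards `u`. -/
lemma mul_sum_igw_mul_gapOf_le (u v : Fin K → ℝ) :
    γ * ∑ a, igw γ v a * gapOf u a ≤ 2 * K + gapDistortion γ u v := by
  have h := igw_mem_stdSimplex hγ v
  calc γ * ∑ a, igw γ v a * gapOf u a = ∑ a, igw γ v a * (γ * gapOf u a) := by
        rw [Finset.mul_sum]
        exact Finset.sum_congr rfl fun a _ => by ring
    _ ≤ ∑ a, igw γ v a * (2 * (γ * gapOf v a) + gapDistortion γ u v) := by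
        refine Finset.sum_le_sum fun a _ => ?_
        exact mul_le_mul_of_nonneg_left (mul_gapOf_le_left γ u v a) (h.1 a)
    _ = 2 * ∑ a, igw γ v a * (γ * gapOf v a) + gapDistortion γ u v := by
        simp_rw [mul_add]
        rw [Finset.sum_add_distrib, ← Finset.sum_mul, h.2, one_mul, Finset.mul_sum]
        congr 1
        exact Finset.sum_congr rfl fun a _ => by ring
    _ ≤ 2 * K + gapDistortion γ u v := by
        have := sum_igw_mul_gapOf_le hγ v
        linarith

end InverseGap

namespace Bandit

variable {M K : ℕ} {X : Fin M → Type*} [∀ m, MeasurableSpace (X m)] {P : Bandit M K X}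
  {n : ℕ} {μω βα ββ σ G : ℝ}

/-! ### Mean rewards and gaps -/

lemma measurable_meanReward (P : Bandit M K X) (m : Fin M) : Measurable (P.meanReward m) :=
  measurable_pi_iff.2 fun a =>
    ((measurable_pi_apply a).stronglyMeasurable.integral_kernel
      (κ := (P.D m).condKernel)).measurable

lemma ae_meanReward_mem (hP : P.Regular) (m : Fin M) :
    ∀ᵐ x ∂(P.D m).fst, ∀ a, P.meanReward m x a ∈ Set.Icc (0 : ℝ) 1 := by
  have h1 := hP.reward_mem m
  rw [← (P.D m).disintegrate (P.D m).condKernel] at h1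
  filter_upwards [Measure.ae_ae_of_ae_compProd h1] with x hx a
  have h0 : 0 ≤ᵐ[(P.D m).condKernel x] fun r => r a := hx.mono fun r hr => (hr a).1
  refine ⟨integral_nonneg_of_ae h0, ?_⟩
  have h2 := integral_mono_of_nonneg h0 (integrable_const (1 : ℝ))
    (hx.mono fun r hr => (hr a).2)
  rw [integral_const, probReal_univ, one_smul] at h2
  exact h2

section Gap

variable [NeZero K]

lemma gap_nonneg (P : Bandit M K X) (m : Fin M) (x : X m) (a : Fin K) : 0 ≤ P.gap m x a :=
  gapOf_nonneg _ a

lemma measurable_gap (P : Bandit M K X) (m : Fin M) (a : Fin K) :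
    Measurable fun x => P.gap m x a :=
  (measurable_gapOf a).comp (P.measurable_meanReward m)

lemma ae_gap_le_one (hP : P.Regular) (m : Fin M) : ∀ᵐ x ∂(P.D m).fst, ∀ a, P.gap m x a ≤ 1 := by
  filter_upwards [ae_meanReward_mem hP m] with x hx a
  have h1 := (hx (greedy (P.meanReward m x))).2
  have h2 := (hx a).1
  unfold gap
  linarith

end Gap

/-! ### Complexity and learning rates -/

/-- Without agents or without samples every sum in the complexity is `0`. The supremum over the
laws of the data may then be one over the empty set, which has the value `0` as well. -/
lemma rademacher_nonpos (P : Bandit M K X) (h : (M : ℝ) * n = 0) : P.rademacher n ≤ 0 := by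
  refine Real.sSup_nonpos ?_
  rintro v ⟨D', p, -, -, -, -, rfl⟩
  simp [rademacherAt, h]

lemma learningRate_nonneg (P : Bandit M K X) (τ : ℕ → ℕ) (μf : ℝ) (l : ℕ) :
    0 ≤ P.learningRate τ μf l := Real.sqrt_nonneg _

/-- The first epoch explores uniformly: its learning rate refers to an epoch of length `0`, whose
complexity is at most `0`, and a nonpositive quotient has the square root `0`. -/
lemma learningRate_one (P : Bandit M K X) (τ : ℕ → ℕ) {μf : ℝ} (hμf : 0 < μf) :
    P.learningRate τ μf 1 = 0 := by
  refine Real.sqrt_eq_zero_of_nonpos (div_nonpos_of_nonneg_of_nonpos (by positivity) ?_)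
  exact P.rademacher_nonpos (by simp [epochLength])

lemma learningRate_succ_sq (P : Bandit M K X) {τ : ℕ → ℕ} {μf : ℝ} (hμf : 0 < μf) {l : ℕ}
    (hR : 0 < P.rademacher (epochLength τ l)) :
    P.learningRate τ μf (l + 1) ^ 2 = K * μf / P.rademacher (epochLength τ l) :=
  Real.sq_sqrt (by rw [Nat.add_sub_cancel]; positivity)

lemma learningRate_succ_pos [NeZero K] (P : Bandit M K X) {τ : ℕ → ℕ} {μf : ℝ} (hμf : 0 < μf)
    {l : ℕ} (hR : 0 < P.rademacher (epochLength τ l)) : 0 < P.learningRate τ μf (l + 1) := by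
  have hK : (0 : ℝ) < K := by exact_mod_cast NeZero.pos K
  exact Real.sqrt_pos.2 (by rw [Nat.add_sub_cancel]; positivity)

/-- The mean regret of a step of epoch `l + 1` is of the order of the number of arms divided by the
learning rate. -/
lemma div_learningRate_succ [NeZero K] (P : Bandit M K X) {τ : ℕ → ℕ} {μf : ℝ} (hμf : 0 < μf)
    {l : ℕ} (hR : 0 < P.rademacher (epochLength τ l)) :
    K / P.learningRate τ μf (l + 1) = √(K * P.rademacher (epochLength τ l) / μf) := by
  rw [div_eq_iff (P.learningRate_succ_pos hμf hR).ne', learningRate, Nat.add_sub_cancel,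
    ← Real.sqrt_mul (by positivity)]
  have e : K * P.rademacher (epochLength τ l) / μf
      * (K * μf / P.rademacher (epochLength τ l)) = (K : ℝ) ^ 2 := by field_simp
  rw [e, Real.sqrt_sq (Nat.cast_nonneg K)]

/-! ### The distortion over one epoch -/

section Epoch

variable [NeZero K] {α : P.Shared} {b : ∀ m, P.Personal m} {μf : ℝ}

/-- Sum over the agents of the mean distortions of the gaps of the estimates `fhat` against the
gaps of the mean rewards. As a lower integral it is defined for all estimates. -/
noncomputable def distortion (P : Bandit M K X) (γ : ℝ) (fhat : ∀ m, X m → Fin K → ℝ) : ℝ≥0∞ :=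
  ∑ m, ∫⁻ x, ENNReal.ofReal (gapDistortion γ (P.meanReward m x) (fhat m x)) ∂(P.D m).fst

lemma measurable_igw_comp (γ : ℝ) {fhat : ∀ m, X m → Fin K → ℝ} (hf : ∀ m, Measurable (fhat m))
    (m : Fin M) (a : Fin K) : Measurable fun x => igw γ (fhat m x) a :=
  (measurable_igw γ a).comp (hf m)

/-- `gapDistortion_step_le` in the mean over the contexts. -/
lemma distortion_step_le (hP : P.Regular) (ht : P.TrueParameter α b) {γ γ' : ℝ} (hγ : 0 ≤ γ)
    (hγγ' : γ ≤ γ') {fhat : ∀ m, X m → Fin K → ℝ} (hf : ∀ m, Measurable (fhat m))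
    {α' : P.Shared} (hα' : α' ∈ P.Ωα) {b' : ∀ m, P.Personal m} (hb' : ∀ m, b' m ∈ P.Ωβ m) :
    P.distortion γ' (fun m x => P.f m α' (b' m) x)
      ≤ 2⁻¹ * P.distortion γ fhat + ENNReal.ofReal (M * K / 2)
        + ENNReal.ofReal (8 * γ' ^ 2)
          * ENNReal.ofReal (P.predictionError (fun m x => igw γ (fhat m x)) α' b' α b) := by
  obtain ⟨B, hB⟩ := hP.bounded_f
  set sqErr : ∀ m, X m → ℝ := fun m x =>
    ∑ a, igw γ (fhat m x) a * (P.f m α' (b' m) x a - P.f m α (b m) x a) ^ 2 with hsq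
  have hsqm : ∀ m, Measurable (sqErr m) := fun m => Finset.measurable_fun_sum _ fun a _ =>
    (measurable_igw_comp γ hf m a).mul
      (((measurable_f_apply hP m _ _ a).sub (measurable_f_apply hP m _ _ a)).pow_const 2)
  have hsq0 : ∀ m x, 0 ≤ sqErr m x := fun m x => Finset.sum_nonneg fun a _ =>
    mul_nonneg ((igw_mem_stdSimplex hγ (fhat m x)).1 a) (sq_nonneg _)
  have hsqint : ∀ m, Integrable (sqErr m) (P.D m).fst := by
    intro m
    refine Integrable.of_bound (hsqm m).aestronglyMeasurable ((2 * B) ^ 2) (.of_forall fun x => ?_)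
    have hw := igw_mem_stdSimplex hγ (fhat m x)
    rw [Real.norm_of_nonneg (hsq0 m x)]
    calc sqErr m x ≤ ∑ a, igw γ (fhat m x) a * (2 * B) ^ 2 := by
          refine Finset.sum_le_sum fun a _ => mul_le_mul_of_nonneg_left ?_ (hw.1 a)
          refine sq_le_sq' ?_ ?_ <;>
          · have h1 := abs_le.1 (hB m α' hα' _ (hb' m) x a)
            have h2 := abs_le.1 (hB m α ht.memα _ (ht.memβ m) x a)
            linarith
      _ = (2 * B) ^ 2 := by rw [← Finset.sum_mul, hw.2, one_mul]
  have hagent : ∀ m, ∫⁻ x, ENNReal.ofReal (gapDistortion γ' (P.meanReward m x)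
        (P.f m α' (b' m) x)) ∂(P.D m).fst
      ≤ 2⁻¹ * ∫⁻ x, ENNReal.ofReal (gapDistortion γ (P.meanReward m x) (fhat m x)) ∂(P.D m).fst
        + ENNReal.ofReal (K / 2)
        + ENNReal.ofReal (8 * γ' ^ 2) * ENNReal.ofReal (∫ x, sqErr m x ∂(P.D m).fst) := by
    intro m
    calc ∫⁻ x, ENNReal.ofReal (gapDistortion γ' (P.meanReward m x)
          (P.f m α' (b' m) x)) ∂(P.D m).fst
        ≤ ∫⁻ x, (2⁻¹ * ENNReal.ofReal (gapDistortion γ (P.meanReward m x) (fhat m x))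
            + ENNReal.ofReal (K / 2)
            + ENNReal.ofReal (8 * γ' ^ 2) * ENNReal.ofReal (sqErr m x)) ∂(P.D m).fst := by
          refine lintegral_mono_ae ?_
          filter_upwards [ht.realizable m] with x hx
          have h1 := gapDistortion_step_le hγ hγγ' (P.meanReward m x) (fhat m x)
            (P.f m α' (b' m) x)
          have h2 : ∑ a, igw γ (fhat m x) a * (P.f m α' (b' m) x a - P.meanReward m x a) ^ 2
              = sqErr m x := Finset.sum_congr rfl fun a _ => by rw [hx a]
          have h3 := gapDistortion_nonneg hγ (P.meanReward m x) (fhat m x)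
          have h4 : (2⁻¹ : ℝ≥0∞) = ENNReal.ofReal 2⁻¹ := by
            rw [ENNReal.ofReal_inv_of_pos two_pos, ENNReal.ofReal_ofNat]
          rw [h2] at h1
          rw [h4, ← ENNReal.ofReal_mul (by norm_num), ← ENNReal.ofReal_mul (by positivity),
            ← ENNReal.ofReal_add (by positivity) (by positivity),
            ← ENNReal.ofReal_add (by positivity) (mul_nonneg (by positivity) (hsq0 m x))]
          refine ENNReal.ofReal_le_ofReal ?_
          linarith
      _ = _ := by
          rw [lintegral_add_right _ ((hsqm m).ennreal_ofReal.const_mul _),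
            lintegral_add_right _ measurable_const, lintegral_const_mul' _ _ (by simp),
            lintegral_const_mul' _ _ ENNReal.ofReal_ne_top, lintegral_const, measure_univ, mul_one,
            ofReal_integral_eq_lintegral_ofReal (hsqint m) (.of_forall (hsq0 m))]
  calc P.distortion γ' (fun m x => P.f m α' (b' m) x)
      ≤ ∑ m, (2⁻¹ * ∫⁻ x, ENNReal.ofReal (gapDistortion γ (P.meanReward m x) (fhat m x))
            ∂(P.D m).fst
          + ENNReal.ofReal (K / 2)
          + ENNReal.ofReal (8 * γ' ^ 2) * ENNReal.ofReal (∫ x, sqErr m x ∂(P.D m).fst)) :=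
        Finset.sum_le_sum fun m _ => hagent m
    _ = _ := by
        rw [Finset.sum_add_distrib, Finset.sum_add_distrib, ← Finset.mul_sum, ← Finset.mul_sum,
          ← ENNReal.ofReal_sum_of_nonneg fun m _ => integral_nonneg (hsq0 m),
          ← ENNReal.ofReal_sum_of_nonneg fun m _ => by positivity]
        congr 3
        simp only [Finset.sum_const, Finset.card_univ, Fintype.card_fin, nsmul_eq_mul]
        rw [mul_div_assoc]

variable {τ κ : ℕ → ℕ} {c : ℕ → Tuning} {γ : ℕ → ℝ}

lemma isProbabilityMeasure_epochLawGiven {l : ℕ} (hE : NeZero (epochLength τ l)) (hγ : 0 ≤ γ l)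
    {fhat : ∀ m, X m → Fin K → ℝ} (hf : ∀ m, Measurable (fhat m)) :
    IsProbabilityMeasure (P.epochLawGiven τ κ c γ l fhat) := by
  have h1 : IsProbabilityMeasure (datasetLaw (epochLength τ l) P.D
      fun m x => igw (γ l) (fhat m x)) :=
    isProbabilityMeasure_datasetLaw (measurable_igw_comp _ hf) fun m x => igw_mem_stdSimplex hγ _
  have h2 : IsProbabilityMeasure (uniformOn (Set.univ :
      Set (Fin M → Fin ((c l).rounds * κ l) → Fin (epochLength τ l)))) :=
    isProbabilityMeasure_uniformOn Set.finite_univ Set.univ_nonempty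
  unfold epochLawGiven
  infer_instance

omit [NeZero K] in
lemma measurable_estimate (hP : P.Regular) (l : ℕ) (d : P.EpochData τ κ c l) (m : Fin M) :
    Measurable (P.estimate τ κ c l d m) :=
  measurable_pi_iff.2 fun a => measurable_f_apply hP m _ _ a

/-- Given the estimates of the previous epoch, the regret of an epoch is the number of its steps
times the mean loss of inverse gap weighting. -/
lemma lintegral_regret_epochLawGiven_le {l : ℕ} (hE : NeZero (epochLength τ l)) (hγ : 0 ≤ γ l)
    {fhat : ∀ m, X m → Fin K → ℝ} (hf : ∀ m, Measurable (fhat m)) :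
    ∫⁻ d, ∑ m, ∑ i : Fin (epochLength τ l), ENNReal.ofReal (P.gap m (d.1 m i).1 (d.1 m i).2.1)
        ∂P.epochLawGiven τ κ c γ l fhat
      ≤ epochLength τ l * ∑ m, ∫⁻ x, ENNReal.ofReal
        (∑ a, igw (γ l) (fhat m x) a * P.gap m x a) ∂(P.D m).fst := by
  have hp := measurable_igw_comp (γ l) hf
  have hp1 : ∀ m x, igw (γ l) (fhat m x) ∈ stdSimplex ℝ (Fin K) := fun m x =>
    igw_mem_stdSimplex hγ _
  have hgm : ∀ m, Measurable fun s : X m × Fin K × ℝ => ENNReal.ofReal (P.gap m s.1 s.2.1) := by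
    intro m
    have h1 : Measurable fun q : X m × Fin K => P.gap m q.1 q.2 :=
      measurable_from_prod_countable_left fun a => P.measurable_gap m a
    exact (h1.comp (measurable_fst.prodMk (measurable_fst.comp measurable_snd))).ennreal_ofReal
  have hmp := fun m (i : Fin (epochLength τ l)) => measurePreserving_sample (D := P.D) hp hp1 m i
  have hone : ∀ m (i : Fin (epochLength τ l)), ∫⁻ S : Dataset K X (epochLength τ l),
      ENNReal.ofReal (P.gap m (S m i).1 (S m i).2.1)
        ∂datasetLaw (epochLength τ l) P.D (fun m x => igw (γ l) (fhat m x))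
      = ∫⁻ x, ENNReal.ofReal (∑ a, igw (γ l) (fhat m x) a * P.gap m x a) ∂(P.D m).fst := by
    intro m i
    have hsum : Measurable fun x => ENNReal.ofReal (∑ a, igw (γ l) (fhat m x) a * P.gap m x a) :=
      (Finset.measurable_fun_sum _ fun a _ => (hp m a).mul (P.measurable_gap m a)).ennreal_ofReal
    rw [(hmp m i).lintegral_comp (hgm m), lintegral_sampleLaw (hp m) (hgm m), Measure.fst,
      lintegral_map hsum measurable_fst]
    refine lintegral_congr fun z => ?_
    rw [ENNReal.ofReal_sum_of_nonneg fun a _ =>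
      mul_nonneg ((hp1 m z.1).1 a) (P.gap_nonneg m z.1 a)]
    exact Finset.sum_congr rfl fun a _ => (ENNReal.ofReal_mul ((hp1 m z.1).1 a)).symm
  have h2 : IsProbabilityMeasure (uniformOn (Set.univ :
      Set (Fin M → Fin ((c l).rounds * κ l) → Fin (epochLength τ l)))) :=
    isProbabilityMeasure_uniformOn Set.finite_univ Set.univ_nonempty
  have hgS : ∀ m (i : Fin (epochLength τ l)), Measurable fun S : Dataset K X (epochLength τ l) =>
      ENNReal.ofReal (P.gap m (S m i).1 (S m i).2.1) := fun m i =>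
    (hgm m).comp (hmp m i).measurable
  refine (lintegral_prod_le _).trans ?_
  simp only [lintegral_const, measure_univ, mul_one]
  rw [lintegral_finsetSum _ fun m _ => Finset.measurable_fun_sum _ fun i _ =>
    hgS m i, Finset.mul_sum]
  refine Finset.sum_le_sum fun m _ => ?_
  rw [lintegral_finsetSum _ fun i _ => hgS m i]
  simp only [hone, Finset.sum_const, Finset.card_univ, Fintype.card_fin, nsmul_eq_mul, le_refl]

/-- In an epoch with a positive learning rate, the regret is controlled by the distortion of the
estimates that the epoch uses. -/
lemma lintegral_regret_le_distortion {l : ℕ} (hE : NeZero (epochLength τ l)) (hγ : 0 < γ l)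
    {fhat : ∀ m, X m → Fin K → ℝ} (hf : ∀ m, Measurable (fhat m)) :
    ∫⁻ d, ∑ m, ∑ i : Fin (epochLength τ l), ENNReal.ofReal (P.gap m (d.1 m i).1 (d.1 m i).2.1)
        ∂P.epochLawGiven τ κ c γ l fhat
      ≤ epochLength τ l * (ENNReal.ofReal (1 / γ l)
        * (ENNReal.ofReal (2 * M * K) + P.distortion (γ l) fhat)) := by
  refine (lintegral_regret_epochLawGiven_le hE hγ.le hf).trans ?_
  gcongr
  have hagent : ∀ m, ∫⁻ x, ENNReal.ofReal (∑ a, igw (γ l) (fhat m x) a * P.gap m x a) ∂(P.D m).fst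
      ≤ ENNReal.ofReal (1 / γ l) * (ENNReal.ofReal (2 * K)
        + ∫⁻ x, ENNReal.ofReal (gapDistortion (γ l) (P.meanReward m x) (fhat m x))
          ∂(P.D m).fst) := by
    intro m
    calc _ ≤ ∫⁻ x, ENNReal.ofReal (1 / γ l) * (ENNReal.ofReal (2 * K)
          + ENNReal.ofReal (gapDistortion (γ l) (P.meanReward m x) (fhat m x))) ∂(P.D m).fst := by
          refine lintegral_mono fun x => ?_
          dsimp only
          have h1 := mul_sum_igw_mul_gapOf_le hγ.le (P.meanReward m x) (fhat m x)
          have h2 := gapDistortion_nonneg hγ.le (P.meanReward m x) (fhat m x)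
          rw [← ENNReal.ofReal_add (by positivity) h2, ← ENNReal.ofReal_mul (by positivity)]
          refine ENNReal.ofReal_le_ofReal ?_
          rw [one_div_mul_eq_div, le_div_iff₀ hγ, mul_comm]
          exact h1
      _ = _ := by
          rw [lintegral_const_mul' _ _ ENNReal.ofReal_ne_top,
            lintegral_add_left measurable_const, lintegral_const, measure_univ, mul_one]
  refine (Finset.sum_le_sum fun m _ => hagent m).trans_eq ?_
  rw [← Finset.mul_sum, Finset.sum_add_distrib, ← ENNReal.ofReal_sum_of_nonneg
    fun m _ => by positivity]
  congr 3
  simp only [Finset.sum_const, Finset.card_univ, Fintype.card_fin, nsmul_eq_mul]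
  ring

/-- Mean rewards in `[0, 1]` bound the regret of any epoch by its number of steps. -/
lemma lintegral_regret_le_epochLength (hP : P.Regular) {l : ℕ} (hE : NeZero (epochLength τ l))
    (hγ : 0 ≤ γ l) {fhat : ∀ m, X m → Fin K → ℝ} (hf : ∀ m, Measurable (fhat m)) :
    ∫⁻ d, ∑ m, ∑ i : Fin (epochLength τ l), ENNReal.ofReal (P.gap m (d.1 m i).1 (d.1 m i).2.1)
        ∂P.epochLawGiven τ κ c γ l fhat ≤ epochLength τ l * M := by
  refine (lintegral_regret_epochLawGiven_le hE hγ hf).trans ?_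
  gcongr
  calc _ ≤ ∑ _m : Fin M, (1 : ℝ≥0∞) := by
        refine Finset.sum_le_sum fun m _ => ?_
        calc _ ≤ ∫⁻ _x, 1 ∂(P.D m).fst := by
              refine lintegral_mono_ae ?_
              filter_upwards [ae_gap_le_one hP m] with x hx
              have hw := igw_mem_stdSimplex hγ (fhat m x)
              rw [← ENNReal.ofReal_one, ← hw.2]
              exact ENNReal.ofReal_le_ofReal (Finset.sum_le_sum fun a _ =>
                mul_le_of_le_one_right (hw.1 a) (hx a))
          _ = 1 := by simp
    _ = M := by simp

end Epoch

end Bandit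

namespace Bandit

variable {M K : ℕ} {X : Fin M → Type*} [∀ m, MeasurableSpace (X m)] {P : Bandit M K X}
  {μω βα ββ σ G : ℝ}

/-! ### The regret of all epochs -/

/-- Positive complexity and the conditions on the protocol make its tuning admissible. -/
lemma admissible_of_rademacher_pos {n κ : ℕ} (hP : P.Regular)
    (h : P.LSGDCondition n κ μω βα ββ σ G) (hκ : 1 ≤ κ) (hμω : 0 < μω) (hβα : 0 < βα)
    (hββ : 0 < ββ) (hR : 0 < P.rademacher n) (hK : 0 < K) :
    Constants.Admissible ⟨M, κ, μω, βα, ββ, σ, G, P.rademacher n⟩ := by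
  have hM : 0 < M := by
    by_contra h0
    obtain rfl : M = 0 := by omega
    exact absurd hR (P.rademacher_nonpos (by simp)).not_gt
  have hX : ∀ m, Nonempty (X m) := fun m =>
    ((P.D m).nonempty_of_neZero).map Prod.fst
  let S : Dataset K X n := fun m _ => ((hX m).some, ⟨0, hK⟩, 0)
  have hS : S.Valid := fun m i => ⟨le_rfl, zero_le_one⟩
  exact ⟨hM, hκ, hμω, hβα, hββ, hR, h.strongConvexity_le_smoothness hM hP.shared_pos hμω hβα hS⟩

/-- The tuning of the protocol in each epoch, with the complexity as the target. -/
noncomputable abbrev epochTuning (P : Bandit M K X) (τ κ : ℕ → ℕ) (μω βα ββ σ G : ℝ) (l : ℕ) :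
    Tuning :=
  tuning ⟨M, κ l, μω, βα, ββ, σ, G, P.rademacher (epochLength τ l)⟩

variable [NeZero K] {α : P.Shared} {b : ∀ m, P.Personal m} {μf : ℝ} {τ κ : ℕ → ℕ}

lemma measure_univ_epochLaw_le (hP : P.Regular) {c : ℕ → Tuning} {γ : ℕ → ℝ}
    (hE : ∀ l, 1 ≤ l → NeZero (epochLength τ l)) (hγ : ∀ l, 0 ≤ γ l) :
    ∀ l, P.epochLaw τ κ c γ l Set.univ ≤ 1
  | 0 => by simp [epochLaw]
  | 1 => by
    have := isProbabilityMeasure_epochLawGiven (P := P) (κ := κ) (c := c) (hE 1 le_rfl) (hγ 1)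
      (fhat := fun _ _ _ => 0) fun m => measurable_const
    exact prob_le_one (μ := P.epochLawGiven τ κ c γ 1 fun _ _ _ => 0)
  | l + 2 => by
    rw [← lintegral_one]
    refine (Measure.lintegral_bind_le _ _ _).trans ?_
    calc _ = ∫⁻ _, 1 ∂P.epochLaw τ κ c γ (l + 1) := by
          refine lintegral_congr fun d => ?_
          have := isProbabilityMeasure_epochLawGiven (P := P) (κ := κ) (c := c)
            (hE (l + 2) (by omega)) (hγ _) fun m => measurable_estimate hP (l + 1) d m
          rw [lintegral_one, measure_univ]
      _ ≤ 1 := by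
          rw [lintegral_one]
          exact measure_univ_epochLaw_le hP hE hγ (l + 1)

section Run

variable (hP : P.Regular) (ht : P.TrueParameter α b) (hL : P.LossCondition α b μf) (hμf : 0 < μf)
  (hE : ∀ l, 1 ≤ l → NeZero (epochLength τ l))
  (h : ∀ l, 1 ≤ l → P.LSGDCondition (epochLength τ l) (κ l) μω βα ββ σ G)
  (hc : ∀ l, 1 ≤ l → Constants.Admissible
    ⟨M, κ l, μω, βα, ββ, σ, G, P.rademacher (epochLength τ l)⟩)
  (hγ : ∀ l, 1 ≤ l → P.learningRate τ μf l ≤ P.learningRate τ μf (l + 1))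
include hP ht hL hμf hE h hc hγ

/-- Mean distortion after an epoch. The learning rate is chosen such that the estimation error,
scaled by its square, is of the order of the number of arms. -/
lemma lintegral_distortion_epochLawGiven_le {l : ℕ} (hl : 1 ≤ l)
    {fhat : ∀ m, X m → Fin K → ℝ} (hf : ∀ m, Measurable (fhat m)) :
    ∫⁻ d, P.distortion (P.learningRate τ μf (l + 1))
        (P.estimate τ κ (P.epochTuning τ κ μω βα ββ σ G) l d)
        ∂P.epochLawGiven τ κ (P.epochTuning τ κ μω βα ββ σ G) (P.learningRate τ μf) l fhat
      ≤ 2⁻¹ * P.distortion (P.learningRate τ μf l) fhat + ENNReal.ofReal (833 * (M * K)) := by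
  have := hE l hl
  set γ := P.learningRate τ μf with hγdef
  have hγ0 : ∀ l, 0 ≤ γ l := P.learningRate_nonneg τ μf
  have hR : 0 < P.rademacher (epochLength τ l) := (hc l hl).target_pos
  have hp := measurable_igw_comp (γ l) hf
  have hp1 : ∀ m x, igw (γ l) (fhat m x) ∈ stdSimplex ℝ (Fin K) := fun m x =>
    igw_mem_stdSimplex (hγ0 l) _
  have hprob := isProbabilityMeasure_epochLawGiven (P := P) (κ := κ)
    (c := P.epochTuning τ κ μω βα ββ σ G) this (hγ0 l) hf
  have hvalid : ∀ᵐ d ∂P.epochLawGiven τ κ (P.epochTuning τ κ μω βα ββ σ G) γ l fhat,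
      Dataset.Valid d.1 :=
    Measure.quasiMeasurePreserving_fst.ae (ae_valid_datasetLaw hp hp1 hP.reward_mem)
  have herr := lintegral_predictionError_output_le hP ht hL hμf (h l hl) (hc l hl) hp hp1
  have hK : (0 : ℝ) ≤ K := Nat.cast_nonneg K
  have hM : (0 : ℝ) ≤ M := Nat.cast_nonneg M
  calc _ ≤ ∫⁻ d, (2⁻¹ * P.distortion (γ l) fhat + ENNReal.ofReal (M * K / 2)
          + ENNReal.ofReal (8 * γ (l + 1) ^ 2)
            * ENNReal.ofReal (P.predictionError (fun m x => igw (γ l) (fhat m x))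
              (P.outputα d.1 (κ l) (P.epochTuning τ κ μω βα ββ σ G l) d.2)
              (P.outputβ d.1 (κ l) (P.epochTuning τ κ μω βα ββ σ G l) d.2) α b))
        ∂P.epochLawGiven τ κ (P.epochTuning τ κ μω βα ββ σ G) γ l fhat := by
        refine lintegral_mono_ae ?_
        filter_upwards [hvalid] with d hd
        obtain ⟨hα', hβ'⟩ := output_mem hP (hc l hl).M_pos (P.epochTuning τ κ μω βα ββ σ G l)
          (rounds_mul_pos (hc l hl)) d.2 (stays_of_admissible (h l hl) (hc l hl) hd _ d.2)
        exact distortion_step_le hP ht (hγ0 l) (hγ l hl) hf hα' hβ'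
    _ ≤ 2⁻¹ * P.distortion (γ l) fhat + ENNReal.ofReal (M * K / 2)
          + ENNReal.ofReal (8 * γ (l + 1) ^ 2)
            * ENNReal.ofReal (104 * M * P.rademacher (epochLength τ l) / μf) := by
        rw [lintegral_add_left measurable_const, lintegral_const, measure_univ, mul_one,
          lintegral_const_mul' _ _ ENNReal.ofReal_ne_top]
        gcongr
        exact herr
    _ ≤ _ := by
        rw [add_assoc]
        gcongr
        rw [← ENNReal.ofReal_mul (by positivity), ← ENNReal.ofReal_add (by positivity)
          (by positivity), hγdef, P.learningRate_succ_sq hμf hR]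
        refine ENNReal.ofReal_le_ofReal ?_
        have e : 8 * (K * μf / P.rademacher (epochLength τ l))
            * (104 * M * P.rademacher (epochLength τ l) / μf) = 832 * (M * K) := by
          field_simp
          ring
        rw [e]
        have := mul_nonneg hM hK
        linarith

/-- The mean distortion stays bounded over all epochs, since each epoch halves it: the bound
`1666 = 2 * 833` is the fixed point of the recursion. -/
lemma lintegral_distortion_epochLaw_le : ∀ l,
    ∫⁻ d, P.distortion (P.learningRate τ μf (l + 2))
        (P.estimate τ κ (P.epochTuning τ κ μω βα ββ σ G) (l + 1) d)
        ∂P.epochLaw τ κ (P.epochTuning τ κ μω βα ββ σ G) (P.learningRate τ μf) (l + 1)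
      ≤ ENNReal.ofReal (1666 * (M * K))
  | 0 => by
    have h1 := lintegral_distortion_epochLawGiven_le hP ht hL hμf hE h hc hγ le_rfl
      (fhat := fun _ _ _ => 0) fun m => measurable_const
    have h2 : P.distortion (P.learningRate τ μf 1) (fun _ _ _ => 0) = 0 := by
      simp [distortion, P.learningRate_one τ hμf, gapDistortion_zero]
    rw [h2, mul_zero, zero_add] at h1
    refine h1.trans (ENNReal.ofReal_le_ofReal ?_)
    have : (0 : ℝ) ≤ M * K := by positivity
    linarith
  | l + 1 => by
    set c := P.epochTuning τ κ μω βα ββ σ G with hcdef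
    set γ := P.learningRate τ μf with hγdef
    have ih := lintegral_distortion_epochLaw_le l
    have hmass := measure_univ_epochLaw_le (c := c) (κ := κ) hP hE
      (P.learningRate_nonneg τ μf) (l + 1)
    have hMK : (0 : ℝ) ≤ M * K := by positivity
    have h2 : (2⁻¹ : ℝ≥0∞) = ENNReal.ofReal 2⁻¹ := by
      rw [ENNReal.ofReal_inv_of_pos two_pos, ENNReal.ofReal_ofNat]
    calc _ ≤ ∫⁻ d, ∫⁻ d', P.distortion (γ (l + 3)) (P.estimate τ κ c (l + 2) d')
            ∂P.epochLawGiven τ κ c γ (l + 2) (P.estimate τ κ c (l + 1) d)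
            ∂P.epochLaw τ κ c γ (l + 1) := Measure.lintegral_bind_le _ _ _
      _ ≤ ∫⁻ d, (2⁻¹ * P.distortion (γ (l + 2)) (P.estimate τ κ c (l + 1) d)
            + ENNReal.ofReal (833 * (M * K))) ∂P.epochLaw τ κ c γ (l + 1) :=
          lintegral_mono fun d => lintegral_distortion_epochLawGiven_le hP ht hL hμf hE h hc hγ
            (by omega) fun m => measurable_estimate hP (l + 1) d m
      _ ≤ 2⁻¹ * ENNReal.ofReal (1666 * (M * K)) + ENNReal.ofReal (833 * (M * K)) * 1 := by
          rw [lintegral_add_right _ measurable_const, lintegral_const,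
            lintegral_const_mul' _ _ (by simp)]
          gcongr
      _ = _ := by
          rw [mul_one, h2, ← ENNReal.ofReal_mul (by norm_num),
            ← ENNReal.ofReal_add (by positivity) (by positivity)]
          congr 1
          ring

/-- The constant is the sum of the `1666` for the distortion and of the `2` for the loss of inverse
gap weighting with exact estimates. -/
lemma lintegral_regret_epochLaw_le (l : ℕ) :
    ∫⁻ d, ∑ m, ∑ i : Fin (epochLength τ (l + 2)),
        ENNReal.ofReal (P.gap m (d.1 m i).1 (d.1 m i).2.1)
        ∂P.epochLaw τ κ (P.epochTuning τ κ μω βα ββ σ G) (P.learningRate τ μf) (l + 2)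
      ≤ ENNReal.ofReal (1668 * (√(K * P.rademacher (epochLength τ (l + 1)) / μf)
        * (M * epochLength τ (l + 2)))) := by
  set c := P.epochTuning τ κ μω βα ββ σ G with hcdef
  set γ := P.learningRate τ μf with hγdef
  have hR : 0 < P.rademacher (epochLength τ (l + 1)) := (hc (l + 1) (by omega)).target_pos
  have hγpos : 0 < γ (l + 2) := P.learningRate_succ_pos hμf hR
  have hmass := measure_univ_epochLaw_le (c := c) (κ := κ) hP hE
    (P.learningRate_nonneg τ μf) (l + 1)
  have hdist := lintegral_distortion_epochLaw_le hP ht hL hμf hE h hc hγ l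
  calc _ ≤ ∫⁻ d, ∫⁻ d', ∑ m, ∑ i : Fin (epochLength τ (l + 2)),
            ENNReal.ofReal (P.gap m (d'.1 m i).1 (d'.1 m i).2.1)
          ∂P.epochLawGiven τ κ c γ (l + 2) (P.estimate τ κ c (l + 1) d)
          ∂P.epochLaw τ κ c γ (l + 1) := Measure.lintegral_bind_le _ _ _
    _ ≤ ∫⁻ d, epochLength τ (l + 2) * (ENNReal.ofReal (1 / γ (l + 2))
          * (ENNReal.ofReal (2 * M * K)
            + P.distortion (γ (l + 2)) (P.estimate τ κ c (l + 1) d)))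
          ∂P.epochLaw τ κ c γ (l + 1) :=
        lintegral_mono fun d => lintegral_regret_le_distortion (hE (l + 2) (by omega)) hγpos
          fun m => measurable_estimate hP (l + 1) d m
    _ ≤ epochLength τ (l + 2) * (ENNReal.ofReal (1 / γ (l + 2))
          * (ENNReal.ofReal (2 * M * K) * 1 + ENNReal.ofReal (1666 * (M * K)))) := by
        rw [lintegral_const_mul' _ _ (ENNReal.natCast_ne_top _),
          lintegral_const_mul' _ _ ENNReal.ofReal_ne_top,
          lintegral_add_left measurable_const, lintegral_const]
        gcongr
    _ = _ := by
        rw [mul_one, ← ENNReal.ofReal_natCast, ← ENNReal.ofReal_add (by positivity) (by positivity),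
          ← ENNReal.ofReal_mul (by positivity), ← ENNReal.ofReal_mul (by positivity),
          ← P.div_learningRate_succ hμf hR]
        congr 1
        change _ = 1668 * (K / γ (l + 2) * (M * epochLength τ (l + 2)))
        field_simp
        ring

end Run

/-- The regret in an epoch, with its time steps cut off at the horizon, is bounded by the lower
integral of the regret of the whole epoch. This requires no measurability of the estimates. -/
lemma integral_regret_le {c : ℕ → Tuning} {γ : ℕ → ℝ} {T l : ℕ} {C : ℝ} (hC : 0 ≤ C)
    (hle : ∫⁻ d, ∑ m, ∑ i : Fin (epochLength τ l),
        ENNReal.ofReal (P.gap m (d.1 m i).1 (d.1 m i).2.1) ∂P.epochLaw τ κ c γ l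
      ≤ ENNReal.ofReal C) :
    ∫ d, ∑ m, ∑ i : Fin (epochLength τ l),
      (if τ (l - 1) + i + 1 ≤ T then P.gap m (d.1 m i).1 (d.1 m i).2.1 else 0)
      ∂P.epochLaw τ κ c γ l ≤ C := by
  refine (Real.le_norm_self _).trans ((norm_integral_le_lintegral_norm _).trans ?_)
  refine ENNReal.toReal_le_of_le_ofReal hC (le_trans (lintegral_mono fun d => ?_) hle)
  have hite : ∀ m (i : Fin (epochLength τ l)),
      0 ≤ (if τ (l - 1) + i + 1 ≤ T then P.gap m (d.1 m i).1 (d.1 m i).2.1 else 0) := fun m i => by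
    split_ifs
    exacts [P.gap_nonneg _ _ _, le_rfl]
  dsimp only
  rw [Real.norm_of_nonneg (Finset.sum_nonneg fun m _ => Finset.sum_nonneg fun i _ => hite m i),
    ENNReal.ofReal_sum_of_nonneg fun m _ => Finset.sum_nonneg fun i _ => hite m i]
  refine Finset.sum_le_sum fun m _ => ?_
  rw [ENNReal.ofReal_sum_of_nonneg fun i _ => hite m i]
  refine Finset.sum_le_sum fun i _ => ENNReal.ofReal_le_ofReal ?_
  split_ifs
  exacts [le_rfl, P.gap_nonneg _ _ _]

end Bandit

end FedIGW

theorem mainTheorem6 :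
    ∃ C : ℝ, 0 < C ∧ ∃ tune : FedIGW.Constants → FedIGW.Tuning,
      ∀ (M K : ℕ) [NeZero K] (X : Fin M → Type*) [∀ m, MeasurableSpace (X m)]
        (P : FedIGW.Bandit M K X) (α : P.Shared) (b : ∀ m, P.Personal m)
        (τ κ : ℕ → ℕ) (μf μω βα ββ σ G : ℝ),
        0 < μf → 0 < μω → 0 < βα → 0 < ββ → 0 ≤ σ → 0 ≤ G →
        P.Regular → P.TrueParameter α b → P.LossCondition α b μf →
        τ 0 = 0 → StrictMono τ → (∀ l, 1 ≤ κ l) →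
        (∀ l, 1 ≤ l → P.LSGDCondition (FedIGW.epochLength τ l) (κ l) μω βα ββ σ G) →
        (∀ l, 1 ≤ l → 0 < P.rademacher (FedIGW.epochLength τ l)) →
        (∀ l, 2 ≤ l → P.learningRate τ μf l ≤ P.learningRate τ μf (l + 1)) →
        ∀ T : ℕ,
          let E : ℕ → ℕ := FedIGW.epochLength τ
          let R : ℕ → ℝ := fun l => P.rademacher (E l)
          let L : ℕ := FedIGW.epochCount τ T
          let c : ℕ → FedIGW.Tuning := fun l => tune ⟨M, κ l, μω, βα, ββ, σ, G, R l⟩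
          P.regret τ κ c (P.learningRate τ μf) T
              ≤ C * ((M : ℝ) * E 1
                + ∑ l ∈ Finset.Icc 2 L, √(K * R (l - 1) / μf) * ((M : ℝ) * E l)) ∧
            (FedIGW.Bandit.communicationRounds τ c T : ℝ)
              ≤ C * ∑ l ∈ Finset.Icc 1 L, Real.log (2 + G ^ 2 / (μω * R l)) *
                (max (ββ / κ l) βα / μω + σ ^ 2 / (μω * κ l * M * R l)
                  + √(βα * (G ^ 2 + σ ^ 2) / (μω ^ 2 * R l))) := by
  refine ⟨1668, by norm_num, FedIGW.tuning, ?_⟩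
  intro M K _ X _ P α b τ κ μf μω βα ββ σ G hμf hμω hβα hββ hσ hG hP ht hL hτ0 hτ hκ h hR hγ T
    E R L c
  have hE : ∀ l, 1 ≤ l → NeZero (FedIGW.epochLength τ l) := fun l hl =>
    ⟨(Nat.sub_pos_of_lt (hτ (Nat.sub_lt hl one_pos))).ne'⟩
  have hc := fun l hl => FedIGW.Bandit.admissible_of_rademacher_pos hP (h l hl) (hκ l) hμω hβα hββ
    (hR l hl) (NeZero.pos K)
  constructor
  · have hγ' : ∀ l, 1 ≤ l → P.learningRate τ μf l ≤ P.learningRate τ μf (l + 1) := by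
      intro l hl
      obtain rfl | hl := hl.eq_or_lt
      · rw [P.learningRate_one τ hμf]
        exact P.learningRate_nonneg τ μf _
      · exact hγ l hl
    set B : ℕ → ℝ := fun l => 1668 * (√(K * R (l - 1) / μf) * ((M : ℝ) * E l)) with hB
    have hB0 : ∀ l, 0 ≤ B l := fun l => by positivity
    have hfirst : ∀ T, ∫ d, ∑ m, ∑ i : Fin (FedIGW.epochLength τ 1),
        (if τ (1 - 1) + i + 1 ≤ T then P.gap m (d.1 m i).1 (d.1 m i).2.1 else 0)
        ∂(P.epochLaw τ κ c (P.learningRate τ μf) 1) ≤ (M : ℝ) * E 1 := by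
      intro T
      refine FedIGW.Bandit.integral_regret_le (by positivity) ?_
      refine (FedIGW.Bandit.lintegral_regret_le_epochLength hP (hE 1 le_rfl)
        (P.learningRate_nonneg τ μf 1) fun m => measurable_const).trans_eq ?_
      rw [ENNReal.ofReal_mul (Nat.cast_nonneg M), ENNReal.ofReal_natCast, ENNReal.ofReal_natCast,
        mul_comm]
    have hlater : ∀ l ∈ Finset.Icc 2 L, ∫ d, ∑ m, ∑ i : Fin (FedIGW.epochLength τ l),
        (if τ (l - 1) + i + 1 ≤ T then P.gap m (d.1 m i).1 (d.1 m i).2.1 else 0)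
        ∂(P.epochLaw τ κ c (P.learningRate τ μf) l) ≤ B l := by
      intro l hl
      obtain ⟨l, rfl⟩ := Nat.exists_eq_add_of_le' (Finset.mem_Icc.1 hl).1
      exact FedIGW.Bandit.integral_regret_le (hB0 _)
        (FedIGW.Bandit.lintegral_regret_epochLaw_le hP ht hL hμf hE h hc hγ' l)
    have hME : 0 ≤ (M : ℝ) * E 1 := by positivity
    have hsum : 0 ≤ ∑ l ∈ Finset.Icc 2 L, B l := Finset.sum_nonneg fun l _ => hB0 l
    rw [mul_add, Finset.mul_sum]
    change _ ≤ 1668 * ((M : ℝ) * E 1) + ∑ l ∈ Finset.Icc 2 L, B l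
    unfold FedIGW.Bandit.regret
    change ∑ l ∈ Finset.Icc 1 L, _ ≤ _
    rcases Nat.eq_zero_or_pos L with hL0 | hLpos
    · rw [hL0, Finset.Icc_eq_empty (by norm_num), Finset.sum_empty, ← hL0]
      linarith
    · rw [← Finset.insert_Icc_add_one_left_eq_Icc hLpos, Finset.sum_insert (by simp)]
      refine (add_le_add (hfirst T) (Finset.sum_le_sum hlater)).trans ?_
      linarith
  · rw [FedIGW.Bandit.communicationRounds, Nat.cast_sum, Finset.mul_sum]
    refine Finset.sum_le_sum fun l hl => ?_
    have hl1 := (Finset.mem_Icc.1 hl).1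
    refine ((hc l hl1).rounds_le).trans ?_
    have hR' : 0 < R l := hR l hl1
    refine mul_le_mul_of_nonneg_right (by norm_num) (mul_nonneg (Real.log_nonneg ?_) ?_)
    · have : 0 ≤ G ^ 2 / (μω * R l) := by positivity
      change 1 ≤ 2 + G ^ 2 / (μω * R l)
      linarith
    · change 0 ≤ max (ββ / κ l) βα / μω + σ ^ 2 / (μω * κ l * M * R l)
        + √(βα * (G ^ 2 + σ ^ 2) / (μω ^ 2 * R l))
      positivity
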